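/- **Setting.** Let $K$ be a field together with a field homomorphism $\varphi:K\to\mathbb R$, through which elements of $K$ are read as real numbers, and suppose that $K$ is effective: its elements are written as natural numbers (by an encoding with decidable range in which distinct elements have distinct codes, so that equality is decidable), and addition, multiplication and division in $K$ are computable. (For example $K=\mathbb Q$.) All matrices and vectors given as inputs have entries in $K$ and are coded by finite lists of entries. For an alphabet $\Sigma$ (a nonempty finite set), an infinite word $w\in\Sigma^\omega$ and matrices $A_a$ $(a\in\Sigma)$, write $A_v=A_{v_1}\cdots A_{v_k}$ for $v=v_1\cdots v_k\in\Sigma^*$ (with $A_\epsilon$ the unit matrix) and $\mathrm{pref}_k(w)$ for the prefix of $w$ of length $k$. The family $\{A_a\mid a\in\Sigma\}$ is *stable* if $\lim_{k\to\infty}A_{\mathrm{pref}_k(w)}=0$ for every $w\in\Sigma^\omega$. A *weighted finite automaton* (WFA) $\mathcal A$ over $\Sigma$ with $n\ge 0$ states consists of an initial row vector $I$, a final column vector $F$, both of length $n$, and $n\times n$ weight matrices $A_a$ $(a\in\Sigma)$. It is *average preserving* (ap) if $\sum_{a\in\Sigma}A_aF=|\Sigma|\,F$. Its partial $\omega$-function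 is $$f_{\mathcal A}(w)=\lim_{k\to\infty}I\,A_{\mathrm{pref}_k(w)}\,F\qquad(w\in\Sigma^\omega),$$ undefined where the limit does not exist; $\Sigma^\omega$ carries the product (Cantor) topology. If $\Sigma=\{0,1\}$, its partial real function $\hat f_{\mathcal A}$ on $[0,1)$ is $\hat f_{\mathcal A}(x)=f_{\mathcal A}(\mathrm{bin}(x))$, where $\mathrm{bin}(x)$ is the binary expansion of $x$ that does not end in $1^\omega$. "Everywhere continuous" means defined at every point of $\Sigma^\omega$ (respectively $[0,1)$) and continuous there. Consider the decision problems: * **Matrix Product Stability.** *Input:* a nonempty finite family $\{A_a\mid a\in\Sigma\}$ of $n\times n$ matrices over $K$. *Question:* is it stable? * **Ap-WFA uniform continuity.** *Input:* an average preserving WFA $\mathcal A$ over the alphabet $\{0,1\}$ with entries in $K$. *Question:* are both $f_{\mathcal A}$ and $\hat f_{\mathcal A}$ everywhere continuous? **Theorem.** Matrix Product Stability and Ap-WFA uniform continuity are algorithmically (Turing) reducible to each other: each of the two problems is decidable by an algorithm that has access to an oracle for the other. -/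

import Mathlib

open Filter Topology
open scoped Matrix Computability

namespace ApWFA

noncomputable section

/-! ### Words and matrix products -/

/-- The prefix of length `k` of the infinite word `w`. -/
def pref {S : Type*} (w : ℕ → S) (k : ℕ) : List S := (List.range k).map w

/-- The matrix product `A_v = A_{v_1} A_{v_2} ⋯ A_{v_k}`; the empty word gives the unit matrix. -/
def wordMat {R S Q : Type*} [CommRing R] [Fintype Q] [DecidableEq Q]
    (A : S → Matrix Q Q R) (v : List S) : Matrix Q Q R := (v.map A).prod

/-- The family `{A_a | a ∈ S}` is stable: along every infinite word the products of the prefixes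
converge to the zero matrix. -/
def IsStable {S Q : Type*} [Fintype Q] [DecidableEq Q] (A : S → Matrix Q Q ℝ) : Prop :=
  ∀ w : ℕ → S, Tendsto (fun k => wordMat A (pref w k)) atTop (𝓝 0)

/-! ### Weighted finite automata -/

/-- A weighted finite automaton with weights in `R`, alphabet `S` and state set `Q`. -/
structure WFA (R S Q : Type*) where
  /-- initial distribution -/
  init : Q → R
  /-- final distribution -/
  final : Q → R
  /-- weight matrices -/
  wt : S → Matrix Q Q R

namespace WFA

/-- The word function `v ↦ I A_v F`. -/
def wordFun {R S Q : Type*} [CommRing R] [Fintype Q] [DecidableEq Q]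
    (𝒜 : WFA R S Q) (v : List S) : R :=
  𝒜.init ⬝ᵥ (wordMat 𝒜.wt v *ᵥ 𝒜.final)

/-- Average preservation: `∑_a A_a F = |S| F`. -/
def IsAveragePreserving {R S Q : Type*} [CommRing R] [Fintype S] [Fintype Q]
    (𝒜 : WFA R S Q) : Prop :=
  ∑ a, 𝒜.wt a *ᵥ 𝒜.final = (Fintype.card S : R) • 𝒜.final

/-- The same automaton with its weights read in another ring. -/
def map {R R' S Q : Type*} [CommRing R] [CommRing R'] (φ : R →+* R') (𝒜 : WFA R S Q) :
    WFA R' S Q where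
  init q := φ (𝒜.init q)
  final q := φ (𝒜.final q)
  wt a := (𝒜.wt a).map φ

end WFA

/-- The (partial) `ω`-function of a word function `F`: its value at `w` is the limit of
`F (pref w k)` as `k → ∞`, and it is undefined where this limit does not exist. -/
def omegaFun {S : Type*} (F : List S → ℝ) : (ℕ → S) →. ℝ := fun w =>
  ⟨∃ y : ℝ, Tendsto (fun k => F (pref w k)) atTop (𝓝 y), fun h => h.choose⟩

/-- The binary expansion of `x ∈ [0,1)` that does not end in `1^ω`. -/
def bin (x : ℝ) : ℕ → Fin 2 := Real.digits x 2

/-- On `[0,1)`, `bin x` is an infinite word with value `∑ w_i 2^{-i} = x` (the first letter having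
index `1` in the sum) which does not end in `1^ω`. -/
theorem bin_spec (x : ℝ) (hx : x ∈ Set.Ico (0 : ℝ) 1) :
    Real.ofDigits (bin x) = x ∧ ¬ ∃ N, ∀ i, N ≤ i → bin x i = 1 := by
  refine ⟨Real.ofDigits_digits (by norm_num) hx, ?_⟩
  rintro ⟨N, hN⟩
  have h1 := Real.ofDigits_digits_sum_eq (b := 2) hx N
  have h2 : Real.ofDigits (Real.digits x 2) = x := Real.ofDigits_digits (by norm_num) hx
  rw [Real.ofDigits_eq_sum_add_ofDigits _ N] at h2
  have h3 : (fun i => Real.digits x 2 (i + N)) = fun _ => (1 : Fin 2) := by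
    funext i
    exact hN (i + N) (by omega)
  have h4 : Real.ofDigits (fun _ : ℕ => (1 : Fin 2)) = 1 := by
    have h := tsum_geometric_two' (1 : ℝ)
    unfold Real.ofDigits Real.ofDigitsTerm
    rw [← h]
    congr 1
    funext n
    simp
    field_simp
    ring
  rw [h3, h4] at h2
  push_cast at h1 h2
  have h5 := Nat.lt_floor_add_one ((2 : ℝ) ^ N * x)
  have h6 : (2 : ℝ) ^ N * x = (⌊(2 : ℝ) ^ N * x⌋₊ : ℝ) + 1 := by
    rw [← h1]
    nth_rewrite 1 [← h2]
    field_simp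
  linarith

/-- The (partial) real function on `[0,1)` of an `ω`-function `f` over the binary alphabet:
`x ↦ f (bin x)`. -/
def realFun (f : (ℕ → Fin 2) →. ℝ) : Set.Ico (0 : ℝ) 1 →. ℝ := fun x => f (bin x)

/-- A partial real-valued function is everywhere continuous: it is defined at every point of `X`
and is continuous on `X`. -/
def EverywhereContinuous {X : Type*} [TopologicalSpace X] (f : X →. ℝ) : Prop :=
  ∃ g : X → ℝ, Continuous g ∧ ∀ x, f x = Part.some (g x)

/-! ### Inputs, their codes, and decision problems -/

/-- A decision problem with inputs of type `X`, written down through `code : X → C`, as a function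
on natural numbers: `1` on the codes of the inputs with answer yes, `0` on all other numbers. -/
def decisionFun {X C : Type*} [Primcodable C] (code : X → C) (Yes : X → Prop) : ℕ →. ℕ :=
  open Classical in
  fun m => Part.some (if ∃ x, Yes x ∧ Encodable.encode (code x) = m then 1 else 0)

/-- The list of the rows of a matrix. -/
def matCode {K : Type*} {n : ℕ} (A : Matrix (Fin n) (Fin n) K) : List (List K) :=
  List.ofFn fun i => List.ofFn fun j => A i j

theorem matCode_injective {K : Type*} {n : ℕ} :
    Function.Injective (matCode : Matrix (Fin n) (Fin n) K → List (List K)) := by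
  intro A B h
  ext i j
  have h1 := congrFun (List.ofFn_injective h) i
  exact congrFun (List.ofFn_injective h1) j

/-- A nonempty finite family of square matrices of the same size with entries in `K`. -/
structure MatrixFamily (K : Type*) where
  /-- the size of the matrices, possibly `0` -/
  size : ℕ
  /-- the number of matrices minus one -/
  predCard : ℕ
  /-- the matrices -/
  mat : Fin (predCard + 1) → Matrix (Fin size) (Fin size) K

/-- The code of a matrix family: the size, the number of matrices minus one, the matrices. -/
def MatrixFamily.code {K : Type*} (B : MatrixFamily K) : ℕ × ℕ × List (List (List K)) :=
  (B.size, B.predCard, List.ofFn fun a => matCode (B.mat a))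

theorem MatrixFamily.code_injective {K : Type*} :
    Function.Injective (MatrixFamily.code : MatrixFamily K → _) := by
  rintro ⟨n, k, A⟩ ⟨n', k', A'⟩ h
  simp only [MatrixFamily.code, Prod.mk.injEq] at h
  obtain ⟨rfl, rfl, h⟩ := h
  congr
  funext a
  exact matCode_injective (congrFun (List.ofFn_injective h) a)

/-- An average preserving WFA over the binary alphabet with weights in `K`. -/
structure BinaryApWFA (K : Type*) [Field K] where
  /-- the number of states, possibly `0` -/
  size : ℕ
  /-- the automaton -/
  aut : WFA K (Fin 2) (Fin size)
  ap : aut.IsAveragePreserving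

/-- The code of a binary average preserving WFA: the number of states, the initial distribution,
the final distribution, the two weight matrices. -/
def BinaryApWFA.code {K : Type*} [Field K] (𝒜 : BinaryApWFA K) :
    ℕ × List K × List K × List (List K) × List (List K) :=
  (𝒜.size, List.ofFn 𝒜.aut.init, List.ofFn 𝒜.aut.final,
    matCode (𝒜.aut.wt 0), matCode (𝒜.aut.wt 1))

theorem BinaryApWFA.code_injective {K : Type*} [Field K] :
    Function.Injective (BinaryApWFA.code : BinaryApWFA K → _) := by
  rintro ⟨n, ⟨I, F, A⟩, hA⟩ ⟨n', ⟨I', F', A'⟩, hA'⟩ h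
  simp only [BinaryApWFA.code, Prod.mk.injEq] at h
  obtain ⟨rfl, h1, h2, h3, h4⟩ := h
  congr
  · exact List.ofFn_injective h1
  · exact List.ofFn_injective h2
  · funext a
    fin_cases a
    · exact matCode_injective h3
    · exact matCode_injective h4

/-- Matrix Product Stability. Input: a nonempty finite family of square matrices over `K`, where
`K` is read as a field of real numbers through `φ`. Question: is it stable? -/
def matrixProductStability {K : Type*} [Field K] [Primcodable K] (φ : K →+* ℝ) : ℕ →. ℕ :=
  decisionFun (MatrixFamily.code (K := K)) fun B => IsStable fun a => (B.mat a).map φ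

/-- Ap-WFA uniform continuity. Input: an average preserving WFA over the binary alphabet with
weights in `K`, where `K` is read as a field of real numbers through `φ`. Question: are both its
`ω`-function and its real function on `[0,1)` everywhere continuous? -/
def apWFAUniformContinuity {K : Type*} [Field K] [Primcodable K] (φ : K →+* ℝ) : ℕ →. ℕ :=
  decisionFun (BinaryApWFA.code (K := K)) fun 𝒜 =>
    EverywhereContinuous (omegaFun (𝒜.aut.map φ).wordFun) ∧
      EverywhereContinuous (realFun (omegaFun (𝒜.aut.map φ).wordFun))

end

end ApWFA

open Filter Topology
open scoped Matrix Computability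

namespace ApWFA

noncomputable section

/-! ### Finite and infinite words -/

section Words

variable {S : Type*}

/-! Continuity to stability. Write `F(v) = I A_v F` for the word function. Average preservation
makes it a martingale on the binary tree and gives `A_1 F - F = -(A_0 F - F)`. Its increments are
`F(vu) - F(v) = I A_v (A_u F - F)`, and every `A_u F - F` lies in the span of the vectors `A_y (A_0
F - F)`. Let `B_0, B_1` be the matrices of the action on this span modulo the vectors killed by all
`I A_v` (`IsReduction`, `exists_isReduction`).

If `B` is stable, an increment is a fixed row times `B_v β(u)` with `β` bounded, so the oscillation
of `F` beyond prefixes vanishes and the limit is continuous (`IsReduction.oscVanish`). Conversely, a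
martingale value at `v` lies between limits at two infinite words through `v`, so a continuous limit
forces the oscillation to vanish; `B_v` is recovered linearly from such oscillations
(`IsReduction.isStable`).

A continuous `g` on infinite words gives a continuous function on `[0,1)` exactly if `g(v01^ω) =
g(v10^ω)` for all `v` (`continuous_bin_iff`). With `p_a - B_a p_a = G`, where `G` is the class of
`A_0 F - F`, all these conditions together amount to the one equation `B_1 p_0 + B_0 p_1 = 2G`
(`IsReduction.limit_eq_iff`). If some `p_a` does not exist, then `B_a` fixes a nonzero vector and
stability fails. Thus continuity is stability of `B` together with linear algebra over `K`. The
algorithm obtains `B` by searching for a certificate: words, matrices and vectors satisfying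
finitely many decidable identities. One always exists, and any one found is good enough.

Stability to continuity. Let the block `1^(n+a) 0` stand for the matrix `A_a` and `1^j 0` for the
`j`-th unit vector. An automaton is built with `F(1^i 0 · blocks of x · 1^j 0 · u) = (A_x)_{ij}
θ(u)`, where `θ` is the word function of a real function with mean zero that vanishes at both ends
of the interval. Mean zero makes zero final weights on the block states average preserving;
vanishing at the ends makes the two expansions of a dyadic number agree. So only stability of the
`A_a` is left to decide continuity (`isContinuousWFA_blockAut_iff`).

In both directions a single oracle question is asked (`decisionFun_le_of_certificates`). -/

/-- The infinite word `v w`, for a finite word `v` and an infinite word `w`. -/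
def app (v : List S) (w : ℕ → S) : ℕ → S :=
  fun i => if h : i < v.length then v[i] else w (i - v.length)

/-- The infinite word `w` without its first `k` letters. -/
def tail (w : ℕ → S) (k : ℕ) : ℕ → S := fun i => w (k + i)

@[simp] theorem length_pref (w : ℕ → S) (k : ℕ) : (pref w k).length = k := by simp [pref]

@[simp] theorem pref_zero (w : ℕ → S) : pref w 0 = [] := rfl

theorem pref_succ (w : ℕ → S) (k : ℕ) : pref w (k + 1) = pref w k ++ [w k] := by
  simp [pref, List.range_succ]

theorem pref_add (w : ℕ → S) (k l : ℕ) : pref w (k + l) = pref w k ++ pref (tail w k) l := by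
  induction l with
  | zero => simp
  | succ l ih => rw [← add_assoc, pref_succ, ih, pref_succ, List.append_assoc]; rfl

theorem pref_eq_iff {w w' : ℕ → S} {k : ℕ} : pref w k = pref w' k ↔ ∀ i < k, w i = w' i := by
  simp [pref, List.map_inj_left]

theorem tail_app (v : List S) (w : ℕ → S) : tail (app v w) v.length = w := by
  funext i; simp [tail, app]

theorem pref_app_length (v : List S) (w : ℕ → S) : pref (app v w) v.length = v := by
  apply List.ext_getElem (by simp)
  intro i h1 h2
  simp [pref, app, h2]

theorem pref_app_add (v : List S) (w : ℕ → S) (k : ℕ) :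
    pref (app v w) (v.length + k) = v ++ pref w k := by
  rw [pref_add, pref_app_length, tail_app]

theorem app_pref (w : ℕ → S) (k : ℕ) : app (pref w k) (tail w k) = w := by
  funext i
  by_cases h : i < k
  · simp [app, h, pref]
  · simp only [app, length_pref, h, tail]
    simp only [dif_neg, not_false_eq_true]
    congr 1; omega

theorem app_nil (w : ℕ → S) : app [] w = w := by
  funext i; simp [app]

theorem app_append (u v : List S) (w : ℕ → S) : app (u ++ v) w = app u (app v w) := by
  have h1 := pref_app_add u (app v w) v.length
  rw [pref_app_length] at h1
  rw [← app_pref (app u (app v w)) (u.length + v.length), h1]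
  congr 1
  funext i
  have := congrFun (tail_app v w) i
  have h2 := congrFun (tail_app u (app v w)) (v.length + i)
  simp only [tail] at this h2 ⊢
  rw [← add_assoc] at h2
  rw [h2, this]

theorem tendsto_pref_app {X : Type*} {F : List S → X} {v : List S} {w : ℕ → S} {l : Filter X} :
    Tendsto (fun k => F (pref (app v w) k)) atTop l ↔
      Tendsto (fun k => F (v ++ pref w k)) atTop l := by
  rw [← tendsto_add_atTop_iff_nat v.length]
  simp only [add_comm _ v.length, pref_app_add]

theorem pref_const (a : S) (k : ℕ) : pref (fun _ => a) k = List.replicate k a := by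
  simp [pref]

theorem eventually_pref_eq [TopologicalSpace S] [DiscreteTopology S] (w : ℕ → S) (k : ℕ) :
    ∀ᶠ w' in 𝓝 w, pref w' k = pref w k := by
  simp only [pref_eq_iff]
  refine (Filter.eventually_all_finite (Set.finite_lt_nat k)).2 fun i _ => ?_
  have h : Tendsto (fun w' : ℕ → S => w' i) (𝓝 w) (𝓝 (w i)) := (continuous_apply i).tendsto w
  rw [nhds_discrete S] at h
  exact h (by simp : {w i} ∈ pure (w i))

theorem tendsto_of_pref_eq [TopologicalSpace S] {w : ℕ → S} {x : ℕ → ℕ → S}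
    (h : ∀ k, pref (x k) k = pref w k) : Tendsto x atTop (𝓝 w) := by
  rw [tendsto_pi_nhds]
  intro i
  refine tendsto_const_nhds.congr' ?_
  filter_upwards [eventually_gt_atTop i] with k hk
  exact (pref_eq_iff.1 (h k) i hk).symm

end Words

/-! ### Continuity of `ω`-functions -/

section Omega

variable {S : Type*}

theorem omegaFun_eq_some_iff {F : List S → ℝ} {w : ℕ → S} {y : ℝ} :
    omegaFun F w = Part.some y ↔ Tendsto (fun k => F (pref w k)) atTop (𝓝 y) := by
  rw [Part.eq_some_iff]
  constructor
  · rintro ⟨h, rfl⟩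
    exact h.choose_spec
  · intro h
    have hd : ∃ y, Tendsto (fun k => F (pref w k)) atTop (𝓝 y) := ⟨y, h⟩
    exact ⟨hd, tendsto_nhds_unique hd.choose_spec h⟩

theorem everywhereContinuous_omegaFun [TopologicalSpace S] {F : List S → ℝ} :
    EverywhereContinuous (omegaFun F) ↔
      ∃ g : (ℕ → S) → ℝ, Continuous g ∧
        ∀ w, Tendsto (fun k => F (pref w k)) atTop (𝓝 (g w)) := by
  simp only [EverywhereContinuous, omegaFun_eq_some_iff]

/-- Along every infinite word, the oscillation of the word function `F` on the extensions of the
prefixes tends to zero. -/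
def OscVanish (F : List S → ℝ) : Prop :=
  ∀ w : ℕ → S, ∀ ε > 0, ∃ k, ∀ u, |F (pref w k ++ u) - F (pref w k)| ≤ ε

/-- Small oscillation makes the values along a word a Cauchy sequence, and the bound passes to the
limit on the whole cylinder of the prefix, so two limits in that cylinder differ by at most `2ε/3`.
-/
theorem OscVanish.exists_continuous [TopologicalSpace S] [DiscreteTopology S]
    {F : List S → ℝ} (hF : OscVanish F) :
    ∃ g : (ℕ → S) → ℝ, Continuous g ∧
        ∀ w, Tendsto (fun k => F (pref w k)) atTop (𝓝 (g w)) := by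
  have key : ∀ w, ∃ y, Tendsto (fun k => F (pref w k)) atTop (𝓝 y) := by
    intro w
    apply cauchySeq_tendsto_of_complete
    rw [Metric.cauchySeq_iff']
    intro ε hε
    obtain ⟨k, hk⟩ := hF w (ε / 2) (half_pos hε)
    refine ⟨k, fun n hn => ?_⟩
    obtain ⟨l, rfl⟩ := Nat.exists_eq_add_of_le hn
    rw [pref_add, Real.dist_eq]
    exact (hk _).trans_lt (by linarith)
  choose g hg using key
  refine ⟨g, ?_, hg⟩
  rw [continuous_iff_continuousAt]
  intro w
  rw [ContinuousAt, Metric.tendsto_nhds]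
  intro ε hε
  obtain ⟨k, hk⟩ := hF w (ε / 3) (by positivity)
  have h : ∀ w', pref w' k = pref w k → |g w' - F (pref w k)| ≤ ε / 3 := by
    intro w' hw'
    have h1 : Tendsto (fun n => |F (pref w' n) - F (pref w k)|) atTop
        (𝓝 |g w' - F (pref w k)|) := ((hg w').sub_const _).abs
    refine le_of_tendsto h1 ?_
    filter_upwards [eventually_ge_atTop k] with n hn
    obtain ⟨l, rfl⟩ := Nat.exists_eq_add_of_le hn
    rw [pref_add, hw']
    exact hk _
  filter_upwards [eventually_pref_eq w k] with w' hw'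
  have h1 := abs_le.1 (h w' hw')
  have h2 := abs_le.1 (h w rfl)
  rw [Real.dist_eq, abs_lt]
  constructor <;> linarith

/-- A word function over the binary alphabet whose value at each word is the average of the values
at the two one-letter extensions. -/
def IsMartingale (F : List (Fin 2) → ℝ) : Prop := ∀ v, F (v ++ [0]) + F (v ++ [1]) = 2 * F v

theorem IsMartingale.neg {F : List (Fin 2) → ℝ} (hF : IsMartingale F) :
    IsMartingale fun v => -F v := by
  intro v; have := hF v; linarith

/-- One of two numbers is at least their average; the word follows that child at every step. -/
theorem IsMartingale.exists_ge {F : List (Fin 2) → ℝ} (hF : IsMartingale F) (v : List (Fin 2)) :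
    ∃ w, ∀ k, F v ≤ F (v ++ pref w k) := by
  have hstep : ∀ u, ∃ a, F u ≤ F (u ++ [a]) := by
    intro u
    by_contra! h
    have h0 := h 0
    have h1 := h 1
    have := hF u
    linarith
  choose a ha using hstep
  let s : ℕ → List (Fin 2) := fun k => k.rec [] fun _ u => u ++ [a (v ++ u)]
  have hs : ∀ k, s (k + 1) = s k ++ [a (v ++ s k)] := fun k => rfl
  refine ⟨fun k => a (v ++ s k), fun k => ?_⟩
  have hp : ∀ k, pref (fun k => a (v ++ s k)) k = s k := by
    intro k
    induction k with
    | zero => rfl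
    | succ k ih => rw [pref_succ, ih, hs]
  rw [hp]
  induction k with
  | zero => simp [s]
  | succ k ih =>
    rw [hs, ← List.append_assoc]
    exact ih.trans (ha _)

theorem IsMartingale.exists_le {F : List (Fin 2) → ℝ} (hF : IsMartingale F) (v : List (Fin 2)) :
    ∃ w, ∀ k, F (v ++ pref w k) ≤ F v := by
  obtain ⟨w, hw⟩ := hF.neg.exists_ge v
  exact ⟨w, fun k => neg_le_neg_iff.1 (hw k)⟩

/-- Each value of `F` is squeezed between the limits along the ascending and the descending word
through it. Both words stay in a small cylinder around `w`, where `g` is close to `g w`. -/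
theorem IsMartingale.exists_close {F : List (Fin 2) → ℝ} (hF : IsMartingale F)
    {g : (ℕ → Fin 2) → ℝ} (hg : Continuous g)
    (hlim : ∀ w, Tendsto (fun k => F (pref w k)) atTop (𝓝 (g w))) (w : ℕ → Fin 2) {ε : ℝ}
    (hε : 0 < ε) : ∃ k, ∀ l ≥ k, ∀ u, |F (pref w l ++ u) - g w| ≤ ε := by
  have h1 : ∀ᶠ w' in 𝓝 w, dist (g w') (g w) < ε :=
    Metric.tendsto_nhds.1 (hg.tendsto w) ε hε
  -- Words agreeing with `w` on longer and longer prefixes converge to `w`, so some cylinder of `w`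
  -- lies in the neighbourhood given by continuity.
  have h2 : ∃ k, ∀ w', pref w' k = pref w k → |g w' - g w| < ε := by
    by_contra! h
    choose x hx hx' using h
    have h3 := (tendsto_of_pref_eq hx).eventually h1
    obtain ⟨k, hk⟩ := h3.exists
    rw [Real.dist_eq] at hk
    linarith [hx' k]
  obtain ⟨k, hk⟩ := h2
  have hk' : ∀ l ≥ k, ∀ u w', |g (app (pref w l ++ u) w') - g w| < ε := by
    intro l hl u w'
    apply hk
    obtain ⟨m, rfl⟩ := Nat.exists_eq_add_of_le hl
    rw [pref_add, List.append_assoc, app_append]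
    conv_lhs => rw [← length_pref w k]
    rw [length_pref]
    have := pref_app_length (pref w k) (app (pref (tail w k) m ++ u) w')
    rwa [length_pref] at this
  refine ⟨k, fun l hl u => ?_⟩
  obtain ⟨w1, hw1⟩ := hF.exists_ge (pref w l ++ u)
  obtain ⟨w2, hw2⟩ := hF.exists_le (pref w l ++ u)
  have h3 := ge_of_tendsto' (tendsto_pref_app.1 (hlim (app (pref w l ++ u) w1))) hw1
  have h4 := le_of_tendsto' (tendsto_pref_app.1 (hlim (app (pref w l ++ u) w2))) hw2
  have h5 := abs_lt.1 (hk' l hl u w1)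
  have h6 := abs_lt.1 (hk' l hl u w2)
  rw [abs_le]
  constructor <;> linarith

end Omega

/-! ### Binary expansions -/

section Binary

theorem ofDigits_eq_head_add (w : ℕ → Fin 2) :
    Real.ofDigits w = (w 0 : ℝ) / 2 + Real.ofDigits (tail w 1) / 2 := by
  rw [Real.ofDigits_eq_sum_add_ofDigits w 1]
  have : (fun i => w (i + 1)) = tail w 1 := by funext i; simp [tail, add_comm]
  rw [this]
  simp [Real.ofDigitsTerm]
  ring

theorem tail_tail {S : Type*} (w : ℕ → S) (k l : ℕ) : tail (tail w k) l = tail w (k + l) := by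
  funext i; simp [tail, add_assoc]

theorem eq_one_of_ofDigits_eq_one {w : ℕ → Fin 2} (h : Real.ofDigits w = 1) : w = fun _ => 1 := by
  have key : ∀ i, w i = 1 ∧ Real.ofDigits (tail w (i + 1)) = 1 := by
    have step : ∀ w : ℕ → Fin 2, Real.ofDigits w = 1 →
        w 0 = 1 ∧ Real.ofDigits (tail w 1) = 1 := by
      intro w h
      rw [ofDigits_eq_head_add] at h
      have h1 := Real.ofDigits_le_one (tail w 1)
      rcases Fin.exists_fin_two.1 ⟨w 0, rfl⟩ with h0 | h0
      · rw [h0] at h; norm_num at h; linarith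
      · rw [h0] at h ⊢; norm_num at h ⊢; linarith
    intro i
    induction i with
    | zero => exact step w h
    | succ i ih =>
      have := step _ ih.2
      rw [tail_tail] at this
      exact ⟨by simpa [tail] using this.1, this.2⟩
  funext i
  exact (key i).1

theorem eq_zero_of_ofDigits_eq_zero {w : ℕ → Fin 2} (h : Real.ofDigits w = 0) :
    w = fun _ => 0 := by
  have key : ∀ i, w i = 0 ∧ Real.ofDigits (tail w (i + 1)) = 0 := by
    have step : ∀ w : ℕ → Fin 2, Real.ofDigits w = 0 →
        w 0 = 0 ∧ Real.ofDigits (tail w 1) = 0 := by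
      intro w h
      rw [ofDigits_eq_head_add] at h
      have h1 := Real.ofDigits_nonneg (tail w 1)
      rcases Fin.exists_fin_two.1 ⟨w 0, rfl⟩ with h0 | h0
      · rw [h0] at h ⊢; norm_num at h ⊢; linarith
      · rw [h0] at h; norm_num at h; linarith
    intro i
    induction i with
    | zero => exact step w h
    | succ i ih =>
      have := step _ ih.2
      rw [tail_tail] at this
      exact ⟨by simpa [tail] using this.1, this.2⟩
  funext i
  exact (key i).1

theorem ofDigits_const_one : Real.ofDigits (fun _ : ℕ => (1 : Fin 2)) = 1 :=
  Real.ofDigits_const_last_eq_one' (b := 2) (by norm_num)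

theorem ofDigits_const_zero : Real.ofDigits (fun _ : ℕ => (0 : Fin 2)) = 0 := by
  simp [Real.ofDigits, Real.ofDigitsTerm]

theorem ofDigits_app_congr (v : List (Fin 2)) {w w' : ℕ → Fin 2}
    (h : Real.ofDigits w = Real.ofDigits w') :
    Real.ofDigits (app v w) = Real.ofDigits (app v w') := by
  induction v with
  | nil => rwa [app_nil, app_nil]
  | cons a v ih =>
    have h1 : ∀ w : ℕ → Fin 2, tail (app (a :: v) w) 1 = app v w := by
      intro w
      rw [← List.singleton_append, app_append]
      exact tail_app [a] _
    rw [ofDigits_eq_head_add, ofDigits_eq_head_add (app _ w'), h1, h1, ih]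
    simp [app]

theorem ofDigits_app_zero_one (v : List (Fin 2)) :
    Real.ofDigits (app (v ++ [0]) fun _ => 1) = Real.ofDigits (app (v ++ [1]) fun _ => 0) := by
  rw [app_append, app_append]
  apply ofDigits_app_congr
  have h : ∀ a b : Fin 2, tail (app [a] fun _ => b) 1 = fun _ => b := fun a b => tail_app [a] _
  rw [ofDigits_eq_head_add, ofDigits_eq_head_add (app [1] _), h, h, ofDigits_const_one,
    ofDigits_const_zero]
  simp [app]

/-- After the common prefix is removed, the word beginning with `0` has value at most `1/2` and the
one beginning with `1` at least `1/2`. Equality forces the extreme tails `1^ω` and `0^ω`. -/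
theorem eq_or_of_ofDigits_eq {w w' : ℕ → Fin 2} (h : Real.ofDigits w = Real.ofDigits w') :
    w = w' ∨ ∃ v, (w = app (v ++ [0]) (fun _ => 1) ∧ w' = app (v ++ [1]) fun _ => 0) ∨
      (w' = app (v ++ [0]) (fun _ => 1) ∧ w = app (v ++ [1]) fun _ => 0) := by
  by_cases hw : w = w'
  · exact Or.inl hw
  right
  have hex : ∃ i, w i ≠ w' i := by
    by_contra! hc
    exact hw (funext hc)
  classical
  obtain ⟨N, hN, hlt⟩ : ∃ N, w N ≠ w' N ∧ ∀ i < N, w i = w' i :=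
    ⟨Nat.find hex, Nat.find_spec hex, fun i hi => by simpa using Nat.find_min hex hi⟩
  have hp : pref w N = pref w' N := pref_eq_iff.2 hlt
  have htail : Real.ofDigits (tail w N) = Real.ofDigits (tail w' N) := by
    rw [Real.ofDigits_eq_sum_add_ofDigits w N, Real.ofDigits_eq_sum_add_ofDigits w' N] at h
    have h1 : ∑ i ∈ Finset.range N, Real.ofDigitsTerm w i =
        ∑ i ∈ Finset.range N, Real.ofDigitsTerm w' i :=
      Finset.sum_congr rfl fun i hi => by simp [Real.ofDigitsTerm, hlt i (Finset.mem_range.1 hi)]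
    rw [h1, add_right_inj] at h
    have h2 := mul_left_cancel₀ (by positivity) h
    simp only [add_comm _ N] at h2
    exact h2
  have main : ∀ x y : ℕ → Fin 2, pref x N = pref y N → x N = 0 → y N = 1 →
      Real.ofDigits (tail x N) = Real.ofDigits (tail y N) →
      x = app (pref x N ++ [0]) (fun _ => 1) ∧ y = app (pref x N ++ [1]) fun _ => 0 := by
    intro x y hxy hx hy ht
    rw [ofDigits_eq_head_add, ofDigits_eq_head_add (tail y N), tail_tail, tail_tail] at ht
    have h1 := Real.ofDigits_le_one (tail x (N + 1))
    have h2 := Real.ofDigits_nonneg (tail y (N + 1))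
    have hx' : tail x N 0 = 0 := hx
    have hy' : tail y N 0 = 1 := hy
    rw [hx', hy'] at ht
    norm_num at ht
    have h3 := eq_one_of_ofDigits_eq_one (w := tail x (N + 1)) (by linarith)
    have h4 := eq_zero_of_ofDigits_eq_zero (w := tail y (N + 1)) (by linarith)
    constructor
    · rw [← h3, ← hx, ← pref_succ, app_pref]
    · rw [← h4, ← hy, hxy, ← pref_succ, app_pref]
  refine ⟨pref w N, ?_⟩
  have h01 : (w N = 0 ∧ w' N = 1) ∨ (w' N = 0 ∧ w N = 1) := by
    revert hN; generalize w N = a; generalize w' N = b; revert a b; decide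
  rcases h01 with ⟨h0, h1⟩ | ⟨h0, h1⟩
  · exact Or.inl (main w w' hp h0 h1 htail)
  · right
    rw [hp]
    exact main w' w hp.symm h0 h1 htail.symm

/-- If the two expansions differed, one of them would end in `1^ω`. For `bin` this is excluded by
its choice, for `w` because it ends in `0^ω`. -/
theorem bin_ofDigits {w : ℕ → Fin 2} (hw : ∃ v, w = app v fun _ => 0)
    (h1 : Real.ofDigits w ∈ Set.Ico (0 : ℝ) 1) : bin (Real.ofDigits w) = w := by
  obtain ⟨hs, hb⟩ := bin_spec _ h1
  rcases eq_or_of_ofDigits_eq hs with h | ⟨v, ⟨h, -⟩ | ⟨h, -⟩⟩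
  · exact h
  · exfalso
    refine hb ⟨(v ++ [0]).length, fun i hi => ?_⟩
    rw [h]
    simp only [app]
    rw [dif_neg (by omega)]
  · exfalso
    obtain ⟨u, hu⟩ := hw
    rw [hu] at h
    have := congrFun h (u.length + (v ++ [(0 : Fin 2)]).length)
    simp only [app] at this
    rw [dif_neg (by omega), dif_neg (by omega)] at this
    exact absurd this (by decide)

theorem ofDigits_app_zero_lt_one (v : List (Fin 2)) : Real.ofDigits (app v fun _ => 0) < 1 := by
  refine lt_of_le_of_ne (Real.ofDigits_le_one _) fun h => ?_
  have h1 := congrFun (eq_one_of_ofDigits_eq_one h) v.length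
  simp [app] at h1

/-- For a continuous function on binary infinite words, the real function read off the binary
expansions is continuous exactly if the two expansions of each dyadic number give equal values. -/
theorem continuous_bin_iff {g : (ℕ → Fin 2) → ℝ} (hg : Continuous g) :
    (Continuous fun x : Set.Ico (0 : ℝ) 1 => g (bin x)) ↔
      ∀ v, g (app (v ++ [0]) fun _ => 1) = g (app (v ++ [1]) fun _ => 0) := by
  constructor
  · intro hc v
    have hx1 : Real.ofDigits (app (v ++ [1]) fun _ => (0 : Fin 2)) ∈ Set.Ico (0 : ℝ) 1 :=
      ⟨Real.ofDigits_nonneg _, ofDigits_app_zero_lt_one _⟩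
    -- These words tend to `v01^ω`, but each ends in `0^ω` and so is the expansion selected by
    -- `bin`. The limit of their values is the dyadic number whose selected expansion is `v10^ω`, so
    -- continuity compares the two.
    let z : ℕ → ℕ → Fin 2 := fun k => app ((v ++ [0]) ++ List.replicate k 1) fun _ => 0
    have hz : Tendsto z atTop (𝓝 (app (v ++ [0]) fun _ => 1)) := by
      apply tendsto_of_pref_eq
      intro k
      rw [pref_eq_iff]
      intro i hi
      simp only [z]
      rw [app_append]
      by_cases h : i < (v ++ [(0 : Fin 2)]).length
      · simp only [app, dif_pos h]
      · simp only [app, dif_neg h]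
        rw [dif_pos (by rw [List.length_replicate]; omega)]
        simp
    have hzx : ∀ k, Real.ofDigits (z k) ∈ Set.Ico (0 : ℝ) 1 := fun k =>
      ⟨Real.ofDigits_nonneg _, ofDigits_app_zero_lt_one _⟩
    have h1 : Tendsto (fun k => (⟨Real.ofDigits (z k), hzx k⟩ : Set.Ico (0 : ℝ) 1)) atTop
        (𝓝 ⟨_, hx1⟩) := by
      rw [tendsto_subtype_rng]
      simp only
      rw [← ofDigits_app_zero_one]
      exact (Real.continuous_ofDigits.tendsto _).comp hz
    have h2 := (hc.tendsto _).comp h1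
    have h3 := (hg.tendsto _).comp hz
    have h4 : ∀ k, bin (Real.ofDigits (z k)) = z k := fun k => bin_ofDigits ⟨_, rfl⟩ (hzx k)
    simp only [Function.comp_def, h4] at h2 h3
    rw [bin_ofDigits ⟨_, rfl⟩ hx1] at h2
    exact tendsto_nhds_unique h3 h2
  · intro h
    -- Evaluation maps a compact space continuously onto a Hausdorff one, so it is closed and a
    -- quotient map; a `g` constant on its fibres then descends continuously.
    have hq : IsQuotientMap (Set.rangeFactorization (Real.ofDigits (b := 2))) :=
      (Real.continuous_ofDigits.subtype_mk _).isClosedMap.isQuotientMap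
        (Real.continuous_ofDigits.subtype_mk _) Set.rangeFactorization_surjective
    have hfac : ∀ w w', Real.ofDigits w = Real.ofDigits w' → g w = g w' := by
      intro w w' hw
      rcases eq_or_of_ofDigits_eq hw with rfl | ⟨v, ⟨rfl, rfl⟩ | ⟨rfl, rfl⟩⟩
      · rfl
      · exact h v
      · exact (h v).symm
    have hr : ∀ x : Set.Ico (0 : ℝ) 1, (x : ℝ) ∈ Set.range (Real.ofDigits (b := 2)) :=
      fun x => ⟨bin x, (bin_spec x x.2).1⟩
    let f : Set.range (Real.ofDigits (b := 2)) → ℝ := fun y => g y.2.choose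
    have hf : f ∘ Set.rangeFactorization (Real.ofDigits (b := 2)) = g := by
      funext w
      apply hfac
      exact (Set.rangeFactorization (Real.ofDigits (b := 2)) w).2.choose_spec
    have hfc : Continuous f := by
      rw [hq.continuous_iff, hf]
      exact hg
    have : (fun x : Set.Ico (0 : ℝ) 1 => g (bin x)) =
        fun x : Set.Ico (0 : ℝ) 1 => f ⟨x, hr x⟩ := by
      funext x
      apply hfac
      rw [(bin_spec x x.2).1]
      exact (hr x).choose_spec.symm
    rw [this]
    exact hfc.comp (continuous_subtype_val.subtype_mk _)

theorem everywhereContinuous_realFun {F : List (Fin 2) → ℝ} {g : (ℕ → Fin 2) → ℝ}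
    (hg : Continuous g) (hlim : ∀ w, Tendsto (fun k => F (pref w k)) atTop (𝓝 (g w))) :
    EverywhereContinuous (realFun (omegaFun F)) ↔
      ∀ v, g (app (v ++ [0]) fun _ => 1) = g (app (v ++ [1]) fun _ => 0) := by
  rw [← continuous_bin_iff hg]
  have h : ∀ w, omegaFun F w = Part.some (g w) := fun w => omegaFun_eq_some_iff.2 (hlim w)
  constructor
  · rintro ⟨f, hf, hfg⟩
    have : (fun x : Set.Ico (0 : ℝ) 1 => g (bin x)) = f := by
      funext x
      have := hfg x
      rw [realFun, h] at this
      exact Part.some_inj.1 this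
    rwa [this]
  · intro hc
    exact ⟨_, hc, fun x => h _⟩

end Binary

/-! ### Products of stable families -/

section Stable

theorem wordMat_nil {R S Q : Type*} [CommRing R] [Fintype Q] [DecidableEq Q]
    (A : S → Matrix Q Q R) : wordMat A [] = 1 := by simp [wordMat]

theorem wordMat_cons {R S Q : Type*} [CommRing R] [Fintype Q] [DecidableEq Q]
    (A : S → Matrix Q Q R) (a : S) (v : List S) : wordMat A (a :: v) = A a * wordMat A v := by
  simp [wordMat]

theorem wordMat_append {R S Q : Type*} [CommRing R] [Fintype Q] [DecidableEq Q]
    (A : S → Matrix Q Q R) (u v : List S) : wordMat A (u ++ v) = wordMat A u * wordMat A v := by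
  simp [wordMat]

theorem wordMat_singleton {R S Q : Type*} [CommRing R] [Fintype Q] [DecidableEq Q]
    (A : S → Matrix Q Q R) (a : S) : wordMat A [a] = A a := by simp [wordMat]

theorem wordMat_map {R R' S Q : Type*} [CommRing R] [CommRing R'] [Fintype Q] [DecidableEq Q]
    (φ : R →+* R') (A : S → Matrix Q Q R) (v : List S) :
    wordMat (fun a => (A a).map φ) v = (wordMat A v).map φ := by
  induction v with
  | nil => simp [wordMat_nil]
  | cons a v ih => rw [wordMat_cons, wordMat_cons, ih, Matrix.map_mul]

/-- The sum of the absolute values of the entries of a matrix. -/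
def entrySum {P Q : Type*} [Fintype P] [Fintype Q] (A : Matrix P Q ℝ) : ℝ := ∑ i, ∑ j, |A i j|

variable {O P Q : Type*} [Fintype O] [Fintype P] [Fintype Q]

theorem entrySum_nonneg (A : Matrix P Q ℝ) : 0 ≤ entrySum A :=
  Finset.sum_nonneg fun _ _ => Finset.sum_nonneg fun _ _ => abs_nonneg _

theorem abs_entry_le (A : Matrix P Q ℝ) (i : P) (j : Q) : |A i j| ≤ entrySum A :=
  (Finset.single_le_sum (f := fun j => |A i j|) (fun _ _ => abs_nonneg _)
      (Finset.mem_univ j)).trans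
    (Finset.single_le_sum (f := fun i => ∑ j, |A i j|)
      (fun _ _ => Finset.sum_nonneg fun _ _ => abs_nonneg _) (Finset.mem_univ i))

theorem entrySum_mul_le (A : Matrix O P ℝ) (B : Matrix P Q ℝ) :
    entrySum (A * B) ≤ entrySum A * entrySum B := by
  have h1 : ∀ i j, |(A * B) i j| ≤ ∑ k, |A i k| * |B k j| := by
    intro i j
    rw [Matrix.mul_apply]
    refine (Finset.abs_sum_le_sum_abs _ _).trans_eq ?_
    simp [abs_mul]
  calc entrySum (A * B) ≤ ∑ i, ∑ j, ∑ k, |A i k| * |B k j| :=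
        Finset.sum_le_sum fun i _ => Finset.sum_le_sum fun j _ => h1 i j
    _ = ∑ i, ∑ k, |A i k| * ∑ j, |B k j| := by
        refine Finset.sum_congr rfl fun i _ => ?_
        rw [Finset.sum_comm]
        simp [Finset.mul_sum]
    _ ≤ ∑ i, ∑ k, |A i k| * entrySum B := by
        refine Finset.sum_le_sum fun i _ => Finset.sum_le_sum fun k _ => ?_
        refine mul_le_mul_of_nonneg_left ?_ (abs_nonneg _)
        exact Finset.single_le_sum (f := fun k => ∑ j, |B k j|)
          (fun _ _ => Finset.sum_nonneg fun _ _ => abs_nonneg _) (Finset.mem_univ k)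
    _ = entrySum A * entrySum B := by simp [entrySum, Finset.sum_mul]

theorem entrySum_add_le (A B : Matrix P Q ℝ) : entrySum (A + B) ≤ entrySum A + entrySum B := by
  simp only [entrySum, ← Finset.sum_add_distrib]
  exact Finset.sum_le_sum fun i _ => Finset.sum_le_sum fun j _ => abs_add_le _ _

omit [Fintype P] [Fintype Q] in
theorem tendsto_matrix_zero_iff {α : Type*} {l : Filter α} {f : α → Matrix P Q ℝ} :
    Tendsto f l (𝓝 0) ↔ ∀ i j, Tendsto (fun k => f k i j) l (𝓝 0) := by
  refine tendsto_pi_nhds.trans (forall_congr' fun i => ?_)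
  exact tendsto_pi_nhds

theorem tendsto_entrySum {α : Type*} {l : Filter α} {f : α → Matrix P Q ℝ} :
    Tendsto f l (𝓝 0) ↔ Tendsto (fun k => entrySum (f k)) l (𝓝 0) := by
  rw [tendsto_matrix_zero_iff]
  constructor
  · intro h
    have : (0 : ℝ) = ∑ i : P, ∑ j : Q, |(0 : ℝ)| := by simp
    rw [this]
    exact tendsto_finsetSum _ fun i _ => tendsto_finsetSum _ fun j _ => (h i j).abs
  · intro h i j
    exact squeeze_zero_norm (fun k => abs_entry_le (f k) i j) h

theorem exists_le_of_length_le {S : Type*} [Finite S] (f : List S → ℝ) (N : ℕ) :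
    ∃ C, 0 ≤ C ∧ ∀ v : List S, v.length ≤ N → f v ≤ C := by
  obtain ⟨C, hC⟩ := ((List.finite_length_le S N).image f).bddAbove
  exact ⟨max C 0, le_max_right _ _, fun v hv => (hC ⟨v, hv, rfl⟩).trans (le_max_left _ _)⟩

/-- If every infinite word has a prefix with a property, then all sufficiently long words have
one, of bounded length. -/
theorem exists_prefix_of_forall {S : Type*} [Finite S] {p : List S → Prop}
    (h : ∀ w : ℕ → S, ∃ k, p (pref w k)) :
    ∃ N, ∀ v : List S, N ≤ v.length → ∃ x y, v = x ++ y ∧ x.length ≤ N ∧ p x := by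
  let _ : TopologicalSpace S := ⊥
  have : DiscreteTopology S := ⟨rfl⟩
  choose k hk using h
  -- König's lemma in the form of compactness: finitely many of the cylinders cut out by good
  -- prefixes cover all infinite words.
  obtain ⟨t, -, ht⟩ := isCompact_univ.elim_nhds_subcover
    (fun w => {w' | pref w' (k w) = pref w (k w)}) fun w _ => eventually_pref_eq w (k w)
  -- The extra `1` makes `v` nonempty, so its head can serve as the letter that pads `v` to an
  -- infinite word.
  refine ⟨t.sup k + 1, fun v hv => ?_⟩
  have hne : v ≠ [] := by rintro rfl; simp at hv
  have hmem := ht (Set.mem_univ (app v fun _ => v.head hne))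
  simp only [Set.mem_iUnion, Set.mem_ofPred_eq] at hmem
  obtain ⟨w, hw, hw'⟩ := hmem
  have hle : k w ≤ t.sup k := Finset.le_sup hw
  obtain ⟨l, hl⟩ := Nat.exists_eq_add_of_le (show k w ≤ v.length by omega)
  refine ⟨pref w (k w), pref (tail (app v fun _ => v.head hne) (k w)) l, ?_, ?_, hk w⟩
  · rw [← hw', ← pref_add, ← hl, pref_app_length]
  · rw [length_pref]; omega

/-- With the threshold `1/2` pointwise convergence becomes a contraction with prefixes of bounded
length. Nonempty prefixes are required so that stripping them shortens the word. -/
theorem IsStable.exists_prefix {S : Type*} [Finite S] [DecidableEq Q]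
    {A : S → Matrix Q Q ℝ} (hA : IsStable A) :
    ∃ N, ∀ v : List S, N ≤ v.length →
      ∃ x y, v = x ++ y ∧ x.length ≤ N ∧ 0 < x.length ∧ entrySum (wordMat A x) ≤ 1 / 2 := by
  refine exists_prefix_of_forall fun w => ?_
  have h2 := (tendsto_entrySum.1 (hA w)).eventually_lt_const (by norm_num : (0 : ℝ) < 1 / 2)
  obtain ⟨k, hk, hk'⟩ := (h2.and (eventually_gt_atTop 0)).exists
  exact ⟨k, by rwa [length_pref], hk.le⟩

/-- The products of a stable family are bounded. -/
theorem IsStable.exists_bound {S : Type*} [Finite S] [DecidableEq Q]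
    {A : S → Matrix Q Q ℝ} (hA : IsStable A) :
    ∃ C, 0 ≤ C ∧ ∀ v : List S, entrySum (wordMat A v) ≤ C := by
  obtain ⟨N, hp⟩ := hA.exists_prefix
  obtain ⟨C, hC0, hC⟩ := exists_le_of_length_le (fun v => entrySum (wordMat A v)) N
  refine ⟨C, hC0, fun v => ?_⟩
  -- Stripping a contracting prefix does not decrease the bound that is needed, so words shorter
  -- than `N` decide.
  induction hn : v.length using Nat.strong_induction_on generalizing v with
  | _ n ih =>
    rcases lt_or_ge v.length N with h | h
    · exact hC v h.le
    · obtain ⟨x, y, rfl, -, hx0, hx⟩ := hp v h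
      rw [List.length_append] at hn
      have h1 := ih y.length (by omega) y rfl
      rw [wordMat_append]
      refine (entrySum_mul_le _ _).trans ?_
      have h2 := entrySum_nonneg (wordMat A y)
      nlinarith

/-- The products of a stable family tend to zero uniformly in the length of the word. -/
theorem IsStable.exists_length {S : Type*} [Finite S] [DecidableEq Q]
    {A : S → Matrix Q Q ℝ} (hA : IsStable A) {ε : ℝ} (hε : 0 < ε) :
    ∃ N, ∀ v : List S, N ≤ v.length → entrySum (wordMat A v) ≤ ε := by
  obtain ⟨N, hp⟩ := hA.exists_prefix
  obtain ⟨C, hC0, hC⟩ := hA.exists_bound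
  have key : ∀ m, ∀ v : List S, m * N ≤ v.length →
      entrySum (wordMat A v) ≤ (1 / 2) ^ m * C := by
    intro m
    induction m with
    | zero => intro v _; simpa using hC v
    | succ m ih =>
      intro v hv
      rw [add_mul, one_mul] at hv
      obtain ⟨x, y, rfl, hx1, -, hx⟩ := hp v (by omega)
      rw [List.length_append] at hv
      have h1 := ih y (by omega)
      rw [wordMat_append]
      refine (entrySum_mul_le _ _).trans ?_
      rw [pow_succ', mul_assoc]
      exact mul_le_mul hx h1 (entrySum_nonneg _) (by norm_num)
  have hlim : Tendsto (fun m : ℕ => (1 / 2 : ℝ) ^ m * C) atTop (𝓝 (0 * C)) :=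
    (tendsto_pow_atTop_nhds_zero_of_lt_one (by norm_num) (by norm_num)).mul_const C
  rw [zero_mul] at hlim
  obtain ⟨m, hm⟩ := (hlim.eventually_lt_const hε).exists
  exact ⟨m * N, fun v hv => (key m v hv).trans hm.le⟩

end Stable

/-! ### Word functions of average preserving automata -/

section Automata

/-- The vector `A_v F` as a function of `v`. -/
def WFA.col {R S Q : Type*} [CommRing R] [Fintype Q] [DecidableEq Q] (𝒜 : WFA R S Q)
    (v : List S) : Q → R := wordMat 𝒜.wt v *ᵥ 𝒜.final

theorem WFA.IsAveragePreserving.isMartingale {Q : Type*} [Fintype Q] [DecidableEq Q]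
    {𝒜 : WFA ℝ (Fin 2) Q} (h : 𝒜.IsAveragePreserving) : IsMartingale 𝒜.wordFun := by
  intro v
  simp only [WFA.IsAveragePreserving, Fin.sum_univ_two, Fintype.card_fin] at h
  simp only [WFA.wordFun, wordMat_append, wordMat_singleton, ← Matrix.mulVec_mulVec]
  rw [← dotProduct_add, ← Matrix.mulVec_add, h, Matrix.mulVec_smul, dotProduct_smul]
  simp

theorem WFA.IsAveragePreserving.map {R R' S Q : Type*} [CommRing R] [CommRing R'] [Fintype S]
    [Fintype Q] {𝒜 : WFA R S Q} (h : 𝒜.IsAveragePreserving) (φ : R →+* R') :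
    (𝒜.map φ).IsAveragePreserving := by
  funext q
  have h1 := congrArg φ (congrFun h q)
  simp only [Finset.sum_apply, Matrix.mulVec, dotProduct, map_sum, map_mul, Pi.smul_apply,
    smul_eq_mul, map_natCast] at h1
  simpa [WFA.map, Finset.sum_apply, Matrix.mulVec, dotProduct] using h1

end Automata

/-! ### Continuity in terms of stability -/

section Reduction

/-- A family `B` of matrices which describes the action of the automaton with data `A`, `I`, `F` on
the span of the vectors `A_v (A_0 F - F)`, modulo the vectors annihilated by all `I A_v`. -/
structure IsReduction {R Q P T : Type*} [CommRing R] [Fintype Q] [DecidableEq Q] [Fintype P]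
    [DecidableEq P] [Fintype T] [DecidableEq T] (A : Fin 2 → Matrix Q Q R)
    (I : Matrix (Fin 1) Q R) (F : Matrix Q (Fin 1) R) (x : P → List (Fin 2))
    (y : T → List (Fin 2)) (X : Matrix P Q R) (Y : Matrix Q T R) (M : Fin 2 → Matrix P P R)
    (J : Matrix (Fin 1) P R) (B : Fin 2 → Matrix T T R) (G : Matrix T (Fin 1) R)
    (L : Matrix T P R) : Prop where
  row : ∀ i q, X i q = (I * wordMat A (x i)) 0 q
  col : ∀ q j, Y q j = (wordMat A (y j) * (A 0 * F - F)) q 0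
  mul_wt : ∀ a, X * A a = M a * X
  init : J * X = I
  mul_restr : ∀ a, M a * (X * Y) = (X * Y) * B a
  diff : (X * Y) * G = X * (A 0 * F - F)
  left_inv : L * (X * Y) = 1

variable {Q P T : Type*} [Fintype Q] [DecidableEq Q] [Fintype P]
    [DecidableEq P] [Fintype T] [DecidableEq T] {A : Fin 2 → Matrix Q Q ℝ}
    {I : Matrix (Fin 1) Q ℝ} {F : Matrix Q (Fin 1) ℝ} {x : P → List (Fin 2)}
    {y : T → List (Fin 2)} {X : Matrix P Q ℝ} {Y : Matrix Q T ℝ} {M : Fin 2 → Matrix P P ℝ}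
    {J : Matrix (Fin 1) P ℝ} {B : Fin 2 → Matrix T T ℝ} {G : Matrix T (Fin 1) ℝ}
    {L : Matrix T P ℝ}

namespace IsReduction

variable (h : IsReduction A I F x y X Y M J B G L)

include h

theorem mul_wordMat (v : List (Fin 2)) : X * wordMat A v = wordMat M v * X := by
  induction v with
  | nil => simp [wordMat_nil]
  | cons a v ih =>
    rw [wordMat_cons, wordMat_cons, ← Matrix.mul_assoc, h.mul_wt, Matrix.mul_assoc, ih,
      Matrix.mul_assoc]

theorem wordMat_mul (v : List (Fin 2)) : wordMat M v * (X * Y) = (X * Y) * wordMat B v := by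
  induction v with
  | nil => simp [wordMat_nil]
  | cons a v ih =>
    rw [wordMat_cons, wordMat_cons, Matrix.mul_assoc, ih, ← Matrix.mul_assoc, h.mul_restr,
      Matrix.mul_assoc]

theorem init_mul_wordMat (v : List (Fin 2)) : I * wordMat A v = J * wordMat M v * X := by
  rw [← h.init, Matrix.mul_assoc, h.mul_wordMat, Matrix.mul_assoc]

end IsReduction

/-- The sign with which the letter `a` acts on `F` modulo `F` for average preserving automata. -/
def letterSign (a : Fin 2) : ℝ := if a = 0 then 1 else -1

namespace IsReduction

variable (h : IsReduction A I F x y X Y M J B G L) (hap : A 0 * F + A 1 * F = (2 : ℝ) • F)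

include h hap

/-- Since `A_1 F - F = -(A_0 F - F)`, a single vector `G` serves both letters up to sign. -/
theorem mul_diff (a : Fin 2) : X * (A a * F - F) = (X * Y) * (letterSign a • G) := by
  rw [Matrix.mul_smul, h.diff]
  have h2 : A 1 * F - F = -(A 0 * F - F) := by
    have : A 1 * F = (2 : ℝ) • F - A 0 * F := by rw [← hap]; abel
    rw [this, two_smul]; abel
  rcases Fin.exists_fin_two.1 ⟨a, rfl⟩ with rfl | rfl
  · simp [letterSign]
  · rw [h2, Matrix.mul_neg]; simp [letterSign]

/-- Here `β v` are coordinates of `A_v F - F` in the reduced space. The cocycle rule reflects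
`A_{uv} F - F = A_u (A_v F - F) + (A_u F - F)`. -/
theorem exists_coeff : ∃ β : List (Fin 2) → Matrix T (Fin 1) ℝ,
    (∀ u v, β (u ++ v) = wordMat B u * β v + β u) ∧
      ∀ v, X * (wordMat A v * F - F) = (X * Y) * β v := by
  let β : List (Fin 2) → Matrix T (Fin 1) ℝ :=
    fun v => v.foldr (fun a b => B a * b + letterSign a • G) 0
  have hβ : ∀ a v, β (a :: v) = B a * β v + letterSign a • G := fun _ _ => rfl
  refine ⟨β, fun u v => ?_, fun v => ?_⟩
  · induction u with
    | nil => simp [wordMat_nil, β]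
    | cons a u ih =>
      rw [List.cons_append, hβ, hβ, ih, wordMat_cons, Matrix.mul_add, Matrix.mul_assoc]
      abel
  · induction v with
    | nil => simp [wordMat_nil, β]
    | cons a v ih =>
      have : wordMat A (a :: v) * F - F = A a * (wordMat A v * F - F) + (A a * F - F) := by
        rw [wordMat_cons, Matrix.mul_sub, Matrix.mul_assoc]; abel
      rw [this, Matrix.mul_add, ← Matrix.mul_assoc, h.mul_wt, Matrix.mul_assoc, ih,
        ← Matrix.mul_assoc, h.mul_restr, h.mul_diff hap, hβ, Matrix.mul_add, Matrix.mul_assoc]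

/-- The increment from `v` to `vu` equals `J X Y B_v β(u)`: the factor `B_v` is uniformly small for
long `v`, and `β` stays bounded by its cocycle rule. -/
theorem oscVanish (hB : IsStable B) : OscVanish fun v => (I * wordMat A v * F) 0 0 := by
  obtain ⟨β, hβ, hXβ⟩ := h.exists_coeff hap
  obtain ⟨N, hp⟩ := hB.exists_prefix
  obtain ⟨D, hD0, hD⟩ := exists_le_of_length_le (fun v => entrySum (β v)) N
  -- The constant `2D` is the fixed point of `c ↦ c/2 + D`: splitting off a contracting prefix
  -- halves the bound on the remainder and adds at most `D`.
  have hbd : ∀ v, entrySum (β v) ≤ 2 * D := by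
    intro v
    induction hn : v.length using Nat.strong_induction_on generalizing v with
    | _ n ih =>
      rcases lt_or_ge v.length N with hv | hv
      · linarith [hD v hv.le]
      · obtain ⟨x, y, rfl, hx1, hx0, hx⟩ := hp v hv
        rw [List.length_append] at hn
        have h1 := ih y.length (by omega) y rfl
        rw [hβ]
        refine (entrySum_add_le _ _).trans ?_
        have h2 := entrySum_mul_le (wordMat B x) (β y)
        have h3 := entrySum_nonneg (β y)
        have h4 := hD x hx1
        nlinarith
  intro w ε hε
  set E := entrySum (J * (X * Y))
  have hE : 0 ≤ E := entrySum_nonneg _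
  obtain ⟨k, hk⟩ := hB.exists_length (ε := ε / ((E + 1) * (2 * D + 1))) (by positivity)
  refine ⟨k, fun u => ?_⟩
  have h1 := hk (pref w k) (by simp)
  set v := pref w k
  have h2 : I * wordMat A (v ++ u) * F - I * wordMat A v * F =
      (J * (X * Y)) * (wordMat B v * β u) := by
    have : I * wordMat A (v ++ u) * F - I * wordMat A v * F =
        I * wordMat A v * (wordMat A u * F - F) := by
      rw [wordMat_append, Matrix.mul_sub]; simp only [Matrix.mul_assoc]
    rw [this, h.init_mul_wordMat, Matrix.mul_assoc, hXβ, ← Matrix.mul_assoc,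
      Matrix.mul_assoc J, h.wordMat_mul]
    simp only [Matrix.mul_assoc]
  have h3 := congrFun (congrFun h2 0) 0
  rw [Matrix.sub_apply] at h3
  rw [h3]
  calc _ ≤ entrySum (J * (X * Y) * (wordMat B v * β u)) := abs_entry_le _ _ _
    _ ≤ E * (entrySum (wordMat B v) * entrySum (β u)) :=
        (entrySum_mul_le _ _).trans (mul_le_mul_of_nonneg_left (entrySum_mul_le _ _) hE)
    _ ≤ E * (ε / ((E + 1) * (2 * D + 1)) * (2 * D)) := by
        refine mul_le_mul_of_nonneg_left ?_ hE
        exact mul_le_mul h1 (hbd u) (entrySum_nonneg _) (by positivity)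
    _ = ε * (E / (E + 1) * (2 * D / (2 * D + 1))) := by field_simp
    _ ≤ ε * (1 * 1) := by
        refine mul_le_mul_of_nonneg_left ?_ hε.le
        refine mul_le_mul ?_ ?_ (by positivity) zero_le_one
        · rw [div_le_one (by positivity)]; linarith
        · rw [div_le_one (by positivity)]; linarith
    _ = ε := by ring

omit h in
theorem isMartingale_entry : IsMartingale fun v => (I * wordMat A v * F) 0 0 := by
  intro v
  have : I * wordMat A (v ++ [0]) * F + I * wordMat A (v ++ [1]) * F =
      (2 : ℝ) • (I * wordMat A v * F) := by
    rw [wordMat_append, wordMat_append, wordMat_singleton, wordMat_singleton]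
    simp only [Matrix.mul_assoc]
    rw [← Matrix.mul_add, ← Matrix.mul_add, hap, Matrix.mul_smul, Matrix.mul_smul]
  simpa using congrFun (congrFun this 0) 0

/-- An entry of `X A_v Y` is the difference of the word function at `x_i v y_j 0` and at `x_i v
y_j`. For a prefix `v` of `w` both words extend a prefix of `x_i w`, so the difference tends to
zero, and `B_v = L X A_v Y`. -/
theorem isStable {g : (ℕ → Fin 2) → ℝ} (hg : Continuous g)
    (hlim : ∀ w, Tendsto (fun k => (I * wordMat A (pref w k) * F) 0 0) atTop (𝓝 (g w))) :
    IsStable B := by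
  intro w
  have h1 : ∀ v, wordMat B v = L * (X * wordMat A v * Y) := by
    intro v
    rw [h.mul_wordMat, Matrix.mul_assoc, h.wordMat_mul, ← Matrix.mul_assoc, h.left_inv,
      Matrix.one_mul]
  have h2 : Tendsto (fun k => X * wordMat A (pref w k) * Y) atTop (𝓝 0) := by
    rw [tendsto_matrix_zero_iff]
    intro i j
    have h3 : ∀ v, (X * wordMat A v * Y) i j =
        (I * wordMat A (x i ++ v ++ (y j ++ [0])) * F) 0 0 -
          (I * wordMat A (x i ++ v ++ y j) * F) 0 0 := by
      intro v
      rw [← Matrix.sub_apply]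
      have : I * wordMat A (x i ++ v ++ (y j ++ [0])) * F - I * wordMat A (x i ++ v ++ y j) * F =
          (I * wordMat A (x i)) * wordMat A v * (wordMat A (y j) * (A 0 * F - F)) := by
        simp only [wordMat_append, wordMat_singleton, Matrix.mul_sub, Matrix.mul_assoc]
      rw [this, Matrix.mul_apply, Matrix.mul_apply]
      refine Finset.sum_congr rfl fun q _ => ?_
      have h4 : (X * wordMat A v) i q = (I * wordMat A (x i) * wordMat A v) 0 q := by
        rw [Matrix.mul_apply, Matrix.mul_apply]
        simp only [h.row]
      rw [h.col, h4]
    rw [Metric.tendsto_atTop]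
    intro ε hε
    obtain ⟨k, hk⟩ := (isMartingale_entry (I := I) hap).exists_close hg hlim (app (x i) w)
      (ε := ε / 3) (by positivity)
    refine ⟨k, fun l hl => ?_⟩
    have h4 := hk ((x i).length + l) (by omega)
    rw [pref_app_add] at h4
    have h5 := abs_le.1 (h4 (y j ++ [0]))
    have h6 := abs_le.1 (h4 (y j))
    rw [dist_zero_right, h3, Real.norm_eq_abs, abs_lt]
    constructor <;> linarith
  simp only [h1]
  rw [tendsto_entrySum] at h2 ⊢
  have h3 := h2.const_mul (entrySum L)
  rw [mul_zero] at h3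
  exact squeeze_zero (fun _ => entrySum_nonneg _) (fun _ => entrySum_mul_le _ _) h3

/-- Modulo the annihilated vectors, `A_a^k F - F` is the geometric sum of the `B_a^j G` for `j < k`,
up to sign; it telescopes when `G = p - B_a p`. -/
theorem mul_pow_letter {a : Fin 2} {p : Matrix T (Fin 1) ℝ} (hp : p - B a * p = G) (k : ℕ) :
    X * (wordMat A (List.replicate k a) * F) =
      X * F + (X * Y) * (letterSign a • (p - wordMat B (List.replicate k a) * p)) := by
  induction k with
  | zero => simp [wordMat_nil]
  | succ k ih =>
    have h1 : X * (A a * F) = X * F + (X * Y) * (letterSign a • G) := by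
      rw [← h.mul_diff hap, Matrix.mul_sub]; abel
    rw [List.replicate_succ, wordMat_cons, wordMat_cons, Matrix.mul_assoc, ← Matrix.mul_assoc,
      h.mul_wt, Matrix.mul_assoc, ih, Matrix.mul_add, ← Matrix.mul_assoc, ← h.mul_wt,
      Matrix.mul_assoc, h1, ← Matrix.mul_assoc, h.mul_restr, add_assoc, Matrix.mul_assoc (X * Y),
      ← Matrix.mul_add]
    congr 2
    rw [Matrix.mul_smul, ← smul_add, ← hp, Matrix.mul_sub, Matrix.mul_assoc]
    congr 1
    abel

omit h hap in
theorem _root_.ApWFA.IsStable.tendsto_pow_letter (hB : IsStable B) (a : Fin 2)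
    (U : Matrix (Fin 1) T ℝ) (p : Matrix T (Fin 1) ℝ) :
    Tendsto (fun k => (U * (wordMat B (List.replicate k a) * p)) 0 0) atTop (𝓝 0) := by
  have h12 := tendsto_entrySum.1 (hB fun _ => a)
  simp only [pref_const] at h12
  have h13 := (h12.mul_const (entrySum p)).const_mul (entrySum U)
  rw [zero_mul, mul_zero] at h13
  refine squeeze_zero_norm (fun k => ?_) h13
  refine (abs_entry_le _ _ _).trans ((entrySum_mul_le _ _).trans ?_)
  exact mul_le_mul_of_nonneg_left (entrySum_mul_le _ _) (entrySum_nonneg _)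

/-- The jump at a dyadic point is split into a defect independent of `k` and two terms carrying
`B_1^k` and `B_0^k`, which disappear in the limit when `B` is stable. -/
theorem entry_sub_entry {p₀ p₁ : Matrix T (Fin 1) ℝ} (hp₀ : p₀ - B 0 * p₀ = G)
    (hp₁ : p₁ - B 1 * p₁ = G) (v : List (Fin 2)) (k : ℕ) :
    (I * wordMat A (v ++ [0] ++ List.replicate k 1) * F) 0 0 -
      (I * wordMat A (v ++ [1] ++ List.replicate k 0) * F) 0 0 =
    (J * wordMat M v * ((X * Y) * ((2 : ℝ) • G - (B 1 * p₀ + B 0 * p₁)))) 0 0 +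
      ((J * (wordMat M v * (X * Y)) * B 0) * (wordMat B (List.replicate k 1) * p₁)) 0 0 +
      ((J * (wordMat M v * (X * Y)) * B 1) * (wordMat B (List.replicate k 0) * p₀)) 0 0 := by
  rw [← Matrix.sub_apply, ← Matrix.add_apply, ← Matrix.add_apply]
  refine congrFun (congrFun ?_ 0) 0
  have h5 : ∀ a b : Fin 2, I * wordMat A (v ++ [a] ++ List.replicate k b) * F =
      J * wordMat M v * (M a * (X * (wordMat A (List.replicate k b) * F))) := by
    intro a b
    rw [← Matrix.mul_assoc (M a), ← h.mul_wt, ← Matrix.mul_assoc, ← Matrix.mul_assoc,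
      ← Matrix.mul_assoc, ← h.init_mul_wordMat, wordMat_append, wordMat_append,
      wordMat_singleton]
    simp only [Matrix.mul_assoc]
  rw [h5, h5, h.mul_pow_letter hap hp₀, h.mul_pow_letter hap hp₁]
  have h6 : M 0 * (X * F) - M 1 * (X * F) = (X * Y) * ((2 : ℝ) • G) := by
    have h7 := h.mul_diff hap 0
    have h8 := h.mul_diff hap 1
    have h9 : M 0 * (X * F) - M 1 * (X * F) = X * (A 0 * F - F) - X * (A 1 * F - F) := by
      rw [← Matrix.mul_assoc, ← Matrix.mul_assoc, ← h.mul_wt, ← h.mul_wt, Matrix.mul_sub,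
        Matrix.mul_sub, Matrix.mul_assoc, Matrix.mul_assoc]
      abel
    rw [h9, h7, h8, ← Matrix.mul_sub]
    congr 1
    rw [← sub_smul]
    norm_num [letterSign]
  have h10 : ∀ a, ∀ z : Matrix T (Fin 1) ℝ, M a * ((X * Y) * z) = (X * Y) * (B a * z) := by
    intro a z
    rw [← Matrix.mul_assoc, h.mul_restr, Matrix.mul_assoc]
  rw [← Matrix.mul_sub, Matrix.mul_add, Matrix.mul_add, h10, h10, add_sub_add_comm, h6,
    ← Matrix.mul_sub, ← Matrix.mul_add]
  have h11 : ∀ a, ∀ z : Matrix T (Fin 1) ℝ, J * (wordMat M v * (X * Y)) * B a * z =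
      J * wordMat M v * ((X * Y) * (B a * z)) := by
    intro a z
    rw [Matrix.mul_assoc _ (B a), ← Matrix.mul_assoc J, Matrix.mul_assoc (J * wordMat M v)]
  rw [h11, h11, ← Matrix.mul_add, ← Matrix.mul_add, ← Matrix.mul_add, ← Matrix.mul_add]
  have h12 : (2 : ℝ) • G + (B 0 * letterSign 1 • (p₁ - wordMat B (List.replicate k 1) * p₁) -
      B 1 * letterSign 0 • (p₀ - wordMat B (List.replicate k 0) * p₀)) =
      (2 : ℝ) • G - (B 1 * p₀ + B 0 * p₁) + B 0 * (wordMat B (List.replicate k 1) * p₁) +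
        B 1 * (wordMat B (List.replicate k 0) * p₀) := by
    generalize wordMat B (List.replicate k 1) * p₁ = z₁
    generalize wordMat B (List.replicate k 0) * p₀ = z₀
    simp only [letterSign, if_true, one_smul, Matrix.mul_sub, Matrix.mul_neg,
      if_neg (show ¬ (1 : Fin 2) = 0 by decide), neg_smul]
    abel
  rw [h12]

/-- The jump at the dyadic point after `v` is `J M_v X Y δ = I A_v Y δ` for one vector `δ`. Taking
for `v` the row words `x_i` shows that vanishing jumps force `X Y δ = 0`, and the left inverse gives
`δ = 0`. -/
theorem limit_eq_iff {g : (ℕ → Fin 2) → ℝ}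
    (hlim : ∀ w, Tendsto (fun k => (I * wordMat A (pref w k) * F) 0 0) atTop (𝓝 (g w)))
    (hB : IsStable B) {p₀ p₁ : Matrix T (Fin 1) ℝ} (hp₀ : p₀ - B 0 * p₀ = G)
    (hp₁ : p₁ - B 1 * p₁ = G) :
    (∀ v, g (app (v ++ [0]) fun _ => 1) = g (app (v ++ [1]) fun _ => 0)) ↔
      B 1 * p₀ + B 0 * p₁ = (2 : ℝ) • G := by
  set δ := (2 : ℝ) • G - (B 1 * p₀ + B 0 * p₁) with hδ
  have h1 : ∀ v, g (app (v ++ [0]) fun _ => 1) - g (app (v ++ [1]) fun _ => 0) =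
      (J * wordMat M v * ((X * Y) * δ)) 0 0 := by
    intro v
    have h2 := (tendsto_pref_app (F := fun v => (I * wordMat A v * F) 0 0)).1
      (hlim (app (v ++ [0]) fun _ => 1))
    have h3 := (tendsto_pref_app (F := fun v => (I * wordMat A v * F) 0 0)).1
      (hlim (app (v ++ [1]) fun _ => 0))
    simp only [pref_const] at h2 h3
    refine tendsto_nhds_unique (h2.sub h3) ?_
    simp only [h.entry_sub_entry hap hp₀ hp₁]
    have h14 := (tendsto_const_nhds (x := (J * wordMat M v * ((X * Y) * δ)) 0 0)).add
      (hB.tendsto_pow_letter 1 (J * (wordMat M v * (X * Y)) * B 0) p₁)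
    simpa using h14.add (hB.tendsto_pow_letter 0 (J * (wordMat M v * (X * Y)) * B 1) p₀)
  have h2 : B 1 * p₀ + B 0 * p₁ = (2 : ℝ) • G ↔ δ = 0 := by
    rw [hδ, sub_eq_zero, eq_comm]
  rw [h2]
  constructor
  · intro hv
    have h3 : (X * Y) * δ = 0 := by
      ext i j
      rw [Subsingleton.elim j 0, Matrix.zero_apply]
      have h4 := h1 (x i)
      rw [hv, sub_self, ← Matrix.mul_assoc, ← Matrix.mul_assoc, ← h.init_mul_wordMat,
        Matrix.mul_assoc, Matrix.mul_apply] at h4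
      rw [Matrix.mul_assoc, Matrix.mul_apply, h4]
      simp only [h.row]
    rw [← Matrix.one_mul δ, ← h.left_inv, Matrix.mul_assoc, h3, Matrix.mul_zero]
  · intro hδ0 v
    rw [← sub_eq_zero, h1, hδ0]
    simp

end IsReduction

end Reduction

/-! ### Existence of reductions and of the fixed-point data -/

section Existence

theorem exists_spanning_words {K V : Type*} [Field K] [AddCommGroup V] [Module K V]
    [Module.Finite K V] {S : Type*} (f : List S → V) :
    ∃ (n : ℕ) (y : Fin n → List S), LinearIndependent K (fun i => f (y i)) ∧
      ∀ v, ∃ c : Fin n → K, ∑ i, c i • f (y i) = f v := by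
  obtain ⟨κ, a, -, hsp, hli⟩ := exists_linearIndependent' K f
  have : Finite κ := hli.finite
  obtain ⟨n, ⟨e⟩⟩ := Finite.exists_equiv_fin κ
  refine ⟨n, a ∘ e.symm, hli.comp _ e.symm.injective, fun v => ?_⟩
  have h1 : f v ∈ Submodule.span K (Set.range (f ∘ a)) := by
    rw [hsp]; exact Submodule.subset_span ⟨v, rfl⟩
  have h2 : Set.range (f ∘ a) = Set.range fun i => f ((a ∘ e.symm) i) := by
    rw [← e.symm.surjective.range_comp (f ∘ a)]; rfl
  rw [h2] at h1
  exact (Submodule.mem_span_range_iff_exists_fun K).1 h1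

theorem exists_left_inverse_of_linearIndependent {K P T : Type*} [Field K] [Fintype P]
    [DecidableEq P] [Fintype T] [DecidableEq T] (H : Matrix P T K)
    (hH : LinearIndependent K fun j => fun i => H i j) : ∃ L : Matrix T P K, L * H = 1 := by
  have h1 := hH.fintypeLinearCombination_injective
  obtain ⟨g, hg⟩ := LinearMap.exists_leftInverse_of_injective _ (LinearMap.ker_eq_bot.2 h1)
  refine ⟨LinearMap.toMatrix' g, ?_⟩
  ext i j
  have h2 : (LinearMap.toMatrix' g * H) i j = (LinearMap.toMatrix' g *ᵥ fun i => H i j) i := rfl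
  have h3 := LinearMap.congr_fun hg (Pi.single j 1)
  rw [LinearMap.comp_apply, Fintype.linearCombination_apply_single, one_smul] at h3
  rw [h2, ← Matrix.toLin'_apply, Matrix.toLin'_toMatrix', h3, Matrix.one_apply]
  simp [Pi.single_apply]

/-- Words `x` are chosen so that the `I A_x` span all `I A_v`; then words `y` so that the `X A_y
(A_0 F - F)` form a basis of the corresponding span. Multiplying by `X` before choosing is what
factors out the annihilated vectors. Appending a letter to an `x`, or prepending one to a `y`, stays
in the span, which yields `M` and `B`. -/
theorem exists_isReduction {K Q : Type*} [Field K] [Fintype Q] [DecidableEq Q]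
    (A : Fin 2 → Matrix Q Q K) (I : Matrix (Fin 1) Q K) (F : Matrix Q (Fin 1) K) :
    ∃ (s t : ℕ) (x : Fin s → List (Fin 2)) (y : Fin t → List (Fin 2)) (X : Matrix (Fin s) Q K)
      (Y : Matrix Q (Fin t) K) (M : Fin 2 → Matrix (Fin s) (Fin s) K)
      (J : Matrix (Fin 1) (Fin s) K) (B : Fin 2 → Matrix (Fin t) (Fin t) K)
      (G : Matrix (Fin t) (Fin 1) K) (L : Matrix (Fin t) (Fin s) K),
      IsReduction A I F x y X Y M J B G L := by
  obtain ⟨s, x, -, hx⟩ := exists_spanning_words (K := K) fun v => (I * wordMat A v) 0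
  let X : Matrix (Fin s) Q K := Matrix.of fun i => (I * wordMat A (x i)) 0
  have hX : ∀ v, ∃ C : Matrix (Fin 1) (Fin s) K, C * X = I * wordMat A v := by
    intro v
    obtain ⟨c, hc⟩ := hx v
    refine ⟨Matrix.of fun _ => c, ?_⟩
    ext i q
    rw [Subsingleton.elim i 0, ← hc, Matrix.mul_apply]
    simp [X]
  obtain ⟨t, y, hli, hy⟩ := exists_spanning_words (K := K) fun v (i : Fin s) =>
    (X * (wordMat A v * (A 0 * F - F))) i 0
  let Y : Matrix Q (Fin t) K := Matrix.of fun q j => (wordMat A (y j) * (A 0 * F - F)) q 0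
  have hXY : ∀ i j, (X * Y) i j = (X * (wordMat A (y j) * (A 0 * F - F))) i 0 := by
    intro i j
    rw [Matrix.mul_apply, Matrix.mul_apply]
    rfl
  have hY : ∀ v, ∃ C : Matrix (Fin t) (Fin 1) K,
      (X * Y) * C = X * (wordMat A v * (A 0 * F - F)) := by
    intro v
    obtain ⟨c, hc⟩ := hy v
    refine ⟨Matrix.of fun j _ => c j, ?_⟩
    ext i k
    have := congrFun hc i
    simp only [Finset.sum_apply, Pi.smul_apply, smul_eq_mul] at this
    rw [Subsingleton.elim k 0, ← this, Matrix.mul_apply]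
    refine Finset.sum_congr rfl fun j _ => ?_
    rw [hXY, Matrix.of_apply, mul_comm]
  obtain ⟨L, hL⟩ := exists_left_inverse_of_linearIndependent (X * Y) (by
    simp only [hXY]; exact hli)
  obtain ⟨J, hJ⟩ := hX []
  obtain ⟨G, hG⟩ := hY []
  have hM : ∀ a, ∃ M : Matrix (Fin s) (Fin s) K, X * A a = M * X := by
    intro a
    choose C hC using fun i => hX (x i ++ [a])
    refine ⟨Matrix.of fun i => C i 0, ?_⟩
    ext i q
    have h1 := congrFun (congrFun (hC i) 0) q
    rw [wordMat_append, wordMat_singleton, ← Matrix.mul_assoc, Matrix.mul_apply,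
      Matrix.mul_apply] at h1
    rw [Matrix.mul_apply, Matrix.mul_apply]
    exact h1.symm
  choose M hM using hM
  have hB : ∀ a, ∃ B : Matrix (Fin t) (Fin t) K, M a * (X * Y) = (X * Y) * B := by
    intro a
    choose C hC using fun j => hY (a :: y j)
    refine ⟨Matrix.of fun i j => C j i 0, ?_⟩
    rw [← Matrix.mul_assoc, ← hM]
    ext i j
    have h1 := congrFun (congrFun (hC j) i) 0
    rw [wordMat_cons, Matrix.mul_assoc (A a), ← Matrix.mul_assoc X, Matrix.mul_apply,
      Matrix.mul_apply] at h1
    rw [Matrix.mul_apply, Matrix.mul_apply]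
    exact h1.symm
  choose B hB using hB
  exact ⟨s, t, x, y, X, Y, M, J, B, G, L, fun i q => rfl, fun q j => rfl, hM,
    by simpa [wordMat_nil] using hJ, hB, by simpa [wordMat_nil] using hG, hL⟩

theorem IsReduction.map {R R' Q P T : Type*} [CommRing R] [CommRing R'] [Fintype Q]
    [DecidableEq Q] [Fintype P] [DecidableEq P] [Fintype T] [DecidableEq T]
    {A : Fin 2 → Matrix Q Q R}
    {I : Matrix (Fin 1) Q R} {F : Matrix Q (Fin 1) R} {x : P → List (Fin 2)}
    {y : T → List (Fin 2)} {X : Matrix P Q R} {Y : Matrix Q T R} {M : Fin 2 → Matrix P P R}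
    {J : Matrix (Fin 1) P R} {B : Fin 2 → Matrix T T R} {G : Matrix T (Fin 1) R}
    {L : Matrix T P R} (h : IsReduction A I F x y X Y M J B G L) (φ : R →+* R') :
    IsReduction (fun a => (A a).map φ) (I.map φ) (F.map φ) x y (X.map φ) (Y.map φ)
      (fun a => (M a).map φ) (J.map φ) (fun a => (B a).map φ) (G.map φ) (L.map φ) where
  row i q := by
    rw [wordMat_map, ← Matrix.map_mul, Matrix.map_apply, Matrix.map_apply, h.row]
  col q j := by
    rw [wordMat_map, ← Matrix.map_mul, ← Matrix.map_sub _ (map_sub φ), ← Matrix.map_mul,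
      Matrix.map_apply, Matrix.map_apply, h.col]
  mul_wt a := by rw [← Matrix.map_mul, ← Matrix.map_mul, h.mul_wt]
  init := by rw [← Matrix.map_mul, h.init]
  mul_restr a := by
    rw [← Matrix.map_mul, ← Matrix.map_mul, ← Matrix.map_mul, h.mul_restr]
  diff := by
    rw [← Matrix.map_mul, ← Matrix.map_mul, ← Matrix.map_mul, ← Matrix.map_sub _ (map_sub φ),
      ← Matrix.map_mul, h.diff]
  left_inv := by
    rw [← Matrix.map_mul, ← Matrix.map_mul, h.left_inv, Matrix.map_one _ φ.map_zero φ.map_one]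

/-- Either `1 - B` is invertible or `1` is an eigenvalue of `B`. -/
theorem exists_fixed_or_solution {K T : Type*} [Field K] [Fintype T] [DecidableEq T]
    (B : Matrix T T K) (G : Matrix T (Fin 1) K) :
    (∃ p : Matrix T (Fin 1) K, p - B * p = G) ∨ ∃ z : Matrix T (Fin 1) K, z ≠ 0 ∧ B * z = z := by
  by_cases hdet : (1 - B).det = 0
  · right
    obtain ⟨z, hz, hBz⟩ := Matrix.exists_mulVec_eq_zero_iff.2 hdet
    refine ⟨Matrix.of fun i _ => z i, fun h => hz ?_, ?_⟩
    · funext i; exact congrFun (congrFun h i) 0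
    · rw [Matrix.sub_mulVec, Matrix.one_mulVec, sub_eq_zero] at hBz
      ext i j
      exact (congrFun hBz i).symm
  · left
    refine ⟨(1 - B)⁻¹ * G, ?_⟩
    have h1 : (1 - B) * ((1 - B)⁻¹ * G) = G := by
      rw [← Matrix.mul_assoc, Matrix.mul_nonsing_inv _ (isUnit_iff_ne_zero.2 hdet),
        Matrix.one_mul]
    rwa [Matrix.sub_mul, Matrix.one_mul] at h1

/-- The powers of `B a` keep `z` in place, so the products along the constant word `a^ω` cannot tend
to zero. -/
theorem not_isStable_of_fixed {T : Type*} [Fintype T] [DecidableEq T]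
    {S : Type*} {B : S → Matrix T T ℝ} {a : S} {z : Matrix T (Fin 1) ℝ} (hz : z ≠ 0)
    (hBz : B a * z = z) : ¬ IsStable B := by
  intro hB
  have h1 : ∀ k, wordMat B (List.replicate k a) * z = z := by
    intro k
    induction k with
    | zero => simp [wordMat_nil]
    | succ k ih => rw [List.replicate_succ, wordMat_cons, Matrix.mul_assoc, ih, hBz]
  have h2 := tendsto_entrySum.1 (hB fun _ => a)
  simp only [pref_const] at h2
  have h3 := h2.mul_const (entrySum z)
  rw [zero_mul] at h3
  have h4 : entrySum z ≤ 0 := ge_of_tendsto' h3 fun k => by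
    have := entrySum_mul_le (wordMat B (List.replicate k a)) z
    rwa [h1] at this
  apply hz
  ext i j
  exact abs_nonpos_iff.1 ((abs_entry_le z i j).trans h4)

end Existence

/-! ### Continuity of an automaton over `K` in terms of its reduction -/

section Continuity

variable {Q P T : Type*} [Fintype Q] [DecidableEq Q] [Fintype P]
    [DecidableEq P] [Fintype T] [DecidableEq T] {K : Type*} [Field K] (φ : K →+* ℝ)
    {𝒜 : WFA K (Fin 2) Q} {x : P → List (Fin 2)}
    {y : T → List (Fin 2)} {X : Matrix P Q K} {Y : Matrix Q T K} {M : Fin 2 → Matrix P P K}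
    {J : Matrix (Fin 1) P K} {B : Fin 2 → Matrix T T K} {G : Matrix T (Fin 1) K}
    {L : Matrix T P K}

/-- Both functions of the automaton `𝒜` are everywhere continuous. -/
def IsContinuousWFA (𝒜 : WFA ℝ (Fin 2) Q) : Prop :=
  EverywhereContinuous (omegaFun 𝒜.wordFun) ∧ EverywhereContinuous (realFun (omegaFun 𝒜.wordFun))

theorem WFA.wordFun_map_eq (v : List (Fin 2)) : (𝒜.map φ).wordFun v =
    ((Matrix.replicateRow (Fin 1) 𝒜.init).map φ * wordMat (fun a => (𝒜.wt a).map φ) v *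
      (Matrix.replicateCol (Fin 1) 𝒜.final).map φ) 0 0 := by
  rw [Matrix.mul_assoc]
  rfl

omit [DecidableEq Q] in
theorem WFA.IsAveragePreserving.replicateCol {R : Type*} [CommRing R] {𝒜 : WFA R (Fin 2) Q}
    (h : 𝒜.IsAveragePreserving) :
    𝒜.wt 0 * Matrix.replicateCol (Fin 1) 𝒜.final + 𝒜.wt 1 * Matrix.replicateCol (Fin 1) 𝒜.final =
      (2 : R) • Matrix.replicateCol (Fin 1) 𝒜.final := by
  simp only [WFA.IsAveragePreserving, Fin.sum_univ_two, Fintype.card_fin] at h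
  ext i j
  have := congrFun h i
  simpa [Matrix.mul_apply, Matrix.mulVec, dotProduct] using this

variable (h : IsReduction 𝒜.wt (Matrix.replicateRow (Fin 1) 𝒜.init)
    (Matrix.replicateCol (Fin 1) 𝒜.final) x y X Y M J B G L)
  (hap : 𝒜.IsAveragePreserving)

include h hap

theorem IsReduction.everywhereContinuous_iff :
    EverywhereContinuous (omegaFun (𝒜.map φ).wordFun) ↔ IsStable fun a => (B a).map φ := by
  have hap' := (hap.map φ).replicateCol
  rw [everywhereContinuous_omegaFun]
  constructor
  · rintro ⟨g, hg, hlim⟩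
    simp only [WFA.wordFun_map_eq] at hlim
    exact (h.map φ).isStable hap' hg hlim
  · intro hB
    have := (h.map φ).oscVanish hap' hB
    simp only [← WFA.wordFun_map_eq] at this
    exact this.exists_continuous

/-- The real criterion is pulled back along the injective `φ`, so that the gluing equation is one
between matrices over `K`, where equality is decidable. -/
theorem IsReduction.isContinuousWFA_iff {p₀ p₁ : Matrix T (Fin 1) K} (hp₀ : p₀ - B 0 * p₀ = G)
    (hp₁ : p₁ - B 1 * p₁ = G) : IsContinuousWFA (𝒜.map φ) ↔
      (IsStable fun a => (B a).map φ) ∧ B 1 * p₀ + B 0 * p₁ = (2 : K) • G := by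
  have hap' := (hap.map φ).replicateCol
  rw [IsContinuousWFA, h.everywhereContinuous_iff φ hap]
  refine and_congr_right fun hB => ?_
  obtain ⟨g, hg, hlim⟩ := everywhereContinuous_omegaFun.1
    ((h.everywhereContinuous_iff φ hap).2 hB)
  rw [everywhereContinuous_realFun hg hlim]
  simp only [WFA.wordFun_map_eq] at hlim
  rw [(h.map φ).limit_eq_iff hap' hlim hB (p₀ := p₀.map φ) (p₁ := p₁.map φ)
    (by rw [← Matrix.map_mul, ← Matrix.map_sub _ (map_sub φ), hp₀])
    (by rw [← Matrix.map_mul, ← Matrix.map_sub _ (map_sub φ), hp₁])]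
  have h1 : (2 : ℝ) • G.map φ = ((2 : K) • G).map φ := by
    ext i j; simp [map_ofNat]
  rw [h1, ← Matrix.map_mul, ← Matrix.map_mul, ← Matrix.map_add _ (map_add φ)]
  exact (Matrix.map_injective φ.injective).eq_iff

theorem IsReduction.not_isContinuousWFA {a : Fin 2} {z : Matrix T (Fin 1) K} (hz : z ≠ 0)
    (hBz : B a * z = z) : ¬ IsContinuousWFA (𝒜.map φ) := by
  intro hc
  have hB := (h.everywhereContinuous_iff φ hap).1 hc.1
  refine not_isStable_of_fixed (a := a) (z := z.map φ) (fun h0 => hz ?_) ?_ hB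
  · apply Matrix.map_injective φ.injective
    simp only [h0]; ext; simp
  · rw [← Matrix.map_mul, hBz]

end Continuity

/-! ### Computability of matrix operations -/

section Computability

open Encodable

theorem _root_.ComputablePred.and {α : Type*} [Primcodable α] {p q : α → Prop}
    (hp : ComputablePred p) (hq : ComputablePred q) : ComputablePred fun a => p a ∧ q a := by
  classical
  refine Computable.computablePred ((Primrec.and.to_comp.comp hp.decide hq.decide).of_eq ?_)
  intro a; simp

theorem _root_.ComputablePred.or {α : Type*} [Primcodable α] {p q : α → Prop}
    (hp : ComputablePred p) (hq : ComputablePred q) : ComputablePred fun a => p a ∨ q a := by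
  classical
  refine Computable.computablePred ((Primrec.or.to_comp.comp hp.decide hq.decide).of_eq ?_)
  intro a; simp

theorem _root_.ComputablePred.comp {α β : Type*} [Primcodable α] [Primcodable β] {p : β → Prop}
    {f : α → β} (hp : ComputablePred p) (hf : Computable f) : ComputablePred fun a => p (f a) := by
  classical
  exact Computable.computablePred (hp.decide.comp hf)

theorem _root_.PrimrecRel.computablePred_comp {α β γ : Type*} [Primcodable α] [Primcodable β]
    [Primcodable γ] {r : β → γ → Prop} (hr : PrimrecRel r) {f : α → β} {g : α → γ}
    (hf : Computable f) (hg : Computable g) : ComputablePred fun a => r (f a) (g a) :=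
  (PrimrecPred.computablePred hr).comp (hf.pair hg)

theorem _root_.ComputablePred.computable_ite {α σ : Type*} [Primcodable α] [Primcodable σ]
    {p : α → Prop} [DecidablePred p] (hp : ComputablePred p)
    {f g : α → σ} (hf : Computable f) (hg : Computable g) :
    Computable fun a => if p a then f a else g a :=
  (Computable.cond hp.decide hf hg).of_eq fun a => by simp [Bool.cond_decide]

/-- Distinct elements have distinct codes, so equality is tested on the codes. -/
theorem computablePred_eq {α β : Type*} [Primcodable α] [Primcodable β] {f g : α → β}
    (hf : Computable f) (hg : Computable g) : ComputablePred fun a => f a = g a := by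
  refine (PrimrecRel.computablePred_comp (Primrec.eq (α := ℕ)) (Computable.encode.comp hf)
    (Computable.encode.comp hg)).of_eq fun a => ?_
  exact encode_injective.eq_iff

theorem Computable.list_getD {α σ : Type*} [Primcodable α] [Primcodable σ] {f : α → List σ}
    {g : α → ℕ} (hf : Computable f) (hg : Computable g) (d : σ) :
    Computable fun a => (f a).getD (g a) d :=
  (Primrec.list_getD d).to_comp.comp hf hg

theorem Computable.list_generate {α σ : Type*} [Primcodable α] [Primcodable σ] {n : α → ℕ}
    {f : α × ℕ → σ} (hn : Computable n) (hf : Computable f) :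
    Computable fun a => List.ofFn fun i : Fin (n a) => f (a, i) := by
  have h1 : Computable fun a => Nat.rec (motive := fun _ => List σ) []
      (fun k l => l ++ [f (a, k)]) (n a) := by
    refine Computable.nat_rec (h := fun a p => p.2 ++ [f (a, p.1)]) hn (Computable.const []) ?_
    exact Computable.list_concat.comp (Computable.snd.comp Computable.snd)
      (hf.comp (Computable.fst.pair (Computable.fst.comp Computable.snd)))
  refine h1.of_eq fun a => ?_
  induction n a with
  | zero => simp
  | succ k ih =>
    rw [List.ofFn_succ_last]
    exact congrArg (· ++ [f (a, k)]) ih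

variable {K : Type*} [Field K] [Primcodable K]

theorem computable_sum_range {α : Type*} [Primcodable α]
    (hadd : Computable₂ fun x y : K => x + y) {n : α → ℕ} {f : α × ℕ → K} (hn : Computable n)
    (hf : Computable f) : Computable fun a => ∑ i ∈ Finset.range (n a), f (a, i) := by
  have h1 : Computable fun a => Nat.rec (motive := fun _ => K) 0
      (fun k s => s + f (a, k)) (n a) := by
    refine Computable.nat_rec (h := fun a p => p.2 + f (a, p.1)) hn (Computable.const 0) ?_
    exact hadd.comp (Computable.snd.comp Computable.snd)
      (hf.comp (Computable.fst.pair (Computable.fst.comp Computable.snd)))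
  refine h1.of_eq fun a => ?_
  induction n a with
  | zero => simp
  | succ k ih => rw [Finset.sum_range_succ, ← ih]

omit [Primcodable K] in
variable (K) in
/-- The entry in row `i` and column `j` of the matrix with list of rows `l`. -/
def listEntry (l : List (List K)) (i j : ℕ) : K := (l.getD i []).getD j 0

/-- The list of the rows of a matrix. -/
def rowList {m n : ℕ} (M : Matrix (Fin m) (Fin n) K) : List (List K) :=
  List.ofFn fun i => List.ofFn fun j => M i j

/-- The `m × n` matrix with the list of rows `l`. -/
def ofRowList (m n : ℕ) (l : List (List K)) : Matrix (Fin m) (Fin n) K :=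
  Matrix.of fun i j => listEntry K l i j

omit [Primcodable K] in
theorem listEntry_rowList {m n : ℕ} (M : Matrix (Fin m) (Fin n) K) (i : Fin m) (j : Fin n) :
    listEntry K (rowList M) i j = M i j := by
  simp [listEntry, rowList]

omit [Primcodable K] in
theorem ofRowList_rowList {m n : ℕ} (M : Matrix (Fin m) (Fin n) K) :
    ofRowList m n (rowList M) = M := by
  ext i j
  exact listEntry_rowList M i j

omit [Primcodable K] in
theorem rowList_injective {m n : ℕ} :
    Function.Injective (rowList : Matrix (Fin m) (Fin n) K → List (List K)) :=
  fun M N h => by rw [← ofRowList_rowList M, h, ofRowList_rowList]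

theorem computable_listEntry {α : Type*} [Primcodable α] {l : α → List (List K)} {i j : α → ℕ}
    (hl : Computable l) (hi : Computable i) (hj : Computable j) :
    Computable fun a => listEntry K (l a) (i a) (j a) :=
  Computable.list_getD (Computable.list_getD hl hi []) hj 0

/-- A family of matrices whose lists of rows depend computably on the parameter. -/
def ComputableMatrix {α : Type*} [Primcodable α] {m n : α → ℕ}
    (M : ∀ a, Matrix (Fin (m a)) (Fin (n a)) K) : Prop :=
  Computable fun a => rowList (M a)

variable {α β : Type*} [Primcodable α] [Primcodable β]

namespace ComputableMatrix

omit [Field K] in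
theorem of_entries {m n : α → ℕ} {M : ∀ a, Matrix (Fin (m a)) (Fin (n a)) K} (hm : Computable m)
    (hn : Computable n) {f : (α × ℕ) × ℕ → K} (hf : Computable f)
    (h : ∀ a i j, M a i j = f ((a, (i : ℕ)), (j : ℕ))) : ComputableMatrix M := by
  have h1 := Computable.list_generate (n := fun p : α × ℕ => n p.1) (hn.comp Computable.fst) hf
  refine (Computable.list_generate hm h1).of_eq fun a => ?_
  simp only [rowList, h]

omit [Field K] in
theorem comp {m n : β → ℕ} {M : ∀ b, Matrix (Fin (m b)) (Fin (n b)) K} (hM : ComputableMatrix M)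
    {f : α → β} (hf : Computable f) : ComputableMatrix fun a => M (f a) :=
  Computable.comp hM hf

theorem entry {m n : α → ℕ} {M : ∀ a, Matrix (Fin (m a)) (Fin (n a)) K} (hM : ComputableMatrix M)
    {i j : α → ℕ} (hi : Computable i) (hj : Computable j) :
    Computable fun a => listEntry K (rowList (M a)) (i a) (j a) :=
  computable_listEntry hM hi hj

theorem ofRowList {m n : α → ℕ} (hm : Computable m) (hn : Computable n) {l : α → List (List K)}
    (hl : Computable l) : ComputableMatrix fun a => ofRowList (m a) (n a) (l a) :=
  of_entries hm hn (computable_listEntry (hl.comp (Computable.fst.comp Computable.fst))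
    (Computable.snd.comp Computable.fst) Computable.snd) fun _ _ _ => rfl

theorem zipWith {m n : α → ℕ} {M N O : ∀ a, Matrix (Fin (m a)) (Fin (n a)) K}
    (hm : Computable m) (hn : Computable n) (hM : ComputableMatrix M) (hN : ComputableMatrix N)
    {f : K → K → K} (hf : Computable₂ f) (h : ∀ a i j, O a i j = f (M a i j) (N a i j)) :
    ComputableMatrix O := by
  have h1 : ∀ {L : ∀ a, Matrix (Fin (m a)) (Fin (n a)) K}, ComputableMatrix L →
      Computable fun p : (α × ℕ) × ℕ => listEntry K (rowList (L p.1.1)) p.1.2 p.2 := fun hL =>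
    computable_listEntry (Computable.comp hL (Computable.fst.comp Computable.fst))
      (Computable.snd.comp Computable.fst) Computable.snd
  refine of_entries hm hn (hf.comp (h1 hM) (h1 hN)) fun a i j => ?_
  rw [h]
  simp only [listEntry_rowList]

theorem mul {m p n : α → ℕ} {M : ∀ a, Matrix (Fin (m a)) (Fin (p a)) K}
    {N : ∀ a, Matrix (Fin (p a)) (Fin (n a)) K} (hadd : Computable₂ fun x y : K => x + y)
    (hmul : Computable₂ fun x y : K => x * y) (hm : Computable m) (hp : Computable p)
    (hn : Computable n) (hM : ComputableMatrix M) (hN : ComputableMatrix N) :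
    ComputableMatrix fun a => M a * N a := by
  have hf : Computable fun q : ((α × ℕ) × ℕ) × ℕ => q.1.1.1 :=
    Computable.fst.comp (Computable.fst.comp Computable.fst)
  have hi : Computable fun q : ((α × ℕ) × ℕ) × ℕ => q.1.1.2 :=
    Computable.snd.comp (Computable.fst.comp Computable.fst)
  have hj : Computable fun q : ((α × ℕ) × ℕ) × ℕ => q.1.2 := Computable.snd.comp Computable.fst
  have hk : Computable fun q : ((α × ℕ) × ℕ) × ℕ => q.2 := Computable.snd
  have h1 : Computable fun q : ((α × ℕ) × ℕ) × ℕ =>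
      listEntry K (rowList (M q.1.1.1)) q.1.1.2 q.2 := entry (hM.comp hf) hi hk
  have h2 : Computable fun q : ((α × ℕ) × ℕ) × ℕ =>
      listEntry K (rowList (N q.1.1.1)) q.2 q.1.2 := entry (hN.comp hf) hk hj
  have h3 : Computable fun q : (α × ℕ) × ℕ => ∑ k ∈ Finset.range (p q.1.1),
      listEntry K (rowList (M q.1.1)) q.1.2 k * listEntry K (rowList (N q.1.1)) k q.2 :=
    computable_sum_range (n := fun q : (α × ℕ) × ℕ => p q.1.1)
      (f := fun q : ((α × ℕ) × ℕ) × ℕ => listEntry K (rowList (M q.1.1.1)) q.1.1.2 q.2 *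
        listEntry K (rowList (N q.1.1.1)) q.2 q.1.2) hadd
      (hp.comp (Computable.fst.comp Computable.fst)) (hmul.comp h1 h2)
  refine of_entries hm hn h3 ?_
  intro a i j
  rw [Matrix.mul_apply, Finset.sum_range]
  simp only [listEntry_rowList]

omit [Field K] in
theorem ite {m n : α → ℕ} {M N : ∀ a, Matrix (Fin (m a)) (Fin (n a)) K} {p : α → Prop}
    [DecidablePred p] (hp : ComputablePred p) (hM : ComputableMatrix M)
    (hN : ComputableMatrix N) : ComputableMatrix fun a => if p a then M a else N a := by
  classical
  refine Computable.of_eq (hp.computable_ite hM hN) fun a => ?_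
  by_cases h : p a <;> simp [h]

theorem eq {m n : α → ℕ} {M N : ∀ a, Matrix (Fin (m a)) (Fin (n a)) K}
    (hM : ComputableMatrix M) (hN : ComputableMatrix N) : ComputablePred fun a => M a = N a :=
  (computablePred_eq hM hN).of_eq fun _ => rowList_injective.eq_iff

theorem one {n : α → ℕ} (hn : Computable n) :
    ComputableMatrix fun a => (1 : Matrix (Fin (n a)) (Fin (n a)) K) := by
  classical
  have h1 : ComputablePred fun p : (α × ℕ) × ℕ => p.1.2 = p.2 :=
    computablePred_eq (Computable.snd.comp Computable.fst) Computable.snd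
  refine of_entries hn hn (h1.computable_ite (Computable.const 1) (Computable.const 0)) ?_
  intro a i j
  simp [Matrix.one_apply, Fin.ext_iff]

theorem add {m n : α → ℕ} {M N : ∀ a, Matrix (Fin (m a)) (Fin (n a)) K}
    (hadd : Computable₂ fun x y : K => x + y) (hm : Computable m) (hn : Computable n)
    (hM : ComputableMatrix M) (hN : ComputableMatrix N) : ComputableMatrix fun a => M a + N a :=
  zipWith hm hn hM hN hadd fun _ _ _ => rfl

theorem sub {m n : α → ℕ} {M N : ∀ a, Matrix (Fin (m a)) (Fin (n a)) K}
    (hadd : Computable₂ fun x y : K => x + y) (hmul : Computable₂ fun x y : K => x * y)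
    (hm : Computable m) (hn : Computable n)
    (hM : ComputableMatrix M) (hN : ComputableMatrix N) : ComputableMatrix fun a => M a - N a := by
  -- Subtraction is expressed through the two operations assumed computable.
  have h1 : Computable₂ fun x y : K => x + (-1) * y :=
    hadd.comp Computable.fst (hmul.comp (Computable.const (-1)) Computable.snd)
  exact zipWith hm hn hM hN h1 fun a i j => by rw [Matrix.sub_apply]; ring

theorem smul {m n : α → ℕ} {M : ∀ a, Matrix (Fin (m a)) (Fin (n a)) K}
    (hmul : Computable₂ fun x y : K => x * y) (hm : Computable m) (hn : Computable n)
    (hM : ComputableMatrix M) (c : K) : ComputableMatrix fun a => c • M a := by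
  have h1 : Computable₂ fun x _ : K => c * x :=
    hmul.comp (Computable.const c) Computable.fst
  exact zipWith hm hn hM hM h1 fun a i j => by rw [Matrix.smul_apply, smul_eq_mul]

theorem wordMat {n : α → ℕ} {A : ∀ a, Fin 2 → Matrix (Fin (n a)) (Fin (n a)) K}
    (hadd : Computable₂ fun x y : K => x + y) (hmul : Computable₂ fun x y : K => x * y)
    (hn : Computable n) (hA : ∀ i, ComputableMatrix fun a => A a i) {v : α → List (Fin 2)}
    (hv : Computable v) : ComputableMatrix fun a => wordMat (A a) (v a) := by
  -- The size of the matrices depends on `a`, so the recursion carries the rows of the partial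
  -- product as a list and rebuilds the matrix at each step.
  have hstep : Computable₂ fun (a : α) (q : ℕ × List (List K)) =>
      rowList (ApWFA.ofRowList (n a) (n a) q.2 *
        if (v a).getD q.1 0 = 0 then A a 0 else A a 1) := by
    have hn' : Computable fun q : α × (ℕ × List (List K)) => n q.1 := hn.comp Computable.fst
    refine mul (m := fun q : α × (ℕ × List (List K)) => n q.1) hadd hmul hn' hn' hn'
      (ofRowList hn' hn' (Computable.snd.comp Computable.snd)) (ite ?_ ?_ ?_)
    · exact computablePred_eq (Computable.list_getD (hv.comp Computable.fst)
        (Computable.fst.comp Computable.snd) 0) (Computable.const 0)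
    · exact (hA 0).comp Computable.fst
    · exact (hA 1).comp Computable.fst
  have h1 := Computable.nat_rec (f := fun a => (v a).length)
    (Computable.list_length.comp hv) (one hn) hstep
  refine h1.of_eq fun a => ?_
  have h2 : ∀ k ≤ (v a).length, (Nat.rec (motive := fun _ => List (List K))
      (rowList (1 : Matrix (Fin (n a)) (Fin (n a)) K))
      (fun k l => rowList (ApWFA.ofRowList (n a) (n a) l *
        if (v a).getD k 0 = 0 then A a 0 else A a 1)) k) =
      rowList (ApWFA.wordMat (A a) ((v a).take k)) := by
    intro k
    induction k with
    | zero => intro _; simp [wordMat_nil]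
    | succ k ih =>
      intro hk
      have h3 : (v a).take (k + 1) = (v a).take k ++ [(v a)[k]] := by simp
      have h4 : (v a).getD k 0 = (v a)[k] := List.getD_eq_getElem _ _ (by omega)
      have h5 : (if (v a)[k] = 0 then A a 0 else A a 1) = A a (v a)[k] := by
        generalize (v a)[k] = b
        fin_cases b <;> rfl
      simp only [ih (by omega)]
      rw [ofRowList_rowList, h3, wordMat_append, wordMat_singleton, h4, h5]
  have h3 := h2 _ le_rfl
  rw [List.take_length] at h3
  exact h3

end ComputableMatrix

/-! ### Reductions by certificates -/

theorem decisionFun_code {X C : Type*} [Primcodable C] {code : X → C}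
    (hcode : Function.Injective code) (Yes : X → Prop) [Decidable (∃ x, Yes x)] (x : X) :
    (Yes x → decisionFun code Yes (encode (code x)) = Part.some 1) ∧
      (¬ Yes x → decisionFun code Yes (encode (code x)) = Part.some 0) := by
  constructor
  · intro h
    simp only [decisionFun]
    rw [if_pos ⟨x, h, rfl⟩]
  · intro h
    simp only [decisionFun]
    rw [if_neg]
    rintro ⟨x', hx', he⟩
    exact h (hcode (encode_injective he) ▸ hx')

/-- A reduction which searches for a certificate and computes its result from the certificate. -/
theorem decisionFun_le_of_certificates {X C X' C' T : Type*} [Primcodable C] [Primcodable C']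
    [Primcodable T] {code : X → C} {code' : X' → C'} {Yes : X → Prop} {Yes' : X' → Prop}
    (hcode : Function.Injective code) (hcode' : Function.Injective code')
    {valid : C → Prop} (hvalid : ComputablePred valid) (hv : ∀ c, valid c ↔ ∃ x, code x = c)
    {chk : C × T → Prop} (hchk : ComputablePred chk) {out : C × T → C'} (hout : Computable out)
    (no : X') (hno : ¬ Yes' no) (total : ∀ x, ∃ t, chk (code x, t))
    (sound : ∀ x t, chk (code x, t) → ∃ x', code' x' = out (code x, t) ∧ (Yes x ↔ Yes' x')) :
    decisionFun code Yes ≤ᵀ decisionFun code' Yes' := by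
  classical
  -- A number may decode to `c` without being the code of `c`; the decision problem answers `0` on
  -- such numbers, so re-encoding is checked.
  let parse : ℕ → Option C := fun m => (decode (α := C) m).bind fun c =>
    if encode c = m ∧ valid c then some c else none
  have hparse : Computable parse := by
    refine Computable.option_bind Computable.decode ?_
    exact ComputablePred.computable_ite (α := ℕ × C)
      ((computablePred_eq (Computable.encode.comp Computable.snd) Computable.fst).and
        (hvalid.comp Computable.snd))
      (Computable.option_some.comp Computable.snd) (Computable.const none)
  have hparse_some : ∀ m c, parse m = some c ↔ encode c = m ∧ valid c := by
    intro m c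
    simp only [parse, Option.bind_eq_some_iff]
    constructor
    · rintro ⟨c', -, h⟩
      split_ifs at h with hc
      cases h
      exact hc
    · rintro ⟨rfl, hc⟩
      exact ⟨c, by simp, by simp [hc]⟩
  -- A non-code is sent to a fixed instance with answer no. On a code, `k` runs through the possible
  -- certificates, and `total` guarantees that the unbounded search stops.
  let f : ℕ → ℕ → Option ℕ := fun m k => Option.casesOn (parse m)
    (some (encode (code' no))) fun c => (decode (α := T) k).bind fun t =>
      if chk (c, t) then some (encode (out (c, t))) else none
  have hf : Computable₂ f := by
    refine Computable.option_casesOn (α := ℕ × ℕ) (hparse.comp Computable.fst)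
      (Computable.const _) ?_
    refine Computable.option_bind (α := (ℕ × ℕ) × C)
      (Computable.decode.comp (Computable.snd.comp Computable.fst)) ?_
    have hct : Computable fun q : ((ℕ × ℕ) × C) × T => (q.1.2, q.2) :=
      (Computable.snd.comp Computable.fst).pair Computable.snd
    exact ComputablePred.computable_ite (α := ((ℕ × ℕ) × C) × T) (hchk.comp hct)
      (Computable.option_some.comp (Computable.encode.comp (hout.comp hct)))
      (Computable.const none)
  have hr : Nat.Partrec fun m => Nat.rfindOpt (f m) := Partrec.nat_iff.1 (Partrec.rfindOpt hf)
  rw [TuringReducible, RecursiveIn.iff_nat]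
  refine (Nat.RecursiveIn.comp (Nat.RecursiveIn.oracle _ (Set.mem_singleton _))
    hr.recursiveIn).of_eq fun m => ?_
  have hdom : (Nat.rfindOpt (f m)).Dom := by
    rw [Nat.rfindOpt_dom]
    rcases hm : parse m with _ | c
    · exact ⟨0, encode (code' no), by simp [f, hm]⟩
    · obtain ⟨x, rfl⟩ := (hv c).1 ((hparse_some m c).1 hm).2
      obtain ⟨t, ht⟩ := total x
      exact ⟨encode t, encode (out (code x, t)), by simp [f, hm, ht]⟩
  obtain ⟨k, hk⟩ := Nat.rfindOpt_spec (Part.get_mem hdom)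
  rw [← Part.some_get hdom]
  generalize (Nat.rfindOpt (f m)).get hdom = e at hk
  refine (Part.bind_some e fun n => decisionFun code' Yes' n).trans ?_
  rcases hm : parse m with _ | c
  · simp only [f, hm, Option.mem_def, Option.some.injEq] at hk
    subst hk
    rw [(decisionFun_code hcode' Yes' no).2 hno]
    simp only [decisionFun]
    rw [if_neg]
    rintro ⟨x, -, rfl⟩
    rw [(hparse_some _ (code x)).2 ⟨rfl, (hv _).2 ⟨x, rfl⟩⟩] at hm
    cases hm
  · obtain ⟨rfl, hc⟩ := (hparse_some m c).1 hm
    obtain ⟨x, rfl⟩ := (hv c).1 hc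
    simp only [f, hm, Option.mem_def, Option.bind_eq_some_iff] at hk
    obtain ⟨t, -, ht⟩ := hk
    split_ifs at ht with hct
    obtain ⟨x', hx', hiff⟩ := sound x t hct
    simp only [Option.some.injEq] at ht
    subst ht
    rw [← hx']
    by_cases hy : Yes x
    · rw [(decisionFun_code hcode Yes x).1 hy, (decisionFun_code hcode' Yes' x').1 (hiff.1 hy)]
    · rw [(decisionFun_code hcode Yes x).2 hy,
        (decisionFun_code hcode' Yes' x').2 (mt hiff.2 hy)]

end Computability

/-! ### From uniform continuity to stability -/

section ContinuityToStability

variable {K : Type*} [Field K]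

/-- Tuples of the form used for the codes of automata. -/
abbrev AutomatonCode (K : Type*) : Type _ :=
  ℕ × List K × List K × List (List K) × List (List K)

/-- The automaton with the given code. -/
def codeAut (c : AutomatonCode K) :
    WFA K (Fin 2) (Fin c.1) where
  init i := c.2.1.getD i 0
  final i := c.2.2.1.getD i 0
  wt a := if a = 0 then ofRowList c.1 c.1 c.2.2.2.1 else ofRowList c.1 c.1 c.2.2.2.2

theorem codeAut_code (𝒜 : BinaryApWFA K) : codeAut 𝒜.code = 𝒜.aut := by
  obtain ⟨n, ⟨I, F, A⟩, h⟩ := 𝒜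
  simp only [codeAut, BinaryApWFA.code, WFA.mk.injEq]
  refine ⟨?_, ?_, ?_⟩
  · funext i; simp
  · funext i; simp
  · funext a
    fin_cases a
    · exact ofRowList_rowList (A 0)
    · exact ofRowList_rowList (A 1)

/-- The tuple `c` is the code of an average preserving automaton. -/
def IsApCode (c : AutomatonCode K) : Prop :=
  (List.ofFn (codeAut c).init = c.2.1 ∧ List.ofFn (codeAut c).final = c.2.2.1) ∧
    (rowList ((codeAut c).wt 0) = c.2.2.2.1 ∧ rowList ((codeAut c).wt 1) = c.2.2.2.2) ∧
    (codeAut c).wt 0 * Matrix.replicateCol (Fin 1) (codeAut c).final +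
      (codeAut c).wt 1 * Matrix.replicateCol (Fin 1) (codeAut c).final =
      (2 : K) • Matrix.replicateCol (Fin 1) (codeAut c).final

/-- `codeAut` reads an automaton off any tuple, with zeros for missing entries, so genuine codes are
those reproduced by re-encoding. -/
theorem isApCode_iff (c : AutomatonCode K) :
    IsApCode c ↔ ∃ 𝒜 : BinaryApWFA K, 𝒜.code = c := by
  constructor
  · rintro ⟨⟨h1, h2⟩, ⟨h3, h4⟩, h5⟩
    have hap : (codeAut c).IsAveragePreserving := by
      rw [WFA.IsAveragePreserving, Fin.sum_univ_two, Fintype.card_fin]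
      funext i
      have := congrFun (congrFun h5 i) 0
      simpa [Matrix.mul_apply, Matrix.mulVec, dotProduct] using this
    refine ⟨⟨c.1, codeAut c, hap⟩, ?_⟩
    exact Prod.ext rfl (Prod.ext h1 (Prod.ext h2 (Prod.ext h3 h4)))
  · rintro ⟨𝒜, rfl⟩
    have h := codeAut_code 𝒜
    refine ⟨⟨?_, ?_⟩, ⟨?_, ?_⟩, ?_⟩
    · rw [h]; rfl
    · rw [h]; rfl
    · rw [h]; rfl
    · rw [h]; rfl
    · rw [h]; exact 𝒜.ap.replicateCol

/-! ### Certificates for the first reduction -/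

/-- A list of words for the rows, a list of words for the columns, and a list of matrices, with
their numbers of rows and columns. -/
abbrev Certificate (K : Type*) : Type _ :=
  (ℕ × ℕ) × (List (List (Fin 2)) × List (List (Fin 2))) × List (List (List K))

namespace Certificate

/-- The `k`-th matrix of a certificate, as an `m × n` matrix. -/
def mat (t : Certificate K) (k m n : ℕ) : Matrix (Fin m) (Fin n) K :=
  ofRowList m n (t.2.2.getD k [])

variable {n : ℕ} (𝒜 : WFA K (Fin 2) (Fin n)) (t : Certificate K)

/-- The matrix whose rows are the vectors `I A_x` for the row words `x` of the certificate. -/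
def rowMat : Matrix (Fin t.1.1) (Fin n) K := Matrix.of fun i j =>
  (Matrix.replicateRow (Fin 1) 𝒜.init * wordMat 𝒜.wt (t.2.1.1.getD i [])) 0 j

/-- The matrix whose columns are the vectors `A_y (A_0 F - F)` for the column words `y` of the
certificate. -/
def colMat : Matrix (Fin n) (Fin t.1.2) K := Matrix.of fun i j =>
  (wordMat 𝒜.wt (t.2.1.2.getD j []) * (𝒜.wt 0 * Matrix.replicateCol (Fin 1) 𝒜.final -
    Matrix.replicateCol (Fin 1) 𝒜.final)) i 0

/-- The certificate describes a reduction of the automaton. -/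
def Reduces : Prop :=
  IsReduction 𝒜.wt (Matrix.replicateRow (Fin 1) 𝒜.init) (Matrix.replicateCol (Fin 1) 𝒜.final)
    (fun i : Fin t.1.1 => t.2.1.1.getD i []) (fun j : Fin t.1.2 => t.2.1.2.getD j [])
    (t.rowMat 𝒜) (t.colMat 𝒜)
    (fun a => t.mat a t.1.1 t.1.1) (t.mat 2 1 t.1.1) (fun a => t.mat (3 + a) t.1.2 t.1.2)
    (t.mat 5 t.1.2 1) (t.mat 6 t.1.2 t.1.1)

/-- The certificate contains solutions of the equations `p - B_a p = G`. -/
def Solves : Prop :=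
  t.mat 7 t.1.2 1 - t.mat 3 t.1.2 t.1.2 * t.mat 7 t.1.2 1 = t.mat 5 t.1.2 1 ∧
    t.mat 8 t.1.2 1 - t.mat 4 t.1.2 t.1.2 * t.mat 8 t.1.2 1 = t.mat 5 t.1.2 1

/-- The solutions of the certificate give equal values at dyadic numbers. -/
def Glues : Prop :=
  t.mat 4 t.1.2 t.1.2 * t.mat 7 t.1.2 1 + t.mat 3 t.1.2 t.1.2 * t.mat 8 t.1.2 1 =
    (2 : K) • t.mat 5 t.1.2 1

/-- The certificate contains a nonzero vector fixed by one of the matrices `B_a`. -/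
def Fixes : Prop :=
  ¬ t.mat 9 t.1.2 1 = 0 ∧ (t.mat 3 t.1.2 t.1.2 * t.mat 9 t.1.2 1 = t.mat 9 t.1.2 1 ∨
    t.mat 4 t.1.2 t.1.2 * t.mat 9 t.1.2 1 = t.mat 9 t.1.2 1)

open Classical in
/-- The code of the matrix family that the certificate leads to. -/
def output : ℕ × ℕ × List (List (List K)) :=
  if t.Solves ∧ t.Glues then
    (t.1.2, 1, [rowList (t.mat 3 t.1.2 t.1.2), rowList (t.mat 4 t.1.2 t.1.2)])
  else (1, 0, [[[1]]])

/-- This makes the search terminate: a reduction always exists, and for each letter either the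
fixed-point equation is solvable or there is a nonzero fixed vector. -/
theorem exists_certificate : ∃ t : Certificate K, t.Reduces 𝒜 ∧ (t.Solves ∨ t.Fixes) := by
  obtain ⟨s, r, x, y, X, Y, M, J, B, G, L, h⟩ := exists_isReduction 𝒜.wt
    (Matrix.replicateRow (Fin 1) 𝒜.init) (Matrix.replicateCol (Fin 1) 𝒜.final)
  have key : ∀ p₀ p₁ z : Matrix (Fin r) (Fin 1) K, ∃ t : Certificate K,
      ∃ h1 : t.1.2 = r, t.Reduces 𝒜 ∧ t.mat 3 r r = B 0 ∧ t.mat 4 r r = B 1 ∧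
        t.mat 5 r 1 = G ∧ t.mat 7 r 1 = p₀ ∧ t.mat 8 r 1 = p₁ ∧ t.mat 9 r 1 = z := by
    intro p₀ p₁ z
    -- The positions in the list are those read by `Reduces`, `Solves` and `Fixes`: `M` at 0 and 1,
    -- `J` at 2, `B` at 3 and 4, `G` at 5, `L` at 6, `p₀` and `p₁` at 7 and 8, the fixed vector at
    -- 9.
    let t : Certificate K := ((s, r), (List.ofFn x, List.ofFn y), [rowList (M 0), rowList (M 1),
      rowList J, rowList (B 0), rowList (B 1), rowList G, rowList L, rowList p₀, rowList p₁,
      rowList z])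
    refine ⟨t, rfl, ?_, ofRowList_rowList _, ofRowList_rowList _, ofRowList_rowList _,
      ofRowList_rowList _, ofRowList_rowList _, ofRowList_rowList _⟩
    have hx : (fun i : Fin s => (List.ofFn x).getD i []) = x := by funext i; simp
    have hy : (fun i : Fin r => (List.ofFn y).getD i []) = y := by funext i; simp
    have hX : t.rowMat 𝒜 = X := by
      ext i q
      rw [h.row, ← congrFun hx i]
      rfl
    have hY : t.colMat 𝒜 = Y := by
      ext q j
      rw [h.col, ← congrFun hy j]
      rfl
    have hM : (fun a : Fin 2 => t.mat a s s) = M := by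
      funext a
      fin_cases a
      · exact ofRowList_rowList _
      · exact ofRowList_rowList _
    have hB : (fun a : Fin 2 => t.mat (3 + a) r r) = B := by
      funext a
      fin_cases a
      · exact ofRowList_rowList _
      · exact ofRowList_rowList _
    have hJ : t.mat 2 1 s = J := ofRowList_rowList _
    have hG : t.mat 5 r 1 = G := ofRowList_rowList _
    have hL : t.mat 6 r s = L := ofRowList_rowList _
    change IsReduction _ _ _ (fun i : Fin s => (List.ofFn x).getD i [])
      (fun i : Fin r => (List.ofFn y).getD i []) (t.rowMat 𝒜) (t.colMat 𝒜)
      (fun a : Fin 2 => t.mat a s s) (t.mat 2 1 s) (fun a : Fin 2 => t.mat (3 + a) r r)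
      (t.mat 5 r 1) (t.mat 6 r s)
    rw [hx, hy, hX, hY, hM, hB, hJ, hG, hL]
    exact h
  have main : ∀ p₀ p₁ z : Matrix (Fin r) (Fin 1) K,
      ((p₀ - B 0 * p₀ = G ∧ p₁ - B 1 * p₁ = G) ∨ (z ≠ 0 ∧ (B 0 * z = z ∨ B 1 * z = z))) →
      ∃ t : Certificate K, t.Reduces 𝒜 ∧ (t.Solves ∨ t.Fixes) := by
    intro p₀ p₁ z hor
    obtain ⟨t, h1, hr, h3, h4, h5, h7, h8, h9⟩ := key p₀ p₁ z
    refine ⟨t, hr, ?_⟩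
    rw [Solves, Fixes, h1, h3, h4, h5, h7, h8, h9]
    exact hor
  rcases exists_fixed_or_solution (B 0) G with ⟨p₀, hp₀⟩ | ⟨z, hz, hBz⟩
  · rcases exists_fixed_or_solution (B 1) G with ⟨p₁, hp₁⟩ | ⟨z, hz, hBz⟩
    · exact main p₀ p₁ 0 (Or.inl ⟨hp₀, hp₁⟩)
    · exact main 0 0 z (Or.inr ⟨hz, Or.inr hBz⟩)
  · exact main 0 0 z (Or.inr ⟨hz, Or.inl hBz⟩)

theorem not_isStable_one {K : Type*} [Field K] (φ : K →+* ℝ) {k : ℕ} :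
    ¬ IsStable fun _ : Fin (k + 1) =>
      (Matrix.of fun _ _ => 1 : Matrix (Fin 1) (Fin 1) K).map φ := by
  refine not_isStable_of_fixed (a := 0) (z := Matrix.of fun _ _ => 1) ?_ ?_
  · intro h
    have := congrFun (congrFun h 0) 0
    simp at this
  · ext i j
    simp [Matrix.mul_apply]

/-- If the solutions glue, continuity is equivalent to stability of `B`, which is the output. If
they do not glue, or `B` fixes a nonzero vector, continuity fails, matching the unstable family
consisting of the `1 × 1` unit matrix. -/
theorem output_sound (φ : K →+* ℝ) (hap : 𝒜.IsAveragePreserving) (hr : t.Reduces 𝒜)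
    (hs : t.Solves ∨ t.Fixes) : ∃ B : MatrixFamily K, B.code = t.output ∧
      (IsContinuousWFA (𝒜.map φ) ↔ IsStable fun a => (B.mat a).map φ) := by
  classical
  by_cases ho : t.Solves ∧ t.Glues
  · refine ⟨⟨t.1.2, 1, fun a => t.mat (3 + a) t.1.2 t.1.2⟩, ?_, ?_⟩
    · rw [output, if_pos ho]
      rfl
    · rw [IsReduction.isContinuousWFA_iff φ hr hap ho.1.1 ho.1.2]
      exact and_iff_left ho.2
  · refine ⟨⟨1, 0, fun _ => Matrix.of fun _ _ => 1⟩, ?_, ?_⟩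
    · rw [output, if_neg ho]
      rfl
    · refine iff_of_false ?_ (not_isStable_one φ)
      rcases hs with hs | ⟨hz, hz' | hz'⟩
      · rw [IsReduction.isContinuousWFA_iff φ hr hap hs.1 hs.2]
        exact fun hc => ho ⟨hs, hc.2⟩
      · exact IsReduction.not_isContinuousWFA φ hr hap (a := 0) hz hz'
      · exact IsReduction.not_isContinuousWFA φ hr hap (a := 1) hz hz'

end Certificate

end ContinuityToStability

/-! ### Decidability of the certificate conditions -/

section ContinuityToStability

variable {K : Type*} [Field K] [Primcodable K]

section Code

variable {α : Type*} [Primcodable α]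
  {c : α → AutomatonCode K} (hc : Computable c)

include hc

theorem computableMatrix_codeAut_init :
    ComputableMatrix fun a => Matrix.replicateRow (Fin 1) (codeAut (c a)).init :=
  .of_entries (Computable.const 1) (Computable.fst.comp hc)
    (f := fun q => (c q.1.1).2.1.getD q.2 0)
    (Computable.list_getD ((Computable.fst.comp (Computable.snd.comp hc)).comp
      (Computable.fst.comp Computable.fst)) Computable.snd 0) fun _ _ _ => rfl

theorem computableMatrix_codeAut_final :
    ComputableMatrix fun a => Matrix.replicateCol (Fin 1) (codeAut (c a)).final :=
  .of_entries (Computable.fst.comp hc) (Computable.const 1)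
    (f := fun q => (c q.1.1).2.2.1.getD q.1.2 0)
    (Computable.list_getD ((Computable.fst.comp (Computable.snd.comp (Computable.snd.comp hc))).comp
      (Computable.fst.comp Computable.fst)) (Computable.snd.comp Computable.fst) 0)
    fun _ _ _ => rfl

theorem computableMatrix_codeAut_wt (i : Fin 2) :
    ComputableMatrix fun a => (codeAut (c a)).wt i := by
  have h1 : Computable fun a => (c a).2.2.2 :=
    Computable.snd.comp (Computable.snd.comp (Computable.snd.comp hc))
  have hn : Computable fun a => (c a).1 := Computable.fst.comp hc
  fin_cases i
  · exact .ofRowList hn hn (Computable.fst.comp h1)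
  · exact .ofRowList hn hn (Computable.snd.comp h1)

variable (hadd : Computable₂ fun x y : K => x + y) (hmul : Computable₂ fun x y : K => x * y)

include hadd hmul

theorem computableMatrix_codeAut_diff :
    ComputableMatrix fun a => (codeAut (c a)).wt 0 *
      Matrix.replicateCol (Fin 1) (codeAut (c a)).final -
        Matrix.replicateCol (Fin 1) (codeAut (c a)).final := by
  have hn : Computable fun a => (c a).1 := Computable.fst.comp hc
  have h1 := computableMatrix_codeAut_final hc
  exact (ComputableMatrix.mul hadd hmul hn hn (Computable.const 1)
    (computableMatrix_codeAut_wt hc 0) h1).sub hadd hmul hn (Computable.const 1) h1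

end Code

variable (hadd : Computable₂ fun x y : K => x + y) (hmul : Computable₂ fun x y : K => x * y)

include hadd hmul

omit hadd hmul in
theorem computable_codeAut_lists :
    (Computable fun c : AutomatonCode K =>
      List.ofFn (codeAut c).init) ∧
    Computable fun c : AutomatonCode K =>
      List.ofFn (codeAut c).final := by
  have h1 : Computable fun q : AutomatonCode K × ℕ => q.1.2 := Computable.snd.comp Computable.fst
  have h2 : Computable fun q : AutomatonCode K × ℕ => q.1.2.1 := Computable.fst.comp h1
  have h3 : Computable fun q : AutomatonCode K × ℕ => q.1.2.2.1 :=
    Computable.fst.comp (Computable.snd.comp h1)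
  have h4 : Computable fun q : AutomatonCode K × ℕ => q.1.2.1.getD q.2 0 :=
    Computable.list_getD h2 Computable.snd 0
  have h5 : Computable fun q : AutomatonCode K × ℕ => q.1.2.2.1.getD q.2 0 :=
    Computable.list_getD h3 Computable.snd 0
  exact ⟨Computable.list_generate (n := fun c : AutomatonCode K => c.1)
    (f := fun q => q.1.2.1.getD q.2 0) Computable.fst h4,
    Computable.list_generate (n := fun c : AutomatonCode K => c.1)
    (f := fun q => q.1.2.2.1.getD q.2 0) Computable.fst h5⟩

theorem computablePred_isApCode : ComputablePred (IsApCode (K := K)) := by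
  have hc : Computable fun c : AutomatonCode K => c := Computable.id
  have hn : Computable fun c : AutomatonCode K => c.1 := Computable.fst
  have h1 : Computable fun c : AutomatonCode K => c.2 := Computable.snd
  have h2 : Computable fun c : AutomatonCode K => c.2.2 := Computable.snd.comp h1
  have h3 : Computable fun c : AutomatonCode K => c.2.2.2 := Computable.snd.comp h2
  have hF := computableMatrix_codeAut_final hc
  have hA : ∀ i, ComputableMatrix fun c : AutomatonCode K => (codeAut c).wt i *
      Matrix.replicateCol (Fin 1) (codeAut c).final := fun i =>
    ComputableMatrix.mul hadd hmul hn hn (Computable.const 1) (computableMatrix_codeAut_wt hc i) hF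
  exact ((computablePred_eq computable_codeAut_lists.1 (Computable.fst.comp h1)).and
    (computablePred_eq computable_codeAut_lists.2 (Computable.fst.comp h2))).and
    (((computablePred_eq (computableMatrix_codeAut_wt hc 0) (Computable.fst.comp h3)).and
    (computablePred_eq (computableMatrix_codeAut_wt hc 1) (Computable.snd.comp h3))).and
    (((hA 0).add hadd hn (Computable.const 1) (hA 1)).eq (hF.smul hmul hn (Computable.const 1) 2)))

namespace Certificate

variable {α : Type*} [Primcodable α]

omit hadd hmul in
theorem computableMatrix_mat {t : α → Certificate K} (ht : Computable t) {k : ℕ} {m n : α → ℕ}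
    (hm : Computable m) (hn : Computable n) :
    ComputableMatrix fun a => (t a).mat k (m a) (n a) :=
  .ofRowList hm hn (Computable.list_getD (Computable.snd.comp (Computable.snd.comp ht))
    (Computable.const k) [])

variable {c : α → AutomatonCode K} (hc : Computable c)
  {t : α → Certificate K} (ht : Computable t)

include hc ht

theorem computableMatrix_rowMat :
    ComputableMatrix fun a => (t a).rowMat (codeAut (c a)) := by
  have hn : Computable fun a => (c a).1 := Computable.fst.comp hc
  have hs : Computable fun a => (t a).1.1 := Computable.fst.comp (Computable.fst.comp ht)
  have hx : Computable fun a => (t a).2.1.1 :=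
    Computable.fst.comp (Computable.fst.comp (Computable.snd.comp ht))
  have hc' : Computable fun q : α × ℕ => c q.1 := hc.comp Computable.fst
  have hw : Computable fun q : α × ℕ => (t q.1).2.1.1.getD q.2 [] :=
    Computable.list_getD (hx.comp Computable.fst) Computable.snd []
  have h1 : ComputableMatrix fun q : α × ℕ =>
      Matrix.replicateRow (Fin 1) (codeAut (c q.1)).init *
        wordMat (codeAut (c q.1)).wt ((t q.1).2.1.1.getD q.2 []) :=
    ComputableMatrix.mul hadd hmul (Computable.const 1) (hn.comp Computable.fst)
      (hn.comp Computable.fst) (computableMatrix_codeAut_init hc')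
      (ComputableMatrix.wordMat hadd hmul (hn.comp Computable.fst)
        (computableMatrix_codeAut_wt hc') hw)
  refine ComputableMatrix.of_entries hs hn
    (ComputableMatrix.entry (h1.comp Computable.fst) (Computable.const 0) Computable.snd) ?_
  intro a i j
  exact (listEntry_rowList (Matrix.replicateRow (Fin 1) (codeAut (c a)).init *
        wordMat (codeAut (c a)).wt ((t a).2.1.1.getD i [])) 0 j).symm

theorem computableMatrix_colMat :
    ComputableMatrix fun a => (t a).colMat (codeAut (c a)) := by
  have hn : Computable fun a => (c a).1 := Computable.fst.comp hc
  have hr : Computable fun a => (t a).1.2 := Computable.snd.comp (Computable.fst.comp ht)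
  have hy : Computable fun a => (t a).2.1.2 :=
    Computable.snd.comp (Computable.fst.comp (Computable.snd.comp ht))
  have hc' : Computable fun q : α × ℕ => c q.1 := hc.comp Computable.fst
  have hw : Computable fun q : α × ℕ => (t q.1).2.1.2.getD q.2 [] :=
    Computable.list_getD (hy.comp Computable.fst) Computable.snd []
  have h1 : ComputableMatrix fun q : α × ℕ =>
      wordMat (codeAut (c q.1)).wt ((t q.1).2.1.2.getD q.2 []) *
        ((codeAut (c q.1)).wt 0 * Matrix.replicateCol (Fin 1) (codeAut (c q.1)).final -
          Matrix.replicateCol (Fin 1) (codeAut (c q.1)).final) :=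
    ComputableMatrix.mul hadd hmul (hn.comp Computable.fst) (hn.comp Computable.fst)
      (Computable.const 1) (ComputableMatrix.wordMat hadd hmul (hn.comp Computable.fst)
        (computableMatrix_codeAut_wt hc') hw) (computableMatrix_codeAut_diff hc' hadd hmul)
  have hf : Computable fun q : (α × ℕ) × ℕ => (q.1.1, q.2) :=
    (Computable.fst.comp Computable.fst).pair Computable.snd
  refine ComputableMatrix.of_entries hn hr (ComputableMatrix.entry (h1.comp hf)
    (Computable.snd.comp Computable.fst) (Computable.const 0)) ?_
  intro a i j
  exact (listEntry_rowList (wordMat (codeAut (c a)).wt ((t a).2.1.2.getD j []) *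
        ((codeAut (c a)).wt 0 * Matrix.replicateCol (Fin 1) (codeAut (c a)).final -
          Matrix.replicateCol (Fin 1) (codeAut (c a)).final)) i 0).symm

/-- The descriptions of rows and columns hold by construction of `rowMat` and `colMat`; only
finitely many matrix equations remain to be tested. -/
theorem computablePred_reduces : ComputablePred fun a => (t a).Reduces (codeAut (c a)) := by
  have hn : Computable fun a => (c a).1 := Computable.fst.comp hc
  have hs : Computable fun a => (t a).1.1 := Computable.fst.comp (Computable.fst.comp ht)
  have hr : Computable fun a => (t a).1.2 := Computable.snd.comp (Computable.fst.comp ht)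
  have h1 : Computable fun _ : α => 1 := Computable.const 1
  have hX := computableMatrix_rowMat hadd hmul hc ht
  have hY := computableMatrix_colMat hadd hmul hc ht
  have hXY := hX.mul hadd hmul hs hn hr hY
  have hA := computableMatrix_codeAut_wt hc
  have hwt := fun i : Fin 2 => (hX.mul hadd hmul hs hn hn (hA i)).eq
    ((computableMatrix_mat ht (k := i) hs hs).mul hadd hmul hs hs hn hX)
  have hinit := ((computableMatrix_mat ht (k := 2) h1 hs).mul hadd hmul h1 hs hn hX).eq
    (computableMatrix_codeAut_init hc)
  have hrestr := fun i : Fin 2 =>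
    ((computableMatrix_mat ht (k := i) hs hs).mul hadd hmul hs hs hr hXY).eq
      (hXY.mul hadd hmul hs hr hr (computableMatrix_mat ht (k := 3 + i) hr hr))
  have hdiff := (hXY.mul hadd hmul hs hr h1 (computableMatrix_mat ht (k := 5) hr h1)).eq
    (hX.mul hadd hmul hs hn h1 (computableMatrix_codeAut_diff hc hadd hmul))
  have hinv := ((computableMatrix_mat ht (k := 6) hr hs).mul hadd hmul hr hs hr hXY).eq
    (ComputableMatrix.one hr)
  refine ((((hwt 0).and (hwt 1)).and hinit).and
    ((((hrestr 0).and (hrestr 1)).and hdiff).and hinv)).of_eq fun a => ?_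
  constructor
  · rintro ⟨⟨⟨h1, h2⟩, h3⟩, ⟨⟨h4, h5⟩, h6⟩, h7⟩
    exact ⟨fun _ _ => rfl, fun _ _ => rfl, Fin.forall_fin_two.2 ⟨h1, h2⟩, h3,
      Fin.forall_fin_two.2 ⟨h4, h5⟩, h6, h7⟩
  · intro h
    exact ⟨⟨⟨h.mul_wt 0, h.mul_wt 1⟩, h.init⟩, ⟨⟨h.mul_restr 0, h.mul_restr 1⟩, h.diff⟩,
      h.left_inv⟩

omit hc

theorem computablePred_solves : ComputablePred fun a => (t a).Solves := by
  have hr : Computable fun a => (t a).1.2 := Computable.snd.comp (Computable.fst.comp ht)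
  have h1 : Computable fun _ : α => 1 := Computable.const 1
  have key := fun k l : ℕ =>
    ((computableMatrix_mat ht (k := k) hr h1).sub hadd hmul hr h1
      ((computableMatrix_mat ht (k := l) hr hr).mul hadd hmul hr hr h1
        (computableMatrix_mat ht (k := k) hr h1))).eq (computableMatrix_mat ht (k := 5) hr h1)
  exact (key 7 3).and (key 8 4)

theorem computablePred_glues : ComputablePred fun a => (t a).Glues := by
  have hr : Computable fun a => (t a).1.2 := Computable.snd.comp (Computable.fst.comp ht)
  have h1 : Computable fun _ : α => 1 := Computable.const 1
  have key := fun k l : ℕ => (computableMatrix_mat ht (k := k) hr hr).mul hadd hmul hr hr h1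
    (computableMatrix_mat ht (k := l) hr h1)
  exact ((key 4 7).add hadd hr h1 (key 3 8)).eq
    ((computableMatrix_mat ht (k := 5) hr h1).smul hmul hr h1 2)

theorem computablePred_fixes : ComputablePred fun a => (t a).Fixes := by
  have hr : Computable fun a => (t a).1.2 := Computable.snd.comp (Computable.fst.comp ht)
  have h1 : Computable fun _ : α => 1 := Computable.const 1
  have h9 := computableMatrix_mat ht (k := 9) hr h1
  have key := fun k : ℕ => ((computableMatrix_mat ht (k := k) hr hr).mul hadd hmul hr hr h1 h9).eq
    h9
  have h0 : ComputableMatrix fun a => (0 : Matrix (Fin (t a).1.2) (Fin 1) K) :=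
    .of_entries hr h1 (Computable.const 0) fun _ _ _ => rfl
  exact (h9.eq h0).not.and ((key 3).or (key 4))

theorem computable_output : Computable fun a => (t a).output := by
  have hr : Computable fun a => (t a).1.2 := Computable.snd.comp (Computable.fst.comp ht)
  have h3 := computableMatrix_mat ht (k := 3) hr hr
  have h4 := computableMatrix_mat ht (k := 4) hr hr
  classical
  refine ((computablePred_solves hadd hmul ht).and
    (computablePred_glues hadd hmul ht)).computable_ite (hr.pair ((Computable.const 1).pair ?_))
    (Computable.const _)
  exact Computable.list_cons.comp h3 (Computable.list_cons.comp h4 (Computable.const []))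

end Certificate

theorem apWFAUniformContinuity_le (φ : K →+* ℝ) :
    apWFAUniformContinuity φ ≤ᵀ matrixProductStability φ := by
  have hc : Computable fun q : AutomatonCode K ×
      Certificate K => q.1 := Computable.fst
  have ht : Computable fun q : AutomatonCode K ×
      Certificate K => q.2 := Computable.snd
  refine decisionFun_le_of_certificates BinaryApWFA.code_injective MatrixFamily.code_injective
    (computablePred_isApCode hadd hmul) isApCode_iff
    ((Certificate.computablePred_reduces hadd hmul hc ht).and
      ((Certificate.computablePred_solves hadd hmul ht).or
        (Certificate.computablePred_fixes hadd hmul ht)))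
    (Certificate.computable_output hadd hmul ht)
    ⟨1, 0, fun _ => Matrix.of fun _ _ => 1⟩ (Certificate.not_isStable_one φ) ?_ ?_
  · intro 𝒜
    exact Certificate.exists_certificate (codeAut 𝒜.code)
  · rintro 𝒜 t ⟨h1, h2⟩
    simp only at h1 h2
    rw [codeAut_code] at h1
    exact Certificate.output_sound 𝒜.aut t φ 𝒜.ap h1 h2

end ContinuityToStability

/-! ### From stability to uniform continuity: the automaton -/

section BlockAutomaton

variable {R : Type*} [Field R]

/-- The matrix unit in row `x` and column `y` times `c`, as a function on all pairs of indices. -/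
def single (c : R) (x y p i : ℕ) : R := if p = x ∧ i = y then c else 0

/-- The coordinates of a vector, extended by zero. -/
def extend {P M : ℕ} (z : Fin P × Fin M → R) (p i : ℕ) : R :=
  if h : p < P ∧ i < M then z (⟨p, h.1⟩, ⟨i, h.2⟩) else 0

/-- The value of a linear form on a vector. -/
def pairing {P M : ℕ} (r : ℕ → ℕ → R) (z : Fin P × Fin M → R) : R := ∑ q, r q.1 q.2 * z q

theorem pairing_single {P M : ℕ} (c : R) (x y : ℕ) (z : Fin P × Fin M → R) :
    pairing (single c x y) z = c * extend z x y := by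
  rw [pairing, extend]
  split_ifs with h
  · rw [Finset.sum_eq_single (⟨x, h.1⟩, ⟨y, h.2⟩)]
    · simp [single]
    · rintro ⟨p, i⟩ - hne
      have : ¬ ((p : ℕ) = x ∧ (i : ℕ) = y) := by
        rintro ⟨rfl, rfl⟩
        exact hne rfl
      simp [single, this]
    · simp
  · rw [mul_zero]
    refine Finset.sum_eq_zero ?_
    rintro ⟨p, i⟩ -
    have : ¬ ((p : ℕ) = x ∧ (i : ℕ) = y) := by
      rintro ⟨rfl, rfl⟩
      exact h ⟨p.2, i.2⟩
    simp [single, this]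

theorem pairing_add {P M : ℕ} (r r' : ℕ → ℕ → R) (z : Fin P × Fin M → R) :
    pairing (fun p i => r p i + r' p i) z = pairing r z + pairing r' z := by
  simp [pairing, add_mul, Finset.sum_add_distrib]

theorem pairing_zero {P M : ℕ} (z : Fin P × Fin M → R) :
    pairing (fun _ _ => 0) z = 0 := by
  simp [pairing]

theorem pairing_row {P n : ℕ} (e : ℕ → R) (z : Fin (P + 1) × Fin (n + 4) → R) :
    pairing (fun p i => if p = 0 ∧ i < n then e i else 0) z =
      ∑ j : Fin n, e j * extend z 0 j := by
  rw [pairing, Fintype.sum_prod_type, Finset.sum_eq_single 0]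
  · rw [Fin.sum_univ_add]
    rw [Finset.sum_eq_zero (s := (Finset.univ : Finset (Fin 4)))]
    · rw [add_zero]
      refine Finset.sum_congr rfl fun j _ => ?_
      have h : extend z 0 j = z (0, Fin.castAdd 4 j) := by
        rw [extend, dif_pos ⟨Nat.succ_pos P, by omega⟩]
        rfl
      rw [h]
      simp
    · intro j _
      simp
  · intro p _ hp
    have : ¬ (p : ℕ) = 0 := fun h => hp (Fin.ext h)
    simp [this]
  · simp

/-- The weights in row `(p, i)` for the letter `a`. The states `(p, i)` with `p < n + k`, `i < n`
read a word `1^p 0`, which stands for the `p`-th unit vector if `p < n` and for the matrix with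
index `p - n` otherwise; the states `(n + k + 1, i)` select a row; the states `(n + k + 2, i)`
compute a function which vanishes at both ends of the interval. -/
def blockRow (n k : ℕ) (E : ℕ → ℕ → ℕ → R) (a : Fin 2) (p i : ℕ) : ℕ → ℕ → R :=
  if p < n + k ∧ i < n then
    if a = 0 then
      if p < n then if i = p then single 1 (n + k + 2) 0 else fun _ _ => 0
      else fun p' i' => if p' = 0 ∧ i' < n then E (p - n) i i' else 0
    else single 1 (p + 1) i
  else if p = n + k + 1 ∧ i < n then
    if a = 0 then single 1 0 i else single 1 (n + k + 1) (i + 1)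
  else if p = n + k + 2 ∧ i = 0 then
    if a = 0 then single 1 (n + k + 2) 1 else single (-1) (n + k + 2) 1
  else if p = n + k + 2 ∧ i = 1 then
    if a = 0 then single 1 (n + k + 2) 2
    else fun p' i' => single (-1) (n + k + 2) 2 p' i' + single 1 (n + k + 2) 3 p' i'
  else if p = n + k + 2 ∧ i = 2 then
    if a = 0 then single (1 / 2) (n + k + 2) 2
    else fun p' i' => single (1 / 2) (n + k + 2) 2 p' i' + single (1 / 2) (n + k + 2) 3 p' i'
  else if p = n + k + 2 ∧ i = 3 then single 1 (n + k + 2) 3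
  else fun _ _ => 0

/-- The final weights. -/
def blockFinal (n k p i : ℕ) : R :=
  if p = n + k + 2 ∧ (i = 1 ∨ i = 2) then 1 / 2 else if p = n + k + 2 ∧ i = 3 then 1 else 0

/-- The automaton built from the `n × n` matrices with entries `E a i j`, for `a < k`. -/
def blockAut (n k : ℕ) (E : ℕ → ℕ → ℕ → R) :
    WFA R (Fin 2) (Fin (n + k + 3) × Fin (n + 4)) where
  -- Row `n + k` catches runs of `1` that are too long and has zero weights. The four columns beyond
  -- `n` leave room for the four scalar states of row `n + k + 2`, whatever `n` is.
  init q := single 1 (n + k + 1) 0 q.1 q.2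
  final q := blockFinal n k q.1 q.2
  wt a q q' := blockRow n k E a q.1 q.2 q'.1 q'.2

variable (n k : ℕ) (E : ℕ → ℕ → ℕ → R)

/-- The word function of the state `(p, i)`. -/
def blockFun (v : List (Fin 2)) (p i : ℕ) : R := extend ((blockAut n k E).col v) p i

variable {n k E}

theorem blockFun_nil {p i : ℕ} :
    blockFun n k E [] p i = blockFinal n k p i := by
  rw [blockFun, extend]
  split_ifs with h
  · rw [WFA.col, wordMat_nil, Matrix.one_mulVec]
    rfl
  · rw [blockFinal, if_neg (by omega), if_neg (by omega)]

theorem blockFun_cons {a : Fin 2} {v : List (Fin 2)} {p i : ℕ} (hp : p < n + k + 3)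
    (hi : i < n + 4) : blockFun n k E (a :: v) p i =
      pairing (blockRow n k E a p i) ((blockAut n k E).col v) := by
  rw [blockFun, extend, dif_pos ⟨hp, hi⟩, WFA.col, wordMat_cons, ← Matrix.mulVec_mulVec]
  rfl

theorem wordFun_blockAut (v : List (Fin 2)) :
    (blockAut n k E).wordFun v = blockFun n k E v (n + k + 1) 0 := by
  have h := pairing_single 1 (n + k + 1) 0 ((blockAut n k E).col v)
  rw [one_mul] at h
  exact h

/-! ### Recurrences of the word functions of the states -/

section Recurrences

variable {v : List (Fin 2)} {p i : ℕ}

theorem blockFun_one_cons (hp : p < n + k) (hi : i < n) :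
    blockFun n k E (1 :: v) p i = blockFun n k E v (p + 1) i := by
  rw [blockFun_cons (by omega) (by omega), blockRow, if_pos ⟨hp, hi⟩, if_neg (by decide),
    pairing_single, one_mul, blockFun]

theorem blockFun_zero_cons_of_lt (hp : p < n) (hi : i < n) :
    blockFun n k E (0 :: v) p i = if i = p then blockFun n k E v (n + k + 2) 0 else 0 := by
  rw [blockFun_cons (by omega) (by omega), blockRow, if_pos ⟨by omega, hi⟩, if_pos rfl,
    if_pos hp]
  split_ifs
  · rw [pairing_single, one_mul, blockFun]
  · rw [pairing_zero]

theorem blockFun_zero_cons_add {a : ℕ} (ha : a < k) (hi : i < n) :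
    blockFun n k E (0 :: v) (n + a) i = ∑ j : Fin n, E a i j * blockFun n k E v 0 j := by
  rw [blockFun_cons (by omega) (by omega), blockRow, if_pos ⟨by omega, hi⟩, if_pos rfl,
    if_neg (by omega), Nat.add_sub_cancel_left]
  exact pairing_row (E a i) _

theorem blockFun_dummy (hi : i < n + 4) : blockFun n k E v (n + k) i = 0 := by
  rcases v with _ | ⟨a, v⟩
  · rw [blockFun_nil, blockFinal, if_neg (by omega), if_neg (by omega)]
  · rw [blockFun_cons (by omega) hi, blockRow, if_neg (by omega), if_neg (by omega),
      if_neg (by omega), if_neg (by omega), if_neg (by omega), if_neg (by omega), pairing_zero]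

/-- This covers the state `(n + k + 1, n)`, reached when the selector reads too many `1`s. -/
theorem blockFun_large (hp : p < n + k + 2) (hi : n ≤ i) (hi' : i < n + 4) :
    blockFun n k E v p i = 0 := by
  rcases v with _ | ⟨a, v⟩
  · rw [blockFun_nil, blockFinal, if_neg (by omega), if_neg (by omega)]
  · rw [blockFun_cons (by omega) (by omega), blockRow, if_neg (by omega), if_neg (by omega),
      if_neg (by omega), if_neg (by omega), if_neg (by omega), if_neg (by omega), pairing_zero]

theorem blockFun_zero_cons_select (hi : i < n) :
    blockFun n k E (0 :: v) (n + k + 1) i = blockFun n k E v 0 i := by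
  rw [blockFun_cons (by omega) (by omega), blockRow, if_neg (by omega), if_pos ⟨rfl, hi⟩,
    if_pos rfl, pairing_single, one_mul, blockFun]

theorem blockFun_one_cons_select (hi : i < n) :
    blockFun n k E (1 :: v) (n + k + 1) i = blockFun n k E v (n + k + 1) (i + 1) := by
  rw [blockFun_cons (by omega) (by omega), blockRow, if_neg (by omega), if_pos ⟨rfl, hi⟩,
    if_neg (by decide), pairing_single, one_mul, blockFun]

/-- The scalar states 0, 1, 2, 3 give the means over dyadic intervals of real functions: `θ`, the
tent, the identity and the constant `1`. The function `θ` is a tent on the left half and a negative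
tent on the right half, so it has mean zero and vanishes at `0`, `1/2` and `1`. -/
theorem blockFun_zero_cons_theta :
    blockFun n k E (0 :: v) (n + k + 2) 0 = blockFun n k E v (n + k + 2) 1 := by
  rw [blockFun_cons (by omega) (by omega), blockRow, if_neg (by omega), if_neg (by omega),
    if_pos (by omega), if_pos rfl, pairing_single, one_mul, blockFun]

theorem blockFun_one_cons_theta :
    blockFun n k E (1 :: v) (n + k + 2) 0 = -blockFun n k E v (n + k + 2) 1 := by
  rw [blockFun_cons (by omega) (by omega), blockRow, if_neg (by omega), if_neg (by omega),
    if_pos (by omega), if_neg (by decide), pairing_single, neg_one_mul, blockFun]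

theorem blockFun_zero_cons_tent :
    blockFun n k E (0 :: v) (n + k + 2) 1 = blockFun n k E v (n + k + 2) 2 := by
  rw [blockFun_cons (by omega) (by omega), blockRow, if_neg (by omega), if_neg (by omega),
    if_neg (by omega), if_pos (by omega), if_pos rfl, pairing_single, one_mul, blockFun]

theorem blockFun_unit : blockFun n k E v (n + k + 2) 3 = 1 := by
  induction v with
  | nil => rw [blockFun_nil, blockFinal, if_neg (by omega), if_pos (by omega)]
  | cons a v ih =>
    rw [blockFun_cons (by omega) (by omega), blockRow, if_neg (by omega), if_neg (by omega),
      if_neg (by omega), if_neg (by omega), if_neg (by omega), if_pos (by omega), pairing_single,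
      one_mul]
    exact ih

theorem blockFun_one_cons_tent :
    blockFun n k E (1 :: v) (n + k + 2) 1 = 1 - blockFun n k E v (n + k + 2) 2 := by
  rw [blockFun_cons (by omega) (by omega), blockRow, if_neg (by omega), if_neg (by omega),
    if_neg (by omega), if_pos (by omega), if_neg (by decide), pairing_add, pairing_single,
    pairing_single]
  change -1 * blockFun n k E v (n + k + 2) 2 + 1 * blockFun n k E v (n + k + 2) 3 = _
  rw [blockFun_unit]
  ring

theorem blockFun_zero_cons_value :
    blockFun n k E (0 :: v) (n + k + 2) 2 = 1 / 2 * blockFun n k E v (n + k + 2) 2 := by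
  rw [blockFun_cons (by omega) (by omega), blockRow, if_neg (by omega), if_neg (by omega),
    if_neg (by omega), if_neg (by omega), if_pos (by omega), if_pos rfl, pairing_single, blockFun]

theorem blockFun_one_cons_value :
    blockFun n k E (1 :: v) (n + k + 2) 2 = 1 / 2 * blockFun n k E v (n + k + 2) 2 + 1 / 2 := by
  rw [blockFun_cons (by omega) (by omega), blockRow, if_neg (by omega), if_neg (by omega),
    if_neg (by omega), if_neg (by omega), if_pos (by omega), if_neg (by decide), pairing_add,
    pairing_single, pairing_single]
  change 1 / 2 * blockFun n k E v (n + k + 2) 2 + 1 / 2 * blockFun n k E v (n + k + 2) 3 = _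
  rw [blockFun_unit, mul_one]

theorem blockFun_cons_of_four_le {a : Fin 2} (hi : i < n + 4) (hi' : 4 ≤ i) :
    blockFun n k E (a :: v) (n + k + 2) i = 0 := by
  rw [blockFun_cons (by omega) hi, blockRow, if_neg (by omega), if_neg (by omega),
    if_neg (by omega), if_neg (by omega), if_neg (by omega), if_neg (by omega), pairing_zero]

end Recurrences

theorem blockFinal_eq_zero {p i : ℕ} (hp : p < n + k + 2) :
    (blockFinal n k p i : R) = 0 := by
  rw [blockFinal, if_neg (by omega), if_neg (by omega)]

/-- Outside the scalar row all final weights are zero, and transitions lead only to states of final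
weight zero: `θ` is the only scalar state entered from there, and its mean is zero. In the scalar
row the identity is that a mean is the average of the means over the two halves. -/
theorem isAveragePreserving_blockAut (h2 : (2 : R) ≠ 0) :
    (blockAut n k E).IsAveragePreserving := by
  have hcol : ∀ a q, ((blockAut n k E).wt a *ᵥ (blockAut n k E).final) q =
      blockFun n k E [a] q.1 q.2 := by
    intro a q
    rw [blockFun, extend, dif_pos ⟨q.1.2, q.2.2⟩, WFA.col, wordMat_singleton]
  rw [WFA.IsAveragePreserving, Fin.sum_univ_two, Fintype.card_fin]
  funext q
  rw [Pi.add_apply, hcol, hcol, Pi.smul_apply, smul_eq_mul]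
  change _ = ((2 : ℕ) : R) * blockFinal n k q.1 q.2
  obtain ⟨⟨p, hp⟩, ⟨i, hi⟩⟩ := q
  simp only
  have h0 : (blockFinal n k (n + k + 2) 0 : R) = 0 := by
    rw [blockFinal, if_neg (by omega), if_neg (by omega)]
  rcases lt_or_ge p (n + k + 2) with hlt | hge
  · rw [blockFinal_eq_zero hlt, mul_zero]
    rcases lt_or_ge i n with hin | hin
    · rcases lt_trichotomy p (n + k) with h | rfl | h
      · rw [blockFun_one_cons h hin, blockFun_nil, blockFinal_eq_zero (by omega), add_zero]
        rcases lt_or_ge p n with hpn | hpn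
        · rw [blockFun_zero_cons_of_lt hpn hin, blockFun_nil, h0, ite_self]
        · obtain ⟨a, rfl⟩ := Nat.exists_eq_add_of_le hpn
          rw [blockFun_zero_cons_add (by omega) hin]
          refine Finset.sum_eq_zero fun j _ => ?_
          rw [blockFun_nil, blockFinal_eq_zero (by omega), mul_zero]
      · rw [blockFun_dummy hi, blockFun_dummy hi, add_zero]
      · obtain rfl : p = n + k + 1 := by omega
        rw [blockFun_zero_cons_select hin, blockFun_one_cons_select hin, blockFun_nil,
          blockFun_nil, blockFinal_eq_zero (by omega), blockFinal_eq_zero (by omega),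
          add_zero]
    · rw [blockFun_large hlt hin hi, blockFun_large hlt hin hi, add_zero]
  · obtain rfl : p = n + k + 2 := by omega
    have h1 : (blockFinal n k (n + k + 2) 1 : R) = 1 / 2 := by
      rw [blockFinal, if_pos (by omega)]
    have h2' : (blockFinal n k (n + k + 2) 2 : R) = 1 / 2 := by
      rw [blockFinal, if_pos (by omega)]
    by_cases hi4 : i < 4
    · interval_cases i
      · rw [blockFun_zero_cons_theta, blockFun_one_cons_theta, h0]
        ring
      · rw [blockFun_zero_cons_tent, blockFun_one_cons_tent, h1]
        push_cast
        field_simp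
        ring
      · rw [blockFun_zero_cons_value, blockFun_one_cons_value, blockFun_nil, h2']
        push_cast
        field_simp
        ring
      · rw [blockFun_unit, blockFun_unit, blockFinal, if_neg (by omega), if_pos (by omega)]
        push_cast
        ring
    · rw [blockFun_cons_of_four_le hi (by omega), blockFun_cons_of_four_le hi (by omega),
        blockFinal, if_neg (by omega), if_neg (by omega)]
      ring

theorem map_blockAut {R' : Type*} [Field R'] (φ : R →+* R') :
    (blockAut n k E).map φ = blockAut n k fun a i j => φ (E a i j) := by
  have hs : ∀ (c : R) x y p i, φ (single c x y p i) = single (φ c) x y p i := by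
    intro c x y p i
    simp only [single]
    split_ifs <;> simp
  have hr : ∀ a p i p' i', φ (blockRow n k E a p i p' i') =
      blockRow n k (fun a i j => φ (E a i j)) a p i p' i' := by
    intro a p i p' i'
    simp only [blockRow]
    split_ifs <;> simp only [hs, map_add, map_neg, map_one, map_zero, map_div₀, map_ofNat]
    split_ifs <;> simp only [map_zero]
  have hf : ∀ p i, φ (blockFinal n k p i) = blockFinal n k p i := by
    intro p i
    simp only [blockFinal]
    split_ifs <;> simp only [map_one, map_zero, map_div₀, map_ofNat]
  unfold WFA.map blockAut
  congr 1
  · funext q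
    rw [hs, map_one]
  · funext q
    exact hf _ _
  · funext a q q'
    exact hr _ _ _ _ _

end BlockAutomaton

/-! ### From stability to uniform continuity: stable families -/

section UniformOscillation

variable {S : Type*}

/-- The oscillation of the word function `F` on the extensions of a word tends to zero uniformly
in the length of the word. -/
def UnifOscVanish (F : List S → ℝ) : Prop :=
  ∀ ε > 0, ∃ N, ∀ v : List S, N ≤ v.length → ∀ u, |F (v ++ u) - F v| ≤ ε

theorem UnifOscVanish.oscVanish {F : List S → ℝ} (hF : UnifOscVanish F) : OscVanish F := by
  intro w ε hε
  obtain ⟨N, hN⟩ := hF ε hε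
  exact ⟨N, hN _ (by simp)⟩

/-- By compactness a good prefix of bounded length exists; `v` and `v ++ u` are both compared with
it, whence `ε/2`. -/
theorem OscVanish.unifOscVanish [Finite S] {F : List S → ℝ} (hF : OscVanish F) :
    UnifOscVanish F := by
  intro ε hε
  obtain ⟨N, hN⟩ := exists_prefix_of_forall
    (p := fun x => ∀ u, |F (x ++ u) - F x| ≤ ε / 2) fun w => hF w (ε / 2) (half_pos hε)
  refine ⟨N, fun v hv u => ?_⟩
  obtain ⟨x, y, rfl, -, hx⟩ := hN v hv
  have h1 := abs_le.1 (hx y)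
  have h2 := abs_le.1 (hx (y ++ u))
  rw [List.append_assoc, abs_le]
  constructor <;> linarith

/-- Vanishing oscillation is thereby carried from the successors of a state back to the state. -/
theorem UnifOscVanish.of_cons [Finite S] {F : List S → ℝ}
    (hF : ∀ a, UnifOscVanish fun v => F (a :: v)) : UnifOscVanish F := by
  intro ε hε
  choose N hN using fun a => hF a ε hε
  obtain ⟨M, hM⟩ := (Set.finite_range N).bddAbove
  refine ⟨M + 1, fun v hv u => ?_⟩
  rcases v with _ | ⟨a, v⟩
  · simp at hv
  · have h1 : N a ≤ M := hM ⟨a, rfl⟩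
    exact hN a v (by rw [List.length_cons] at hv; omega) u

theorem unifOscVanish_const (c : ℝ) : UnifOscVanish fun _ : List S => c :=
  fun ε hε => ⟨0, fun _ _ _ => by simpa using hε.le⟩

theorem IsMartingale.oscVanish {F : List (Fin 2) → ℝ} (hF : IsMartingale F)
    {g : (ℕ → Fin 2) → ℝ} (hg : Continuous g)
    (hlim : ∀ w, Tendsto (fun k => F (pref w k)) atTop (𝓝 (g w))) : OscVanish F := by
  intro w ε hε
  obtain ⟨k, hk⟩ := hF.exists_close hg hlim w (half_pos hε)
  refine ⟨k, fun u => ?_⟩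
  have h1 := abs_le.1 (hk k le_rfl u)
  have h2 := abs_le.1 (hk k le_rfl [])
  rw [List.append_nil] at h2
  rw [abs_le]
  constructor <;> linarith

end UniformOscillation

/-- Used with `T = n + k`, these are the fates of a block: the word ends inside it, the run of `1`s
overflows, or the block is completed by a `0`. -/
theorem eq_replicate_or (T : ℕ) (u : List (Fin 2)) :
    (∃ p < T, u = List.replicate p 1) ∨ (∃ r, u = List.replicate T 1 ++ r) ∨
      ∃ p < T, ∃ r, u = List.replicate p 1 ++ 0 :: r := by
  induction T generalizing u with
  | zero => exact Or.inr (Or.inl ⟨u, rfl⟩)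
  | succ T ih =>
    rcases u with _ | ⟨a, u⟩
    · exact Or.inl ⟨0, Nat.succ_pos T, rfl⟩
    · rcases Fin.exists_fin_two.1 ⟨a, rfl⟩ with rfl | rfl
      · exact Or.inr (Or.inr ⟨0, Nat.succ_pos T, u, rfl⟩)
      · rcases ih u with ⟨p, hp, rfl⟩ | ⟨r, rfl⟩ | ⟨p, hp, r, rfl⟩
        · exact Or.inl ⟨p + 1, by omega, rfl⟩
        · exact Or.inr (Or.inl ⟨r, rfl⟩)
        · exact Or.inr (Or.inr ⟨p + 1, by omega, r, rfl⟩)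

/-! ### Bounds and oscillation of the scalar states -/

section Scalars

variable {n k : ℕ} {E : ℕ → ℕ → ℕ → ℝ}

theorem blockFun_value_mem (v : List (Fin 2)) :
    0 ≤ blockFun n k E v (n + k + 2) 2 ∧ blockFun n k E v (n + k + 2) 2 ≤ 1 := by
  induction v with
  | nil =>
    rw [blockFun_nil, blockFinal, if_pos (by omega)]
    norm_num
  | cons a v ih =>
    rcases Fin.exists_fin_two.1 ⟨a, rfl⟩ with rfl | rfl
    · rw [blockFun_zero_cons_value]
      constructor <;> linarith
    · rw [blockFun_one_cons_value]
      constructor <;> linarith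

theorem blockFun_tent_mem (v : List (Fin 2)) :
    0 ≤ blockFun n k E v (n + k + 2) 1 ∧ blockFun n k E v (n + k + 2) 1 ≤ 1 := by
  rcases v with _ | ⟨a, v⟩
  · rw [blockFun_nil, blockFinal, if_pos (by omega)]
    norm_num
  · have h := blockFun_value_mem (n := n) (k := k) (E := E) v
    rcases Fin.exists_fin_two.1 ⟨a, rfl⟩ with rfl | rfl
    · rwa [blockFun_zero_cons_tent]
    · rw [blockFun_one_cons_tent]
      constructor <;> linarith

theorem abs_blockFun_theta_le (v : List (Fin 2)) : |blockFun n k E v (n + k + 2) 0| ≤ 1 := by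
  rcases v with _ | ⟨a, v⟩
  · rw [blockFun_nil, blockFinal, if_neg (by omega), if_neg (by omega)]
    norm_num
  · have h := blockFun_tent_mem (n := n) (k := k) (E := E) v
    rcases Fin.exists_fin_two.1 ⟨a, rfl⟩ with rfl | rfl
    · rw [blockFun_zero_cons_theta, abs_le]
      constructor <;> linarith
    · rw [blockFun_one_cons_theta, abs_le]
      constructor <;> linarith

theorem abs_blockFun_value_sub_le (v u : List (Fin 2)) :
    |blockFun n k E (v ++ u) (n + k + 2) 2 - blockFun n k E v (n + k + 2) 2| ≤
      (1 / 2) ^ v.length := by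
  induction v with
  | nil =>
    have h1 := blockFun_value_mem (n := n) (k := k) (E := E) ([] ++ u)
    have h2 := blockFun_value_mem (n := n) (k := k) (E := E) []
    rw [abs_le, List.length_nil, pow_zero]
    constructor <;> linarith
  | cons a v ih =>
    rw [abs_le] at ih ⊢
    rw [List.length_cons, pow_succ, List.cons_append]
    rcases Fin.exists_fin_two.1 ⟨a, rfl⟩ with rfl | rfl
    · rw [blockFun_zero_cons_value, blockFun_zero_cons_value]
      constructor <;> linarith
    · rw [blockFun_one_cons_value, blockFun_one_cons_value]
      constructor <;> linarith

theorem unifOscVanish_value : UnifOscVanish fun v => blockFun n k E v (n + k + 2) 2 := by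
  intro ε hε
  obtain ⟨N, hN⟩ := exists_pow_lt_of_lt_one hε (by norm_num : (1 / 2 : ℝ) < 1)
  refine ⟨N, fun v hv u => (abs_blockFun_value_sub_le v u).trans ?_⟩
  exact (pow_le_pow_of_le_one (by norm_num) (by norm_num) hv).trans hN.le

theorem UnifOscVanish.const_add_mul {S : Type*} {F : List S → ℝ} (hF : UnifOscVanish F)
    (b c : ℝ) : UnifOscVanish fun v => b + c * F v := by
  intro ε hε
  obtain ⟨N, hN⟩ := hF (ε / (|c| + 1)) (by positivity)
  refine ⟨N, fun v hv u => ?_⟩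
  have h1 := hN v hv u
  rw [le_div_iff₀ (by positivity)] at h1
  rw [add_sub_add_left_eq_sub, ← mul_sub, abs_mul]
  nlinarith [abs_nonneg (F (v ++ u) - F v)]

theorem unifOscVanish_tent : UnifOscVanish fun v => blockFun n k E v (n + k + 2) 1 := by
  refine UnifOscVanish.of_cons fun a => ?_
  rcases Fin.exists_fin_two.1 ⟨a, rfl⟩ with rfl | rfl
  · simp only [blockFun_zero_cons_tent]
    exact unifOscVanish_value
  · simp only [blockFun_one_cons_tent, sub_eq_add_neg, ← neg_one_mul (blockFun _ _ _ _ _ _)]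
    exact unifOscVanish_value.const_add_mul 1 (-1)

theorem unifOscVanish_theta : UnifOscVanish fun v => blockFun n k E v (n + k + 2) 0 := by
  refine UnifOscVanish.of_cons fun a => ?_
  rcases Fin.exists_fin_two.1 ⟨a, rfl⟩ with rfl | rfl
  · simp only [blockFun_zero_cons_theta]
    exact unifOscVanish_tent
  · simp only [blockFun_one_cons_theta, ← neg_one_mul (blockFun _ _ _ _ _ _)]
    simpa using unifOscVanish_tent.const_add_mul 0 (-1)

end Scalars

/-! ### Reading blocks -/

section Blocks

/-- The matrices with entries `E a i j`. -/
def blockMat (n k : ℕ) (E : ℕ → ℕ → ℕ → ℝ) (a : Fin k) : Matrix (Fin n) (Fin n) ℝ :=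
  Matrix.of fun i j => E a i j

/-- The word functions of the states in which the reading of a block `1^p 0` begins. -/
def blockVec (n k : ℕ) (E : ℕ → ℕ → ℕ → ℝ) (v : List (Fin 2)) : Fin n → ℝ :=
  fun i => blockFun n k E v 0 i

variable {n k : ℕ} {E : ℕ → ℕ → ℕ → ℝ}

theorem blockFun_replicate_append {p q i : ℕ} (h : q + p ≤ n + k) (hi : i < n)
    (u : List (Fin 2)) :
    blockFun n k E (List.replicate p 1 ++ u) q i = blockFun n k E u (q + p) i := by
  induction p generalizing q with
  | zero => rfl
  | succ p ih =>
    rw [List.replicate_succ, List.cons_append, blockFun_one_cons (by omega) hi,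
      ih (by omega)]
    congr 1
    omega

theorem blockVec_replicate_append_full (r : List (Fin 2)) :
    blockVec n k E (List.replicate (n + k) 1 ++ r) = 0 := by
  funext i
  rw [blockVec, blockFun_replicate_append (by omega) i.2, zero_add, blockFun_dummy (by omega)]
  rfl

theorem blockVec_replicate (p : ℕ) : blockVec n k E (List.replicate p 1) = 0 := by
  rcases lt_or_ge p (n + k) with h | h
  · funext i
    rw [blockVec, ← List.append_nil (List.replicate p 1), blockFun_replicate_append (by omega) i.2,
      blockFun_nil, blockFinal_eq_zero (by omega)]
    rfl
  · obtain ⟨m, rfl⟩ := Nat.exists_eq_add_of_le h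
    rw [List.replicate_add, blockVec_replicate_append_full]

theorem blockVec_unit {p : ℕ} (hp : p < n) (r : List (Fin 2)) :
    blockVec n k E (List.replicate p 1 ++ 0 :: r) =
      Pi.single ⟨p, hp⟩ (blockFun n k E r (n + k + 2) 0) := by
  funext i
  rw [blockVec, blockFun_replicate_append (by omega) i.2, zero_add,
    blockFun_zero_cons_of_lt hp i.2, Pi.single_apply]
  simp only [Fin.ext_iff]

theorem blockVec_mat (a : Fin k) (r : List (Fin 2)) :
    blockVec n k E (List.replicate (n + a) 1 ++ 0 :: r) =
      blockMat n k E a *ᵥ blockVec n k E r := by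
  funext i
  rw [blockVec, blockFun_replicate_append (by omega) i.2, zero_add,
    blockFun_zero_cons_add a.2 i.2]
  rfl

theorem blockVec_cases (u : List (Fin 2)) :
    (blockVec n k E u = 0) ∨
      (∃ p, p < n ∧ ∃ r, u = List.replicate p 1 ++ 0 :: r) ∨
      ∃ a : Fin k, ∃ r, u = List.replicate (n + a) 1 ++ 0 :: r := by
  rcases eq_replicate_or (n + k) u with ⟨p, -, rfl⟩ | ⟨r, rfl⟩ | ⟨p, hp, r, rfl⟩
  · exact Or.inl (blockVec_replicate p)
  · exact Or.inl (blockVec_replicate_append_full r)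
  · right
    rcases lt_or_ge p n with h | h
    · exact Or.inl ⟨p, h, r, rfl⟩
    · obtain ⟨a, rfl⟩ := Nat.exists_eq_add_of_le h
      exact Or.inr ⟨⟨a, by omega⟩, r, rfl⟩

/-- Matrix blocks at the front of `u` are absorbed into `v`, so no constants multiply up. Once a
unit block is reached, only a matrix entry times a value of `θ`, at most `1` in modulus, remains. -/
theorem abs_wordMat_mulVec_blockVec_le {C : ℝ} (hC0 : 0 ≤ C)
    (hC : ∀ v, entrySum (wordMat (blockMat n k E) v) ≤ C) (u : List (Fin 2)) (v : List (Fin k))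
    (i : Fin n) : |(wordMat (blockMat n k E) v *ᵥ blockVec n k E u) i| ≤ C := by
  induction hl : u.length using Nat.strong_induction_on generalizing u v with
  | _ l ih =>
    rcases blockVec_cases (n := n) (k := k) (E := E) u with h | ⟨p, hp, r, rfl⟩ | ⟨a, r, rfl⟩
    · rw [h, Matrix.mulVec_zero]
      simpa using hC0
    · rw [blockVec_unit hp, Matrix.mulVec_single, Pi.smul_apply]
      simp only [MulOpposite.smul_eq_mul_unop, MulOpposite.unop_op, abs_mul]
      refine (mul_le_of_le_one_right (abs_nonneg _) (abs_blockFun_theta_le r)).trans ?_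
      exact (abs_entry_le (wordMat (blockMat n k E) v) i ⟨p, hp⟩).trans (hC v)
    · have h := ih r.length (by rw [← hl]; simp; omega) r (v ++ [a]) rfl
      rw [wordMat_append, wordMat_singleton, ← Matrix.mulVec_mulVec] at h
      rwa [blockVec_mat]

end Blocks

/-! ### Stable families give vanishing oscillation -/

section BlockStability

variable {n k : ℕ} {E : ℕ → ℕ → ℕ → ℝ}

theorem abs_mulVec_le {P Q : Type*} [Fintype P] [Fintype Q] (A : Matrix P Q ℝ) {z : Q → ℝ} {c : ℝ}
    (hz : ∀ j, |z j| ≤ c) (hc : 0 ≤ c) (i : P) : |(A *ᵥ z) i| ≤ entrySum A * c := by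
  calc |(A *ᵥ z) i| ≤ ∑ j, |A i j * z j| := Finset.abs_sum_le_sum_abs _ _
    _ ≤ ∑ j, |A i j| * c := Finset.sum_le_sum fun j _ => by
        rw [abs_mul]; exact mul_le_mul_of_nonneg_left (hz j) (abs_nonneg _)
    _ = (∑ j, |A i j|) * c := by rw [Finset.sum_mul]
    _ ≤ entrySum A * c := by
        refine mul_le_mul_of_nonneg_right ?_ hc
        exact Finset.single_le_sum (f := fun i => ∑ j, |A i j|)
          (fun _ _ => Finset.sum_nonneg fun _ _ => abs_nonneg _) (Finset.mem_univ i)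

/-- A long word begins with many blocks which stand for matrices, or after some of these the
oscillation is small. -/
theorem exists_blockVec_append_eq {ε : ℝ} (hε : 0 ≤ ε) {N : ℕ}
    (hN : ∀ v : List (Fin 2), N ≤ v.length → ∀ u,
      |blockFun n k E (v ++ u) (n + k + 2) 0 - blockFun n k E v (n + k + 2) 0| ≤ ε)
    (m : ℕ) (v : List (Fin 2)) (hv : (m + 1) * (n + k + 1) + N ≤ v.length) :
    ∃ (x : List (Fin k)) (z : List (Fin 2) → Fin n → ℝ),
      (∀ u, blockVec n k E (v ++ u) = wordMat (blockMat n k E) x *ᵥ z u) ∧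
      ((∀ u j, |z u j - z [] j| ≤ ε) ∨ m ≤ x.length ∧ ∀ u, ∃ y, z u = blockVec n k E y) := by
  -- A completed block has at most `n + k` letters, so the length allows for more than `m` of them,
  -- and after a unit block at least `N` letters are left to control `θ`.
  induction m generalizing v with
  | zero =>
    refine ⟨[], fun u => blockVec n k E (v ++ u), fun u => ?_, Or.inr ⟨le_rfl, fun u => ⟨_, rfl⟩⟩⟩
    rw [wordMat_nil, Matrix.one_mulVec]
  | succ m ih =>
    rw [add_mul _ 1, one_mul] at hv
    rcases eq_replicate_or (n + k) v with ⟨p, hp, rfl⟩ | ⟨r, rfl⟩ | ⟨p, hp, r, rfl⟩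
    · rw [List.length_replicate] at hv
      omega
    · refine ⟨[], fun _ => 0, fun u => ?_, Or.inl fun u j => by simpa using hε⟩
      rw [List.append_assoc, blockVec_replicate_append_full, Matrix.mulVec_zero]
    · rw [List.length_append, List.length_replicate, List.length_cons] at hv
      rcases lt_or_ge p n with h | h
      · refine ⟨[], fun u => Pi.single ⟨p, h⟩ (blockFun n k E (r ++ u) (n + k + 2) 0),
          fun u => ?_, Or.inl fun u j => ?_⟩
        · rw [List.append_assoc, List.cons_append, blockVec_unit h, wordMat_nil,
            Matrix.one_mulVec]
        · simp only [Pi.single_apply]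
          split_ifs
          · rw [List.append_nil]
            exact hN r (by omega) u
          · simpa using hε
      · obtain ⟨a, rfl⟩ := Nat.exists_eq_add_of_le h
        obtain ⟨x, z, hx, hz⟩ := ih r (by omega)
        refine ⟨⟨a, by omega⟩ :: x, z, fun u => ?_, hz.imp_right fun hz => ⟨?_, hz.2⟩⟩
        · rw [List.append_assoc, List.cons_append, blockVec_mat ⟨a, by omega⟩, hx, wordMat_cons,
            Matrix.mulVec_mulVec]
        · rw [List.length_cons]
          omega

/-- After many matrix blocks the product is small and the vectors it acts on differ by at most `2C`.
Otherwise the word has reached `θ` or the zero row, where the oscillation is small and the product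
is bounded by `C`. -/
theorem unifOscVanish_blockVec (hA : IsStable (blockMat n k E)) (i : Fin n) :
    UnifOscVanish fun v => blockVec n k E v i := by
  intro ε hε
  obtain ⟨C, hC0, hC⟩ := hA.exists_bound
  have hbd : ∀ u j, |blockVec n k E u j| ≤ C := by
    intro u j
    have h := abs_wordMat_mulVec_blockVec_le hC0 hC u [] j
    rwa [wordMat_nil, Matrix.one_mulVec] at h
  obtain ⟨m, hm⟩ := hA.exists_length (ε := ε / (2 * C + 1)) (by positivity)
  obtain ⟨N, hN⟩ := unifOscVanish_theta (n := n) (k := k) (E := E) (ε / (C + 1)) (by positivity)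
  refine ⟨(m + 1) * (n + k + 1) + N, fun v hv u => ?_⟩
  obtain ⟨x, z, hx, hz⟩ := exists_blockVec_append_eq (by positivity) hN m v hv
  have h0 := hx []
  rw [List.append_nil] at h0
  simp only [h0, hx]
  rw [← Pi.sub_apply, ← Matrix.mulVec_sub]
  rcases hz with hz | ⟨hxm, hz⟩
  · refine (abs_mulVec_le _ (c := ε / (C + 1)) (fun j => hz u j) (by positivity) i).trans ?_
    refine (mul_le_mul_of_nonneg_right (hC x) (by positivity)).trans ?_
    rw [mul_div_assoc', div_le_iff₀ (by positivity)]
    nlinarith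
  · refine (abs_mulVec_le _ (c := 2 * C) (fun j => ?_) (by positivity) i).trans ?_
    · obtain ⟨y, hy⟩ := hz u
      obtain ⟨y', hy'⟩ := hz []
      rw [Pi.sub_apply, hy, hy']
      refine (abs_sub _ _).trans ?_
      linarith [hbd y j, hbd y' j]
    · refine (mul_le_mul_of_nonneg_right (hm x hxm) (by positivity)).trans ?_
      rw [div_mul_eq_mul_div, div_le_iff₀ (by positivity)]
      nlinarith

/-- The selector moves from `i` to `i + 1` on reading `1`, so the induction descends from the zero
state at `i = n`. -/
theorem unifOscVanish_select (hA : IsStable (blockMat n k E)) {i : ℕ} (hi : i ≤ n) :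
    UnifOscVanish fun v => blockFun n k E v (n + k + 1) i := by
  induction hi using Nat.decreasingInduction with
  | self =>
    have h : ∀ v, blockFun n k E v (n + k + 1) n = 0 := fun v =>
      blockFun_large (by omega) le_rfl (by omega)
    simp only [h]
    exact unifOscVanish_const 0
  | of_succ i hi ih =>
    refine UnifOscVanish.of_cons fun a => ?_
    rcases Fin.exists_fin_two.1 ⟨a, rfl⟩ with rfl | rfl
    · simp only [blockFun_zero_cons_select hi]
      exact unifOscVanish_blockVec hA ⟨i, hi⟩
    · simp only [blockFun_one_cons_select hi]
      exact ih

end BlockStability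

/-! ### From stability to uniform continuity: dyadic points -/

section Gluing

variable {n k : ℕ} {E : ℕ → ℕ → ℕ → ℝ}

theorem tendsto_blockFun_value_zero :
    Tendsto (fun l => blockFun n k E (List.replicate l 0) (n + k + 2) 2) atTop (𝓝 0) := by
  have h : ∀ l, blockFun n k E (List.replicate l 0) (n + k + 2) 2 = (1 / 2) ^ l * (1 / 2) := by
    intro l
    induction l with
    | zero => rw [List.replicate_zero, blockFun_nil, blockFinal, if_pos (by omega)]; norm_num
    | succ l ih => rw [List.replicate_succ, blockFun_zero_cons_value, ih]; ring
  simp only [h]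
  have h1 := (tendsto_pow_atTop_nhds_zero_of_lt_one (r := (1 / 2 : ℝ)) (by norm_num)
    (by norm_num)).mul_const (1 / 2)
  rwa [zero_mul] at h1

theorem tendsto_blockFun_value_one :
    Tendsto (fun l => blockFun n k E (List.replicate l 1) (n + k + 2) 2) atTop (𝓝 1) := by
  have h : ∀ l, blockFun n k E (List.replicate l 1) (n + k + 2) 2 = 1 - (1 / 2) ^ l * (1 / 2) := by
    intro l
    induction l with
    | zero => rw [List.replicate_zero, blockFun_nil, blockFinal, if_pos (by omega)]; norm_num
    | succ l ih => rw [List.replicate_succ, blockFun_one_cons_value, ih]; ring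
  simp only [h]
  have h1 := ((tendsto_pow_atTop_nhds_zero_of_lt_one (r := (1 / 2 : ℝ)) (by norm_num)
    (by norm_num)).mul_const (1 / 2)).const_sub 1
  rwa [zero_mul, sub_zero] at h1

theorem tendsto_blockFun_tent_zero :
    Tendsto (fun l => blockFun n k E (List.replicate l 0) (n + k + 2) 1) atTop (𝓝 0) := by
  rw [← tendsto_add_atTop_iff_nat 1]
  simp only [List.replicate_succ, blockFun_zero_cons_tent]
  exact tendsto_blockFun_value_zero

theorem tendsto_blockFun_tent_one :
    Tendsto (fun l => blockFun n k E (List.replicate l 1) (n + k + 2) 1) atTop (𝓝 0) := by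
  rw [← tendsto_add_atTop_iff_nat 1]
  simp only [List.replicate_succ, blockFun_one_cons_tent]
  simpa using (tendsto_blockFun_value_one (n := n) (k := k) (E := E)).const_sub 1

theorem tendsto_blockFun_theta_zero :
    Tendsto (fun l => blockFun n k E (List.replicate l 0) (n + k + 2) 0) atTop (𝓝 0) := by
  rw [← tendsto_add_atTop_iff_nat 1]
  simp only [List.replicate_succ, blockFun_zero_cons_theta]
  exact tendsto_blockFun_tent_zero

theorem tendsto_blockFun_theta_one :
    Tendsto (fun l => blockFun n k E (List.replicate l 1) (n + k + 2) 0) atTop (𝓝 0) := by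
  rw [← tendsto_add_atTop_iff_nat 1]
  simp only [List.replicate_succ, blockFun_one_cons_theta]
  simpa using (tendsto_blockFun_tent_one (n := n) (k := k) (E := E)).neg

/-- At most two zeros lead to zero or to `θ`, which vanishes at the left end: after a matrix block
the next `0` is already a complete unit block. -/
theorem tendsto_blockFun_block_zero {p i : ℕ} (hp : p ≤ n + k) (hi : i < n) :
    Tendsto (fun l => blockFun n k E (List.replicate l 0) p i) atTop (𝓝 0) := by
  have hsmall : ∀ p i, p < n → i < n →
      Tendsto (fun l => blockFun n k E (List.replicate l 0) p i) atTop (𝓝 0) := by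
    intro p i hp hi
    rw [← tendsto_add_atTop_iff_nat 1]
    simp only [List.replicate_succ, blockFun_zero_cons_of_lt hp hi]
    split_ifs
    · exact tendsto_blockFun_theta_zero
    · exact tendsto_const_nhds
  rcases lt_or_ge p n with h | h
  · exact hsmall p i h hi
  · obtain ⟨a, rfl⟩ := Nat.exists_eq_add_of_le h
    rcases lt_or_ge a k with ha | ha
    · rw [← tendsto_add_atTop_iff_nat 1]
      simp only [List.replicate_succ, blockFun_zero_cons_add ha hi]
      have h0 : (0 : ℝ) = ∑ j : Fin n, E a i j * 0 := by simp
      rw [h0]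
      exact tendsto_finsetSum _ fun j _ => (hsmall 0 j (by omega) j.2).const_mul _
    · obtain rfl : a = k := by omega
      simp only [blockFun_dummy (show i < n + 4 by omega)]
      exact tendsto_const_nhds

theorem blockFun_replicate_one {i : ℕ} (hi : i < n) (l : ℕ) :
    blockFun n k E (List.replicate l 1) 0 i = 0 :=
  congrFun (blockVec_replicate l) ⟨i, hi⟩

/-- In block and selector states both one-sided limits are zero, because `θ` vanishes at the ends
and runs of `1` contribute nothing. In the scalar states they agree because the functions there are
continuous at `1/2`. -/
theorem tendsto_blockFun_sub {p i : ℕ} (hp : p < n + k + 3) (hi : i < n + 4) :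
    Tendsto (fun l => blockFun n k E (0 :: List.replicate l 1) p i -
      blockFun n k E (1 :: List.replicate l 0) p i) atTop (𝓝 0) := by
  rcases lt_or_ge p (n + k + 2) with hlt | hge
  · rcases lt_or_ge i n with hin | hin
    · rcases lt_trichotomy p (n + k) with h | rfl | h
      · rw [← sub_zero (0 : ℝ)]
        refine Tendsto.sub ?_ ?_
        · rcases lt_or_ge p n with hpn | hpn
          · simp only [blockFun_zero_cons_of_lt hpn hin]
            split_ifs
            · exact tendsto_blockFun_theta_one
            · exact tendsto_const_nhds
          · obtain ⟨a, rfl⟩ := Nat.exists_eq_add_of_le hpn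
            simp [blockFun_zero_cons_add (show a < k by omega) hin, blockFun_replicate_one]
        · simp only [blockFun_one_cons h hin]
          exact tendsto_blockFun_block_zero h hin
      · simp [blockFun_dummy hi]
      · obtain rfl : p = n + k + 1 := by omega
        simp only [blockFun_zero_cons_select hin, blockFun_replicate_one hin,
          blockFun_one_cons_select hin]
        simp only [zero_sub]
        refine Eq.subst (motive := fun x : ℝ => Tendsto _ atTop (𝓝 x)) neg_zero (Tendsto.neg ?_)
        rcases lt_or_ge (i + 1) n with hin' | hin'
        · rw [← tendsto_add_atTop_iff_nat 1]
          simp only [List.replicate_succ, blockFun_zero_cons_select hin']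
          exact tendsto_blockFun_block_zero (Nat.zero_le _) hin'
        · simp only [blockFun_large hlt hin' (show i + 1 < n + 4 by omega)]
          exact tendsto_const_nhds
    · simp [blockFun_large hlt hin hi]
  · obtain rfl : p = n + k + 2 := by omega
    by_cases hi4 : i < 4
    · interval_cases i
      · simp only [blockFun_zero_cons_theta, blockFun_one_cons_theta]
        simpa using (tendsto_blockFun_tent_one (n := n) (k := k) (E := E)).sub
          (tendsto_blockFun_tent_zero (n := n) (k := k) (E := E)).neg
      · simp only [blockFun_zero_cons_tent, blockFun_one_cons_tent]
        simpa using (tendsto_blockFun_value_one (n := n) (k := k) (E := E)).sub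
          ((tendsto_blockFun_value_zero (n := n) (k := k) (E := E)).const_sub 1)
      · simp only [blockFun_zero_cons_value, blockFun_one_cons_value]
        have h := ((tendsto_blockFun_value_one (n := n) (k := k) (E := E)).const_mul (1 / 2)).sub
          (((tendsto_blockFun_value_zero (n := n) (k := k) (E := E)).const_mul (1 / 2)).add_const
            (1 / 2))
        rwa [mul_one, mul_zero, zero_add, sub_self] at h
      · simp [blockFun_unit]
    · simp [blockFun_cons_of_four_le hi (not_lt.1 hi4)]

/-- A common prefix `v` acts as a fixed linear map, so agreement at `1/2` in all states gives
agreement at every dyadic point. -/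
theorem tendsto_blockAut_wordFun_sub (v : List (Fin 2)) :
    Tendsto (fun l => (blockAut n k E).wordFun (v ++ 0 :: List.replicate l 1) -
      (blockAut n k E).wordFun (v ++ 1 :: List.replicate l 0)) atTop (𝓝 0) := by
  have hcol : ∀ v, Tendsto (fun l => (blockAut n k E).col (v ++ 0 :: List.replicate l 1) -
      (blockAut n k E).col (v ++ 1 :: List.replicate l 0)) atTop (𝓝 0) := by
    intro v
    have h0 : Tendsto (fun l => (blockAut n k E).col (0 :: List.replicate l 1) -
        (blockAut n k E).col (1 :: List.replicate l 0)) atTop (𝓝 0) := by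
      rw [tendsto_pi_nhds]
      rintro ⟨p, i⟩
      have h := tendsto_blockFun_sub (n := n) (k := k) (E := E) p.2 i.2
      have he : ∀ u, blockFun n k E u p i = (blockAut n k E).col u (p, i) := by
        intro u
        rw [blockFun, extend, dif_pos ⟨p.2, i.2⟩]
      simp only [he] at h
      exact h
    have h1 : Continuous fun x : Fin (n + k + 3) × Fin (n + 4) → ℝ =>
        wordMat (blockAut n k E).wt v *ᵥ x := continuous_const.matrix_mulVec continuous_id
    have h2 := (h1.tendsto 0).comp h0
    rw [Matrix.mulVec_zero] at h2
    refine h2.congr fun l => ?_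
    simp only [Function.comp_apply, WFA.col, wordMat_append, Matrix.mulVec_sub,
      Matrix.mulVec_mulVec]
  have h1 : Continuous fun x : Fin (n + k + 3) × Fin (n + 4) → ℝ =>
      (blockAut n k E).init ⬝ᵥ x := continuous_const.dotProduct continuous_id
  have h2 := (h1.tendsto 0).comp (hcol v)
  rw [dotProduct_zero] at h2
  refine h2.congr fun l => ?_
  simp only [Function.comp_apply, dotProduct_sub]
  rfl

end Gluing

/-! ### From stability to uniform continuity: the equivalence -/

section BlockEquivalence

variable {n k : ℕ} {E : ℕ → ℕ → ℕ → ℝ}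

theorem isContinuousWFA_blockAut (hA : IsStable (blockMat n k E)) :
    IsContinuousWFA (blockAut n k E) := by
  have hosc : OscVanish (blockAut n k E).wordFun := by
    have h := (unifOscVanish_select hA (Nat.zero_le n)).oscVanish
    simpa only [← wordFun_blockAut] using h
  obtain ⟨g, hg, hlim⟩ := hosc.exists_continuous
  refine ⟨everywhereContinuous_omegaFun.2 ⟨g, hg, hlim⟩,
    (everywhereContinuous_realFun hg hlim).2 fun v => ?_⟩
  have h1 : ∀ a b : Fin 2, Tendsto
      (fun l => (blockAut n k E).wordFun (v ++ a :: List.replicate l b)) atTop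
      (𝓝 (g (app (v ++ [a]) fun _ => b))) := by
    intro a b
    have h := tendsto_pref_app.1 (hlim (app (v ++ [a]) fun _ => b))
    simpa only [pref_const, List.append_assoc, List.singleton_append] using h
  exact sub_eq_zero.1
    (tendsto_nhds_unique ((h1 0 1).sub (h1 1 0)) (tendsto_blockAut_wordFun_sub v))

theorem blockFun_select_replicate_append {p q : ℕ} (h : q + p ≤ n) (u : List (Fin 2)) :
    blockFun n k E (List.replicate p 1 ++ u) (n + k + 1) q =
      blockFun n k E u (n + k + 1) (q + p) := by
  induction p generalizing q with
  | zero => rfl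
  | succ p ih =>
    rw [List.replicate_succ, List.cons_append, blockFun_one_cons_select (by omega),
      ih (by omega)]
    congr 1
    omega

/-- The concatenation of the blocks which stand for the letters of a word. -/
def blockWord (n : ℕ) {k : ℕ} (x : List (Fin k)) : List (Fin 2) :=
  x.flatMap fun a : Fin k => List.replicate (n + a) 1 ++ [0]

theorem length_le_blockWord (x : List (Fin k)) : x.length ≤ (blockWord n x).length := by
  induction x with
  | nil => simp
  | cons a x ih =>
    rw [blockWord] at ih ⊢
    rw [List.flatMap_cons, List.length_append, List.length_append, List.length_cons,
      List.length_singleton]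
    omega

theorem blockVec_blockWord_append (x : List (Fin k)) (u : List (Fin 2)) :
    blockVec n k E (blockWord n x ++ u) =
      wordMat (blockMat n k E) x *ᵥ blockVec n k E u := by
  induction x with
  | nil => rw [wordMat_nil, Matrix.one_mulVec]; rfl
  | cons a x ih =>
    rw [wordMat_cons, ← Matrix.mulVec_mulVec, ← ih, ← blockVec_mat]
    simp [blockWord]

/-- The coding property: the first `1^i 0` selects a row, the blocks multiply the matrices, the last
`1^j 0` selects a column, and `θ` tests the entry. -/
theorem wordFun_blockAut_entry (i j : Fin n) (x : List (Fin k)) (u : List (Fin 2)) :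
    (blockAut n k E).wordFun (List.replicate i 1 ++ 0 :: (blockWord n x ++
      (List.replicate j 1 ++ 0 :: u))) =
      wordMat (blockMat n k E) x i j * blockFun n k E u (n + k + 2) 0 := by
  rw [wordFun_blockAut, blockFun_select_replicate_append (by omega), zero_add,
    blockFun_zero_cons_select i.2]
  have h := congrFun (blockVec_blockWord_append (E := E) x (List.replicate j 1 ++ 0 :: u)) i
  rw [blockVec_unit j.2, Matrix.mulVec_single] at h
  exact h

theorem isStable_of_isContinuousWFA_blockAut (h : IsContinuousWFA (blockAut n k E)) :
    IsStable (blockMat n k E) := by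
  obtain ⟨g, hg, hlim⟩ := everywhereContinuous_omegaFun.1 h.1
  have hosc := ((isAveragePreserving_blockAut (n := n) (k := k) (E := E)
    two_ne_zero).isMartingale.oscVanish hg hlim).unifOscVanish
  intro w
  rw [tendsto_matrix_zero_iff]
  intro i j
  rw [Metric.tendsto_atTop]
  intro ε hε
  -- The word is compared with its extension by `0`. The values of `θ` at the empty word and at `0`
  -- are `0` and `1/2`, so half the matrix entry is bounded by `ε/4`.
  obtain ⟨N, hN⟩ := hosc (ε / 4) (by positivity)
  refine ⟨N, fun m hm => ?_⟩
  have hlen := length_le_blockWord (n := n) (pref w m)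
  rw [length_pref] at hlen
  have h1 := hN (List.replicate i 1 ++ 0 :: (blockWord n (pref w m) ++
    (List.replicate j 1 ++ 0 :: []))) (by simp; omega) [0]
  simp only [List.append_assoc, List.cons_append, List.nil_append] at h1
  rw [wordFun_blockAut_entry, wordFun_blockAut_entry, blockFun_zero_cons_theta, blockFun_nil,
    blockFun_nil, blockFinal, blockFinal, if_pos (by omega), if_neg (by omega),
    if_neg (by omega), mul_zero, sub_zero, abs_mul, abs_of_pos (by norm_num : (0 : ℝ) < 1 / 2)]
    at h1
  rw [Real.dist_eq, sub_zero]
  linarith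

theorem isContinuousWFA_blockAut_iff :
    IsContinuousWFA (blockAut n k E) ↔ IsStable (blockMat n k E) :=
  ⟨isStable_of_isContinuousWFA_blockAut, isContinuousWFA_blockAut⟩

end BlockEquivalence

/-! ### From stability to uniform continuity: the reduction -/

section Reindex

variable {R S P Q : Type*} [CommRing R] [Fintype P] [Fintype Q] [DecidableEq P] [DecidableEq Q]

/-- The automaton with renamed states. -/
def WFA.reindex (e : P ≃ Q) (𝒜 : WFA R S P) : WFA R S Q where
  init q := 𝒜.init (e.symm q)
  final q := 𝒜.final (e.symm q)
  wt a := (𝒜.wt a).submatrix e.symm e.symm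

theorem WFA.wordFun_reindex (e : P ≃ Q) (𝒜 : WFA R S P) (v : List S) :
    (𝒜.reindex e).wordFun v = 𝒜.wordFun v := by
  have h : wordMat (𝒜.reindex e).wt v = (wordMat 𝒜.wt v).submatrix e.symm e.symm := by
    induction v with
    | nil => simp [wordMat_nil]
    | cons a v ih =>
      rw [wordMat_cons, wordMat_cons, ih]
      exact Matrix.submatrix_mul_equiv _ _ _ _ _
  rw [WFA.wordFun, h, WFA.wordFun, Matrix.submatrix_mulVec_equiv]
  have hF : (𝒜.reindex e).final ∘ e.symm.symm = 𝒜.final := by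
    funext p
    simp [WFA.reindex]
  rw [hF]
  exact comp_equiv_dotProduct_comp_equiv _ _ e.symm

omit [DecidableEq P] [DecidableEq Q] in
theorem WFA.IsAveragePreserving.reindex [Fintype S] {𝒜 : WFA R S P}
    (h : 𝒜.IsAveragePreserving) (e : P ≃ Q) : (𝒜.reindex e).IsAveragePreserving := by
  have hF : (𝒜.reindex e).final ∘ e.symm.symm = 𝒜.final := by
    funext p
    simp [WFA.reindex]
  funext q
  have h1 := congrFun h (e.symm q)
  rw [Finset.sum_apply] at h1 ⊢
  refine Eq.trans (Finset.sum_congr rfl fun a _ => ?_) h1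
  change (((𝒜.wt a).submatrix e.symm e.symm) *ᵥ (𝒜.reindex e).final) q = _
  rw [Matrix.submatrix_mulVec_equiv, hF]
  rfl

end Reindex

/-! ### From codes of families to automata -/

section StabilityToContinuity

variable {K : Type*} [Field K]

/-- Tuples of the form used for the codes of matrix families. -/
abbrev FamilyCode (K : Type*) : Type _ := ℕ × ℕ × List (List (List K))

/-- The entries of the matrices of the family with the given code. -/
def codeEntry (c : FamilyCode K) (a i j : ℕ) : K := listEntry K (c.2.2.getD a []) i j

/-- The automaton built from the matrices of the family with the given code. -/
def codeBlockAut (c : FamilyCode K) :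
    WFA K (Fin 2) (Fin ((c.1 + (c.2.1 + 1) + 3) * (c.1 + 4))) :=
  (blockAut c.1 (c.2.1 + 1) (codeEntry c)).reindex finProdFinEquiv

theorem getD_ofFn {X : Type*} {n : ℕ} (f : Fin n → X) (i : Fin n) (d : X) :
    (List.ofFn f).getD i d = f i := by
  rw [List.getD_eq_getElem _ _ (by simp), List.getElem_ofFn]

theorem codeEntry_code (B : MatrixFamily K) (a : Fin (B.predCard + 1)) (i j : Fin B.size) :
    codeEntry B.code a i j = B.mat a i j := by
  rw [← listEntry_rowList (B.mat a), ← getD_ofFn (fun a => rowList (B.mat a)) a []]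
  rfl

/-- The average preserving automaton built from a matrix family. -/
def MatrixFamily.blockAp (h2 : (2 : K) ≠ 0) (B : MatrixFamily K) : BinaryApWFA K where
  size := _
  aut := codeBlockAut B.code
  ap := (isAveragePreserving_blockAut h2).reindex _

theorem isContinuousWFA_blockAp_iff (h2 : (2 : K) ≠ 0) (B : MatrixFamily K) (φ : K →+* ℝ) :
    IsContinuousWFA ((B.blockAp h2).aut.map φ) ↔ IsStable fun a => (B.mat a).map φ := by
  have h1 : ((B.blockAp h2).aut.map φ).wordFun =
      (blockAut B.size (B.predCard + 1) fun a i j => φ (codeEntry B.code a i j)).wordFun := by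
    rw [← map_blockAut]
    funext v
    exact WFA.wordFun_reindex finProdFinEquiv
      ((blockAut B.size (B.predCard + 1) (codeEntry B.code)).map φ) v
  have h3 : blockMat B.size (B.predCard + 1) (fun a i j => φ (codeEntry B.code a i j)) =
      fun a => (B.mat a).map φ := by
    funext a
    ext i j
    exact congrArg φ (codeEntry_code B a i j)
  rw [← h3, ← isContinuousWFA_blockAut_iff, IsContinuousWFA, IsContinuousWFA, h1]

/-- The tuple `c` is the code of a matrix family. -/
def IsFamilyCode (c : FamilyCode K) : Prop :=
  (List.ofFn fun a : Fin (c.2.1 + 1) => rowList (ofRowList c.1 c.1 (c.2.2.getD a []))) = c.2.2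

theorem isFamilyCode_iff (c : FamilyCode K) :
    IsFamilyCode c ↔ ∃ B : MatrixFamily K, B.code = c := by
  constructor
  · intro h
    exact ⟨⟨c.1, c.2.1, fun a => ofRowList c.1 c.1 (c.2.2.getD a [])⟩,
      Prod.ext rfl (Prod.ext rfl h)⟩
  · rintro ⟨⟨n, k, A⟩, rfl⟩
    refine congrArg List.ofFn (funext fun a => ?_)
    exact (congrArg (fun l => rowList (ofRowList n n l))
      (getD_ofFn (fun a => rowList (A a)) a [])).trans
      (congrArg rowList (ofRowList_rowList (A a)))

variable [Primcodable K]

theorem computablePred_isFamilyCode : ComputablePred (IsFamilyCode (K := K)) := by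
  have h1 : Computable fun q : FamilyCode K × ℕ => q.1.1 := Computable.fst.comp Computable.fst
  have h2 : Computable fun c : FamilyCode K => c.2.2 := Computable.snd.comp Computable.snd
  have h3 : ComputableMatrix fun q : FamilyCode K × ℕ =>
      ofRowList q.1.1 q.1.1 (q.1.2.2.getD q.2 []) :=
    .ofRowList h1 h1 (Computable.list_getD (h2.comp Computable.fst) Computable.snd [])
  exact computablePred_eq (Computable.list_generate (n := fun c : FamilyCode K => c.2.1 + 1)
    (f := fun q => rowList (ofRowList q.1.1 q.1.1 (q.1.2.2.getD q.2 [])))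
    (Computable.succ.comp (Computable.fst.comp Computable.snd)) h3) h2

/-! ### Computability of the block automaton -/

section Output

variable {β : Type*} [Primcodable β]

theorem computablePred_and_eq {p i x y : β → ℕ} (hp : Computable p) (hi : Computable i)
    (hx : Computable x) (hy : Computable y) : ComputablePred fun b => p b = x b ∧ i b = y b :=
  (computablePred_eq hp hx).and (computablePred_eq hi hy)

theorem computablePred_lt {p x : β → ℕ} (hp : Computable p) (hx : Computable x) :
    ComputablePred fun b => p b < x b :=
  PrimrecRel.computablePred_comp Primrec.nat_lt hp hx

theorem computable_single (c : K) {p i x y : β → ℕ} (hp : Computable p) (hi : Computable i)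
    (hx : Computable x) (hy : Computable y) :
    Computable fun b => single c (x b) (y b) (p b) (i b) :=
  (computablePred_and_eq hp hi hx hy).computable_ite (Computable.const c) (Computable.const 0)

theorem Computable.add_nat {f g : β → ℕ} (hf : Computable f) (hg : Computable g) :
    Computable fun b => f b + g b := Primrec.nat_add.to_comp.comp hf hg

theorem computable_blockFinal {n k p i : β → ℕ} (hn : Computable n) (hk : Computable k)
    (hp : Computable p) (hi : Computable i) :
    Computable fun b => (blockFinal (n b) (k b) (p b) (i b) : K) := by
  have h2 := Computable.add_nat (Computable.add_nat hn hk) (Computable.const 2)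
  exact ((computablePred_eq hp h2).and ((computablePred_eq hi (Computable.const 1)).or
    (computablePred_eq hi (Computable.const 2)))).computable_ite (Computable.const _)
    ((computablePred_and_eq hp hi h2 (Computable.const 3)).computable_ite (Computable.const 1)
      (Computable.const 0))

theorem computable_blockRow (hadd : Computable₂ fun x y : K => x + y) (a : Fin 2)
    {n k p i p' i' : β → ℕ} (hn : Computable n) (hk : Computable k)
    (hp : Computable p) (hi : Computable i) (hp' : Computable p') (hi' : Computable i')
    {E : β → ℕ → ℕ → ℕ → K} (hE : Computable fun b => E b (p b - n b) (i b) (i' b)) :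
    Computable fun b => blockRow (n b) (k b) (E b) a (p b) (i b) (p' b) (i' b) := by
  have hc : ∀ m : ℕ, Computable fun _ : β => m := fun m => Computable.const m
  have hnk := Computable.add_nat hn hk
  have h1 := Computable.add_nat hnk (hc 1)
  have h2 := Computable.add_nat hnk (hc 2)
  have ha : ComputablePred fun _ : β => a = 0 :=
    computablePred_eq (Computable.const a) (Computable.const 0)
  have hin := computablePred_lt hi hn
  have hs := fun (c : K) {x y : β → ℕ} (hx : Computable x) (hy : Computable y) =>
    computable_single c hp' hi' hx hy
  have h0 : Computable fun _ : β => (0 : K) := Computable.const 0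
  have hrow := ((computablePred_eq hp' (hc 0)).and (computablePred_lt hi' hn)).computable_ite hE h0
  have hunit := (computablePred_eq hi hp).computable_ite (hs 1 h2 (hc 0)) h0
  have hblock := ha.computable_ite ((computablePred_lt hp hn).computable_ite hunit hrow)
    (hs 1 (Computable.add_nat hp (hc 1)) hi)
  have hselect := ha.computable_ite (hs 1 (hc 0) hi) (hs 1 h1 (Computable.add_nat hi (hc 1)))
  have htheta := ha.computable_ite (hs 1 h2 (hc 1)) (hs (-1) h2 (hc 1))
  have htent := ha.computable_ite (hs 1 h2 (hc 2))
    (hadd.comp (hs (-1) h2 (hc 2)) (hs 1 h2 (hc 3)))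
  have hvalue := ha.computable_ite (hs (1 / 2) h2 (hc 2))
    (hadd.comp (hs (1 / 2) h2 (hc 2)) (hs (1 / 2) h2 (hc 3)))
  have hstate := fun m => computablePred_and_eq hp hi h2 (hc m)
  have hall := ((computablePred_lt hp hnk).and hin).computable_ite hblock
    (((computablePred_eq hp h1).and hin).computable_ite hselect
    ((hstate 0).computable_ite htheta ((hstate 1).computable_ite htent
    ((hstate 2).computable_ite hvalue ((hstate 3).computable_ite (hs 1 h2 (hc 3)) h0)))))
  refine hall.of_eq fun b => ?_
  simp only [blockRow, ite_apply]

/-- The code of the automaton built from the matrices of the family with the given code. -/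
def blockCode (c : FamilyCode K) : AutomatonCode K :=
  ((c.1 + (c.2.1 + 1) + 3) * (c.1 + 4), List.ofFn (codeBlockAut c).init,
    List.ofFn (codeBlockAut c).final, rowList ((codeBlockAut c).wt 0),
    rowList ((codeBlockAut c).wt 1))

theorem computable_blockCode (hadd : Computable₂ fun x y : K => x + y) :
    Computable (blockCode (K := K)) := by
  have hn : Computable fun c : FamilyCode K => c.1 := Computable.fst
  have hk : Computable fun c : FamilyCode K => c.2.1 + 1 :=
    Computable.succ.comp (Computable.fst.comp Computable.snd)
  have hM : Computable fun c : FamilyCode K => c.1 + 4 :=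
    Computable.add_nat hn (Computable.const 4)
  have hsize : Computable fun c : FamilyCode K => (c.1 + (c.2.1 + 1) + 3) * (c.1 + 4) :=
    Primrec.nat_mul.to_comp.comp
      (Computable.add_nat (Computable.add_nat hn hk) (Computable.const 3)) hM
  -- The inverse of `finProdFinEquiv` is quotient and remainder modulo the number `n + 4` of
  -- columns.
  have hdiv : ∀ {β : Type _} [Primcodable β] {c : β → FamilyCode K} {q : β → ℕ}, Computable c →
      Computable q → Computable fun b => q b / ((c b).1 + 4) := fun hc hq =>
    Primrec.nat_div.to_comp.comp hq (hM.comp hc)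
  have hmod : ∀ {β : Type _} [Primcodable β] {c : β → FamilyCode K} {q : β → ℕ}, Computable c →
      Computable q → Computable fun b => q b % ((c b).1 + 4) := fun hc hq =>
    Primrec.nat_mod.to_comp.comp hq (hM.comp hc)
  have hinit : Computable fun q : FamilyCode K × ℕ =>
      single (1 : K) (q.1.1 + (q.1.2.1 + 1) + 1) 0 (q.2 / (q.1.1 + 4)) (q.2 % (q.1.1 + 4)) :=
    computable_single 1 (hdiv Computable.fst Computable.snd) (hmod Computable.fst Computable.snd)
      ((Computable.add_nat (Computable.add_nat hn hk) (Computable.const 1)).comp Computable.fst)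
      (Computable.const 0)
  have hfinal : Computable fun q : FamilyCode K × ℕ =>
      (blockFinal q.1.1 (q.1.2.1 + 1) (q.2 / (q.1.1 + 4)) (q.2 % (q.1.1 + 4)) : K) :=
    computable_blockFinal (hn.comp Computable.fst) (hk.comp Computable.fst)
      (hdiv Computable.fst Computable.snd) (hmod Computable.fst Computable.snd)
  have hwt : ∀ a, ComputableMatrix fun c : FamilyCode K => (codeBlockAut c).wt a := by
    intro a
    have hc : Computable fun q : (FamilyCode K × ℕ) × ℕ => q.1.1 :=
      Computable.fst.comp Computable.fst
    have hr : Computable fun q : (FamilyCode K × ℕ) × ℕ => q.1.2 :=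
      Computable.snd.comp Computable.fst
    have hs : Computable fun q : (FamilyCode K × ℕ) × ℕ => q.2 := Computable.snd
    have hE : Computable fun q : (FamilyCode K × ℕ) × ℕ =>
        codeEntry q.1.1 (q.1.2 / (q.1.1.1 + 4) - q.1.1.1) (q.1.2 % (q.1.1.1 + 4))
          (q.2 % (q.1.1.1 + 4)) :=
      computable_listEntry (Computable.list_getD
        ((Computable.snd.comp Computable.snd).comp hc)
        (Primrec.nat_sub.to_comp.comp (hdiv hc hr) (hn.comp hc)) []) (hmod hc hr) (hmod hc hs)
    exact .of_entries hsize hsize (computable_blockRow hadd a (hn.comp hc) (hk.comp hc)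
      (hdiv hc hr) (hmod hc hr) (hdiv hc hs) (hmod hc hs) hE) fun c i j => rfl
  exact hsize.pair ((Computable.list_generate hsize hinit).pair
    ((Computable.list_generate hsize hfinal).pair ((hwt 0).pair (hwt 1))))

end Output

theorem matrixProductStability_le (hadd : Computable₂ fun x y : K => x + y) (φ : K →+* ℝ) :
    matrixProductStability φ ≤ᵀ apWFAUniformContinuity φ := by
  have h2 : (2 : K) ≠ 0 := by
    intro h
    have h1 := congrArg φ h
    rw [map_ofNat, map_zero] at h1
    exact two_ne_zero h1
  -- The automaton is computed directly from the family, so nothing has to be searched and the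
  -- certificate is trivial.
  refine decisionFun_le_of_certificates (T := Unit) (chk := fun _ => True)
    (out := fun q => blockCode q.1) MatrixFamily.code_injective BinaryApWFA.code_injective
    computablePred_isFamilyCode isFamilyCode_iff (Computable.computablePred (Computable.const true))
    ((computable_blockCode hadd).comp Computable.fst)
    (MatrixFamily.blockAp h2 ⟨1, 0, fun _ => Matrix.of fun _ _ => 1⟩)
    (fun h => Certificate.not_isStable_one φ ((isContinuousWFA_blockAp_iff h2 _ φ).1 h))
    (fun _ => ⟨(), trivial⟩) ?_
  intro B _ _
  exact ⟨B.blockAp h2, rfl, (isContinuousWFA_blockAp_iff h2 B φ).symm⟩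

end StabilityToContinuity

end

end ApWFA

theorem mainTheorem4 {K : Type*} [Field K] [Primcodable K] (φ : K →+* ℝ)
    (hadd : Computable₂ fun x y : K => x + y)
    (hmul : Computable₂ fun x y : K => x * y)
    (hdiv : Computable₂ fun x y : K => x / y) :
    ApWFA.matrixProductStability φ ≤ᵀ ApWFA.apWFAUniformContinuity φ ∧
      ApWFA.apWFAUniformContinuity φ ≤ᵀ ApWFA.matrixProductStability φ := by
  exact ⟨ApWFA.matrixProductStability_le hadd φ, ApWFA.apWFAUniformContinuity_le hadd hmul φ⟩
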